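/- Let $d\ge 3$, and let $D$ be a distribution on $\mathbb S^{d-1}\times\{+1,-1\}$ whose marginal on the unit sphere $\mathbb S^{d-1}\subset\mathbb R^d$ is uniform. For $w\in\mathbb S^{d-1}$ let $h_w(x)=\operatorname{sign}(w\cdot x)$ (with $\operatorname{sign}(0)=+1$) and $\operatorname{err}(h_w)=\mathbb P_{(X,Y)\sim D}[h_w(X)\ne Y]$. Suppose $D$ satisfies the $\nu$-adversarial noise condition with respect to $u\in\mathbb S^{d-1}$, i.e. $\mathbb P_D[Y\neq \operatorname{sign}(u\cdot X)]\le\nu$. The algorithm PASSIVE-PERCEPTRON has inputs $v_0\in\mathbb S^{d-1}$, $\epsilon$, $\delta$, $(m_k)_{k\ge1}$, $(b_k)_{k\ge1}$ and access to i.i.d. examples from $D$. For $k=1,\dots,\lceil\log_2(1/\epsilon)\rceil$ it sets $w_0=v_{k-1}$; for $t=0,\dots,m_k-1$ it draws examples until it gets $(x_t,y_t)$ with $b_k/2\le w_t\cdot x_t\le b_k$, and sets $w_{t+1}=w_t-2\,\mathbf 1\{y_t\,w_t\cdot x_t<0\}\,(w_t\cdot x_t)\,x_t$; then it sets $v_k=w_{m_k}$.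 It outputs the last $v_k$. Its running time is the number of elementary steps on a real-number random access machine (an arithmetic operation on, or a comparison of, two real numbers, a table look-up and one step of loop control cost $1$ each; drawing an example costs $d+1$; computing $\lceil\log_2 r\rceil$ for $r\geq 1$ costs $2(\lceil\log_2 r\rceil+1)$). The following holds for all sufficiently small band constants and all sufficiently large sample constants. There is an absolute constant $\beta_0>0$ such that for all $0<\beta_1\le\beta_2\le\beta_0$ there is $\mu_0>0$ such that for all $\mu_0\le\mu_1\le\mu_2$ there are constants $c,C>0$, depending on $\beta_1,\beta_2,\mu_1,\mu_2$ only, with the following property. Let $d$, $D$, $u$, $\nu$ be as above, let $0<\epsilon\le\frac12$, $0<\delta<1$, let $v_0\in\mathbb S^{d-1}$ have angle at most $\frac\pi2$ with $u$, and suppose that for all $k\ge1$ $$\mu_1\, d\Big(\ln d+\ln\frac k\delta\Big)\le m_k\le\mu_2\, d\Big(\ln d+\ln\frac k\delta\Big),\qquad \frac{\beta_1 2^{-k}}{\sqrt d\,\ln(km_k/\delta)}\le b_k\le\frac{\beta_2 2^{-k}}{\sqrt d\,\ln(km_k/\delta)},$$ and that $$\nu\le \frac{c\,\epsilon}{\ln\ln\frac1\epsilon+\ln\frac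 d\delta}.$$ Then with probability at least $1-\delta$ PASSIVE-PERCEPTRON halts, and 1. its output $v\in\mathbb S^{d-1}$ satisfies $\operatorname{err}(h_v)\le\operatorname{err}(h_u)+\epsilon$; 2. the number of labeled examples drawn is at most $C\, d\,\big(\ln d+\ln\frac1\delta+\ln\ln\frac1\epsilon\big)^2\cdot\frac1\epsilon\ln\frac1\epsilon$, i.e. $d/\epsilon$ up to logarithmic factors; 3. the running time is at most $C\, d^2\,\big(\ln d+\ln\frac1\delta+\ln\ln\frac1\epsilon\big)^2\cdot\frac1\epsilon\ln\frac1\epsilon$, i.e. $d^2/\epsilon$ up to logarithmic factors. -/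

import Mathlib

open MeasureTheory Metric
open scoped RealInnerProductSpace

noncomputable section

namespace Halfspace

/-! ### Halfspaces, examples, noise -/

/-- The unit sphere of `ℝ^d`, as a set of unit vectors of Euclidean space. -/
abbrev Sphere (d : ℕ) : Type := sphere (0 : EuclideanSpace ℝ (Fin d)) 1

/-- A labeled example `(x, y)`, with `x` on the unit sphere and `y ∈ {+1, -1}` (the units of `ℤ`). -/
abbrev Example (d : ℕ) : Type := Sphere d × ℤˣ

/-- The uniform probability distribution on the unit sphere: normalized surface measure. -/
def uniformSphere (d : ℕ) : Measure (Sphere d) :=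
  ((volume : Measure (EuclideanSpace ℝ (Fin d))).toSphere Set.univ)⁻¹ •
    (volume : Measure (EuclideanSpace ℝ (Fin d))).toSphere

/-- The homogeneous halfspace `h_w(x) = sign(w ⬝ x)`, with the convention `sign 0 = +1`. -/
def halfspace {d : ℕ} (w x : Sphere d) : ℤˣ :=
  if 0 ≤ ⟪(w : EuclideanSpace ℝ (Fin d)), (x : EuclideanSpace ℝ (Fin d))⟫ then 1 else -1

/-- The error rate `err(h_w) = P_{(X,Y) ∼ D}[h_w(X) ≠ Y]`. -/
def err {d : ℕ} (D : Measure (Example d)) (w : Sphere d) : ℝ :=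
  D.real {z | halfspace w z.1 ≠ z.2}

/-- The `ν`-adversarial noise condition with respect to `u`: `P[Y ≠ sign(u ⬝ X)] ≤ ν`. -/
def AdversarialNoise {d : ℕ} (D : Measure (Example d)) (ν : ℝ) (u : Sphere d) : Prop :=
  D.real {z | z.2 ≠ halfspace u z.1} ≤ ν

/-! ### A real-number random access machine that reads a stream of examples

A computation receives the whole stream of examples but can look at it only through `RAM.draw`,
which returns the next example.  The resources used so far are the number of examples drawn and the
number of elementary steps performed; `none` stands for a computation that does not return. -/

/-- The resources used by a computation. -/
structure Usage where
  /-- number of labeled examples drawn -/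
  drawn : ℕ
  /-- number of elementary steps performed -/
  steps : ℕ

/-- Computations with a result in `α` that read examples in dimension `d`. -/
def RAM (d : ℕ) (α : Type) : Type := (ℕ → Example d) → Usage → Option (α × Usage)

instance (d : ℕ) : Monad (RAM d) where
  pure a := fun _ s => some (a, s)
  bind p f := fun z s => (p z s).bind fun r => f r.1 z r.2

namespace RAM

variable {d : ℕ}

/-- Return `a` and charge `c` steps. -/
def charge {α : Type} (c : ℕ) (a : α) : RAM d α := fun _ s => some (a, ⟨s.drawn, s.steps + c⟩)

/-- The computation that does not return. -/
def diverge {α : Type} : RAM d α := fun _ _ => none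

/-- One step of loop control. -/
def tick : RAM d Unit := charge 1 ()

/-- Reading one entry of a table. -/
def read {α : Type} (a : α) : RAM d α := charge 1 a

/-- Addition of two real numbers, in one step. -/
def add (x y : ℝ) : RAM d ℝ := charge 1 (x + y)

/-- Subtraction of two real numbers, in one step. -/
def sub (x y : ℝ) : RAM d ℝ := charge 1 (x - y)

/-- Multiplication of two real numbers, in one step. -/
def mul (x y : ℝ) : RAM d ℝ := charge 1 (x * y)

/-- Division of two real numbers, in one step. -/
def div (x y : ℝ) : RAM d ℝ := charge 1 (x / y)

open Classical in
/-- The test `x ≤ y`, in one step. -/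
def le (x y : ℝ) : RAM d Bool := charge 1 (decide (x ≤ y))

open Classical in
/-- The test `x < y`, in one step. -/
def lt (x y : ℝ) : RAM d Bool := charge 1 (decide (x < y))

/-- Draw the next labeled example `(x, y)` of the stream.  Storing the `d` coordinates of `x` and
the label `y` takes `d + 1` steps. -/
def draw : RAM d ((Fin d → ℝ) × ℝ) := fun z s =>
  some ((fun i => ((z s.drawn).1 : EuclideanSpace ℝ (Fin d)) i, (((z s.drawn).2 : ℤ) : ℝ)),
    ⟨s.drawn + 1, s.steps + (d + 1)⟩)

/-- `⌈log₂ r⌉`, found by comparing `r` with `1, 2, 4, …`: a doubling and a comparison for each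
power of two that is tried. -/
def ceilLogTwo (r : ℝ) : RAM d ℕ :=
  charge (2 * (⌈Real.logb 2 r⌉₊ + 1)) ⌈Real.logb 2 r⌉₊

/-- The inner product `w ⬝ x`, accumulated coordinate by coordinate. -/
def dot (w x : Fin d → ℝ) : RAM d ℝ :=
  (List.finRange d).foldlM (init := 0) fun acc i => do
    tick
    let p ← mul (w i) (x i)
    add acc p

/-- The vector `w - c • x`, computed coordinate by coordinate. -/
def subSmul (w : Fin d → ℝ) (c : ℝ) (x : Fin d → ℝ) : RAM d (Fin d → ℝ) :=
  (List.finRange d).foldlM (init := w) fun v i => do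
    tick
    let p ← mul c (x i)
    let q ← sub (w i) p
    return Function.update v i q

end RAM

/-! ### Passive-Perceptron

The loop "repeat drawing until the example is in the region" need not end.  It is therefore run with
an upper bound `N` on the number of trials of a single execution of this loop, beyond which the
computation does not return; the bound is existentially quantified in `Outputs`, and it is not
visible to the algorithm. -/

/-- Repeat drawing examples `(x, y)` until `b / 2 ≤ w ⬝ x ≤ b`; return the last one. -/
def rejectionSample {d : ℕ} (w : Fin d → ℝ) (b : ℝ) : ℕ → RAM d ((Fin d → ℝ) × ℝ)
  | 0 => RAM.diverge
  | N + 1 => do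
    RAM.tick
    let (x, y) ← RAM.draw
    let s ← RAM.dot w x
    let h ← RAM.div b 2
    let lo ← RAM.le h s
    let hi ← RAM.le s b
    if lo && hi then return (x, y) else rejectionSample w b N

/-- The update `w - 2 𝟙{y (w ⬝ x) < 0} (w ⬝ x) x`. -/
def perceptronUpdate {d : ℕ} (w x : Fin d → ℝ) (y : ℝ) : RAM d (Fin d → ℝ) := do
  let s ← RAM.dot w x
  let p ← RAM.mul y s
  let mistake ← RAM.lt p 0
  if mistake then
    let c ← RAM.mul 2 s
    RAM.subSmul w c x
  else return w

/-- Passive-Modified-Perceptron with initial halfspace `w`, angle upper bound `θ` and confidence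
`δ` (these two inputs are not used by the procedure), `m` iterations and band width `b`. -/
def passiveModifiedPerceptron {d : ℕ} (N : ℕ) (w : Fin d → ℝ) (_θ _δ : ℝ) (m : ℕ) (b : ℝ) :
    RAM d (Fin d → ℝ) :=
  iter m w
where
  /-- `t` further iterations, from the current vector `w`. -/
  iter : ℕ → (Fin d → ℝ) → RAM d (Fin d → ℝ)
  | 0, w => return w
  | t + 1, w => do
    RAM.tick
    let (x, y) ← rejectionSample w b N
    let w' ← perceptronUpdate w x y
    iter t w'

/-- Passive-Perceptron with initial halfspace `v₀`, target error `ε`, confidence `δ`, sample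
schedule `m` and band widths `b`: for `k = 1, …, ⌈log₂ (1 / ε)⌉`, call
Passive-Modified-Perceptron on `v_{k-1}`, `π / 2 ^ k`, `δ / (k (k + 1))`, `m k`, `b k`. -/
def passivePerceptron {d : ℕ} (N : ℕ) (v₀ : Fin d → ℝ) (ε δ : ℝ) (m : ℕ → ℕ) (b : ℕ → ℝ) :
    RAM d (Fin d → ℝ) := do
  let r ← RAM.div 1 ε
  let k₀ ← RAM.ceilLogTwo r
  epochs k₀ 1 Real.pi v₀
where
  /-- `n` further epochs, the next of which is epoch `k`; `θ` is `π / 2 ^ (k - 1)`, and `v` is the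
  current halfspace. -/
  epochs : ℕ → ℕ → ℝ → (Fin d → ℝ) → RAM d (Fin d → ℝ)
  | 0, _, _, v => return v
  | n + 1, k, θ, v => do
    RAM.tick
    let θk ← RAM.div θ 2
    let k' ← RAM.add k 1
    let q ← RAM.mul k k'
    let δk ← RAM.div δ q
    let mk ← RAM.read (m k)
    let bk ← RAM.read (b k)
    let v' ← passiveModifiedPerceptron N v θk δk mk bk
    epochs n (k + 1) θk v'

/-- On the stream of examples `z`, Passive-Perceptron halts with output `v`, after drawing
`n` labeled examples and performing `T` steps. -/
def Outputs {d : ℕ} (z : ℕ → Example d) (v₀ : Sphere d) (ε δ : ℝ) (m : ℕ → ℕ) (b : ℕ → ℝ)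
    (v : Sphere d) (n T : ℕ) : Prop :=
  ∃ N : ℕ, passivePerceptron N (fun i => (v₀ : EuclideanSpace ℝ (Fin d)) i) ε δ m b z ⟨0, 0⟩ =
    some (fun i => (v : EuclideanSpace ℝ (Fin d)) i, ⟨n, T⟩)

/-- `m_k = Θ(d (ln d + ln (k / δ)))` for `k ≥ 1`, with hidden constants `μ₁` and `μ₂`. -/
def SampleSchedule (d : ℕ) (δ μ₁ μ₂ : ℝ) (m : ℕ → ℕ) : Prop :=
  ∀ k : ℕ, 1 ≤ k →
    μ₁ * (d * (Real.log d + Real.log (k / δ))) ≤ m k ∧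
    m k ≤ μ₂ * (d * (Real.log d + Real.log (k / δ)))

/-- `b_k = Θ(2 ^ (-k) / (√d ln (k m_k / δ)))` for `k ≥ 1`, with hidden constants `β₁` and `β₂`. -/
def BandSchedule (d : ℕ) (δ β₁ β₂ : ℝ) (m : ℕ → ℕ) (b : ℕ → ℝ) : Prop :=
  ∀ k : ℕ, 1 ≤ k →
    β₁ * ((1 / 2) ^ k / (√d * Real.log (k * m k / δ))) ≤ b k ∧
    b k ≤ β₂ * ((1 / 2) ^ k / (√d * Real.log (k * m k / δ)))

end Halfspace

end

/-! The quantity to follow is `Φ = 1 - u ⬝ w`. A mistake reflects `w` in the hyperplane orthogonal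
to `x`, so `w` stays a unit vector. Inside the band `w ⬝ x > 0`, so a mistake means `y = -1`, and
`Φ` then changes by `2 (w ⬝ x)(u ⬝ x)`. This is negative unless the label is noisy.

Drift of one step. Let `S` be the sine of the angle between `w` and `u`, and write `u = α w + S e`
with `e` a unit vector orthogonal to `w`. Given the band, the distribution is still invariant under
the reflections that fix `w`, so `e ⬝ x` is symmetric, of typical size `1 / √d`. As `b √d` is much
smaller than `S`, the variable `u ⬝ x` is essentially `S (e ⬝ x)`, and `Φ` decreases by order `b S /
√d` on average. The second moment of `u ⬝ x` controls both the quadratic term of the exponential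
and, by AM-GM, the noisy examples, provided that the noise rate is a small fraction of the mass of
the band. Hence `exp (Λ Φ)` contracts conditionally on the band (`integral_exp_angleGain_le`). The
moments come from reflection symmetry alone, and the mass of a band and of a disagreement region
from averaging over the rotations of a plane (`le_measure_slab`, `measure_disagreement_le`).

One epoch. With `τ = 2 ^ (-k)`, `L = ln (k m_k / δ)` and `Λ = 64 L / τ²`, an epoch starts at `Φ ≤ 4
τ²` and should end at `Φ ≤ τ² / 8`. The three terms of `potential` watch the target, a barrier at `6
τ²` that `Φ` should not cross, and the steps taken from so low a level that contraction is not
available. The potential is a supermartingale as long as it is below `1` (`integral_potential_le`),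
it is at least `1` when the epoch fails, and it starts below `δ / (2 k (k + 1))` because `m_k` is
large compared with `d L` (`potential_le_of_init`). These bounds sum to at most `δ / 2`.

Whole run. `Succeeds` describes a run by recursion on the number of examples still available, so
that the failure probability satisfies a one-example recursion. The theorem `failProb_le` solves it
by induction, with no stopping times: a state of potential at least `1` has the trivial bound. The
extra term `2 ^ t (1 - p / 2) ^ n` accounts for running out of examples when every band has mass at
least `p`. Here `p` is of order `ε / Γ` with `Γ = ln d + ln (1 / δ) + ln ln (1 / ε)`, so `n` of
order `(∑ m_k + Γ) / p` makes this term at most `δ / 2`. Each example costs at most `10 d + 9`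
steps, which gives the running time, and `err_le` converts the final `Φ` into excess error. -/

noncomputable section

namespace Halfspace

open scoped ENNReal

variable {d : ℕ}

/-! ### Symmetries of the uniform distribution on the sphere -/

/-- A linear isometry acts on the unit sphere. -/
def sphereMap (g : EuclideanSpace ℝ (Fin d) ≃ₗᵢ[ℝ] EuclideanSpace ℝ (Fin d)) (x : Sphere d) :
    Sphere d :=
  ⟨g x, by simp⟩

@[simp] lemma coe_sphereMap (g : EuclideanSpace ℝ (Fin d) ≃ₗᵢ[ℝ] EuclideanSpace ℝ (Fin d))
    (x : Sphere d) : (sphereMap g x : EuclideanSpace ℝ (Fin d)) = g x := rfl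

lemma continuous_sphereMap (g : EuclideanSpace ℝ (Fin d) ≃ₗᵢ[ℝ] EuclideanSpace ℝ (Fin d)) :
    Continuous (sphereMap g) :=
  (g.continuous.comp continuous_subtype_val).subtype_mk _

lemma isProbabilityMeasure_uniformSphere (hd : 1 ≤ d) :
    IsProbabilityMeasure (uniformSphere d) := by
  have : Nonempty (Fin d) := ⟨⟨0, hd⟩⟩
  have h0 : (volume : Measure (EuclideanSpace ℝ (Fin d))).toSphere ≠ 0 := Measure.toSphere_ne_zero _
  constructor
  rw [uniformSphere, Measure.smul_apply, smul_eq_mul]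
  exact ENNReal.inv_mul_cancel (Measure.measure_univ_ne_zero.2 h0) (measure_ne_top _ _)

-- `toSphere` measures a set by the volume of the truncated cone over it. A linear isometry carries
-- such cones to such cones and preserves volume.
open scoped Pointwise in
lemma measurePreserving_sphereMap
    (g : EuclideanSpace ℝ (Fin d) ≃ₗᵢ[ℝ] EuclideanSpace ℝ (Fin d)) :
    MeasurePreserving (sphereMap g) (uniformSphere d) (uniformSphere d) := by
  have hg := (continuous_sphereMap g).measurable
  have key : MeasurePreserving (sphereMap g)
      (volume : Measure (EuclideanSpace ℝ (Fin d))).toSphere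
      (volume : Measure (EuclideanSpace ℝ (Fin d))).toSphere := by
    refine ⟨hg, ?_⟩
    ext s hs
    rw [Measure.map_apply hg hs, Measure.toSphere_apply' _ (hg hs), Measure.toSphere_apply' _ hs]
    congr 1
    rw [← g.measurePreserving.measure_preimage_emb g.toHomeomorph.measurableEmbedding
      (Set.Ioo (0 : ℝ) 1 • (Subtype.val '' s))]
    congr 1
    ext x
    simp only [Set.mem_smul, Set.mem_image, Set.mem_preimage]
    constructor
    · rintro ⟨r, hr, _, ⟨y, hy, rfl⟩, rfl⟩
      exact ⟨r, hr, _, ⟨_, hy, rfl⟩, by simp⟩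
    · rintro ⟨r, hr, _, ⟨y, hy, rfl⟩, h⟩
      refine ⟨r, hr, _, ⟨sphereMap g.symm y, ?_, rfl⟩, ?_⟩
      · have : sphereMap g (sphereMap g.symm y) = y := by ext1; simp
        simpa [this] using hy
      · apply g.injective
        simpa using h
  refine ⟨hg, ?_⟩
  rw [uniformSphere, Measure.map_smul, key.map_eq]

/-- The reflection of the sphere in the hyperplane orthogonal to `f`. -/
def sphereReflection (f : EuclideanSpace ℝ (Fin d)) : Sphere d → Sphere d :=
  sphereMap (Submodule.reflection (ℝ ∙ f)ᗮ)

lemma inner_sphereReflection (f g : EuclideanSpace ℝ (Fin d)) (x : Sphere d) :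
    ⟪g, (sphereReflection f x : EuclideanSpace ℝ (Fin d))⟫ =
      ⟪Submodule.reflection (ℝ ∙ f)ᗮ g, (x : EuclideanSpace ℝ (Fin d))⟫ := by
  rw [sphereReflection, coe_sphereMap,
    ← LinearIsometryEquiv.inner_map_map (Submodule.reflection (ℝ ∙ f)ᗮ) g,
    Submodule.reflection_reflection]

/-- `ν` is invariant under the reflections in hyperplanes orthogonal to a vector of `V`. -/
def ReflectionInvariant (ν : Measure (Sphere d)) (V : Submodule ℝ (EuclideanSpace ℝ (Fin d))) :
    Prop :=
  ∀ f ∈ V, MeasurePreserving (sphereReflection f) ν ν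

lemma reflectionInvariant_uniformSphere : ReflectionInvariant (uniformSphere d) ⊤ :=
  fun _ _ => measurePreserving_sphereMap _

/-- For `f` orthogonal to `w`, the reflection fixes `w` and hence every set defined through `w ⬝ x`.
Conditioning on a band therefore keeps all the symmetry in the directions orthogonal to `w`. -/
lemma ReflectionInvariant.restrict {ν : Measure (Sphere d)} (hν : ReflectionInvariant ν ⊤)
    (w : EuclideanSpace ℝ (Fin d)) {I : Set ℝ} (hI : MeasurableSet I) :
    ReflectionInvariant (ν.restrict {x | ⟪w, (x : EuclideanSpace ℝ (Fin d))⟫ ∈ I}) (ℝ ∙ w)ᗮ := by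
  intro f hf
  have hs : MeasurableSet {x : Sphere d | ⟪w, (x : EuclideanSpace ℝ (Fin d))⟫ ∈ I} :=
    (by fun_prop : Measurable fun x : Sphere d => ⟪w, (x : EuclideanSpace ℝ (Fin d))⟫) hI
  have h := (hν f trivial).restrict_preimage hs
  have e : sphereReflection f ⁻¹' {x : Sphere d | ⟪w, (x : EuclideanSpace ℝ (Fin d))⟫ ∈ I} =
      {x : Sphere d | ⟪w, (x : EuclideanSpace ℝ (Fin d))⟫ ∈ I} := by
    ext x
    have hw : Submodule.reflection (ℝ ∙ f)ᗮ w = w := by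
      rw [Submodule.reflection_eq_self_iff]
      rw [Submodule.mem_orthogonal_singleton_iff_inner_right] at hf ⊢
      rw [real_inner_comm]; exact hf
    simp only [Set.mem_preimage, Set.mem_ofPred_eq, inner_sphereReflection, hw]
  rwa [e] at h

lemma integrable_of_continuous {ν : Measure (Sphere d)} [IsFiniteMeasure ν] {F : Sphere d → ℝ}
    (hF : Continuous F) : Integrable F ν :=
  hF.integrable_of_hasCompactSupport (HasCompactSupport.of_compactSpace F)

/-! ### Moments of linear forms under a reflection-invariant measure -/

section Moments

variable {ν : Measure (Sphere d)} {V : Submodule ℝ (EuclideanSpace ℝ (Fin d))}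

/-- The reflection in the hyperplane orthogonal to `f - g` exchanges `f` and `g`, as they have equal
length. -/
lemma ReflectionInvariant.integral_eq (hν : ReflectionInvariant ν V)
    {f g : EuclideanSpace ℝ (Fin d)} (hf : f ∈ V) (hg : g ∈ V) (hfg : ‖f‖ = ‖g‖)
    {F : ℝ → ℝ} (hF : Continuous F) :
    ∫ x, F ⟪f, (x : EuclideanSpace ℝ (Fin d))⟫ ∂ν =
      ∫ x, F ⟪g, (x : EuclideanSpace ℝ (Fin d))⟫ ∂ν := by
  have h := hν (f - g) (V.sub_mem hf hg)
  have hG : Continuous fun x : Sphere d => F ⟪f, (x : EuclideanSpace ℝ (Fin d))⟫ := by fun_prop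
  rw [← h.map_eq, integral_map h.measurable.aemeasurable hG.aestronglyMeasurable]
  simp only [inner_sphereReflection, Submodule.reflection_sub hfg, h.map_eq]

lemma sum_sq_inner_basis (b : OrthonormalBasis (Fin (Module.finrank ℝ V)) ℝ V)
    (x : EuclideanSpace ℝ (Fin d)) :
    ∑ i, ⟪(b i : EuclideanSpace ℝ (Fin d)), x⟫ ^ 2 = ‖V.orthogonalProjectionOnto x‖ ^ 2 := by
  rw [← b.sum_sq_norm_inner_right]
  refine Finset.sum_congr rfl fun i _ => ?_
  rw [Real.norm_eq_abs, sq_abs, ← Submodule.inner_orthogonalProjectionOnto_eq_of_mem_left]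

/-- All unit vectors of `V` have the same second moment, and over an orthonormal basis the squares
add up to the squared length of the projection. -/
lemma ReflectionInvariant.secondMoment [IsFiniteMeasure ν] (hν : ReflectionInvariant ν V)
    {f : EuclideanSpace ℝ (Fin d)} (hf : f ∈ V) (hf1 : ‖f‖ = 1) :
    Module.finrank ℝ V * ∫ x, ⟪f, (x : EuclideanSpace ℝ (Fin d))⟫ ^ 2 ∂ν =
      ∫ x, ‖V.orthogonalProjectionOnto (x : EuclideanSpace ℝ (Fin d))‖ ^ 2 ∂ν := by
  set b := stdOrthonormalBasis ℝ V
  have hb : ∀ i, ‖f‖ = ‖(b i : EuclideanSpace ℝ (Fin d))‖ := fun i => by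
    rw [hf1, ← b.norm_eq_one i, Submodule.coe_norm]
  simp_rw [← sum_sq_inner_basis b]
  rw [integral_finsetSum]
  · rw [Finset.sum_congr rfl fun i _ =>
      (hν.integral_eq hf (b i).2 (hb i) (F := fun t => t ^ 2) (by fun_prop)).symm]
    simp
  · intro i _
    exact integrable_of_continuous (by fun_prop)

lemma norm_orthogonalProjection_le_one (x : Sphere d) :
    ‖V.orthogonalProjectionOnto (x : EuclideanSpace ℝ (Fin d))‖ ≤ 1 := by
  simpa using V.norm_orthogonalProjectionOnto_apply_le (x : EuclideanSpace ℝ (Fin d))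

/-- Let `M` be the common fourth moment of unit vectors. Applying it to `(b i ± b j) / √2` and
adding gives the mixed moment of `(b i ⬝ x)²` and `(b j ⬝ x)²` as `M / 3` for `i ≠ j`; for `i = j`
it is `M`. The sum over all pairs integrates the fourth power of the length of the projection, which
is at most `1`. -/
lemma ReflectionInvariant.fourthMoment_le [IsFiniteMeasure ν] (hν : ReflectionInvariant ν V)
    {f : EuclideanSpace ℝ (Fin d)} (hf : f ∈ V) (hf1 : ‖f‖ = 1) :
    (Module.finrank ℝ V : ℝ) ^ 2 * ∫ x, ⟪f, (x : EuclideanSpace ℝ (Fin d))⟫ ^ 4 ∂ν ≤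
      3 * ν.real Set.univ := by
  set b := stdOrthonormalBasis ℝ V
  set M := ∫ x, ⟪f, (x : EuclideanSpace ℝ (Fin d))⟫ ^ 4 ∂ν
  have hM0 : 0 ≤ M := integral_nonneg fun x => by positivity
  have hM : ∀ g ∈ V, ‖g‖ = 1 → ∫ x, ⟪g, (x : EuclideanSpace ℝ (Fin d))⟫ ^ 4 ∂ν = M := by
    intro g hg hg1
    exact hν.integral_eq hg hf (by rw [hf1, hg1]) (F := fun t => t ^ 4) (by fun_prop)
  have hb1 : ∀ i, ‖(b i : EuclideanSpace ℝ (Fin d))‖ = 1 := fun i => by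
    rw [← b.norm_eq_one i, Submodule.coe_norm]
  have hpair : ∀ i j, M / 3 ≤ ∫ x : Sphere d, ⟪(b i : EuclideanSpace ℝ (Fin d)), x⟫ ^ 2 *
      ⟪(b j : EuclideanSpace ℝ (Fin d)), x⟫ ^ 2 ∂ν := by
    intro i j
    by_cases hij : i = j
    · subst hij
      have := hM _ (b i).2 (hb1 i)
      simp_rw [← pow_add]
      linarith
    · have hbij : ⟪(b i : EuclideanSpace ℝ (Fin d)), (b j : EuclideanSpace ℝ (Fin d))⟫ = 0 := by
        rw [← Submodule.coe_inner]; exact b.orthonormal.2 hij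
      have s2 : (√2)⁻¹ ^ 2 = (1 / 2 : ℝ) := by rw [inv_pow, Real.sq_sqrt (by norm_num)]; norm_num
      have hn : ∀ σ : ℝ, σ ^ 2 = 1 →
          ‖(√2)⁻¹ • ((b i : EuclideanSpace ℝ (Fin d)) + σ • (b j : EuclideanSpace ℝ (Fin d)))‖ = 1 := by
        intro σ hσ
        have h := norm_add_sq_real (b i : EuclideanSpace ℝ (Fin d))
          (σ • (b j : EuclideanSpace ℝ (Fin d)))
        rw [inner_smul_right, hbij, norm_smul, mul_pow, hb1, hb1, Real.norm_eq_abs, sq_abs, hσ] at h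
        rw [norm_smul, ← sq_eq_sq₀ (by positivity) (by positivity), mul_pow, h, Real.norm_eq_abs,
          sq_abs, s2]
        norm_num
      have hm : ∀ σ : ℝ, (√2)⁻¹ • ((b i : EuclideanSpace ℝ (Fin d)) +
          σ • (b j : EuclideanSpace ℝ (Fin d))) ∈ V := fun σ =>
        V.smul_mem _ (V.add_mem (b i).2 (V.smul_mem _ (b j).2))
      have e1 := hM _ (hm 1) (hn 1 (by norm_num))
      have e2 := hM _ (hm (-1)) (hn (-1) (by norm_num))
      have e3 := hM _ (b i).2 (hb1 i)
      have e4 := hM _ (b j).2 (hb1 j)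
      have key : ∀ x : Sphere d,
          ⟪(√2)⁻¹ • ((b i : EuclideanSpace ℝ (Fin d)) + (1 : ℝ) • (b j : EuclideanSpace ℝ (Fin d))),
            (x : EuclideanSpace ℝ (Fin d))⟫ ^ 4 +
          ⟪(√2)⁻¹ • ((b i : EuclideanSpace ℝ (Fin d)) + (-1 : ℝ) • (b j : EuclideanSpace ℝ (Fin d))),
            (x : EuclideanSpace ℝ (Fin d))⟫ ^ 4 =
          (1 / 2) * ⟪(b i : EuclideanSpace ℝ (Fin d)), (x : EuclideanSpace ℝ (Fin d))⟫ ^ 4 +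
          (1 / 2) * ⟪(b j : EuclideanSpace ℝ (Fin d)), (x : EuclideanSpace ℝ (Fin d))⟫ ^ 4 +
          3 * (⟪(b i : EuclideanSpace ℝ (Fin d)), (x : EuclideanSpace ℝ (Fin d))⟫ ^ 2 *
            ⟪(b j : EuclideanSpace ℝ (Fin d)), (x : EuclideanSpace ℝ (Fin d))⟫ ^ 2) := by
        intro x
        have s4 : (√2)⁻¹ ^ 4 = (1 / 4 : ℝ) := by
          rw [show 4 = 2 * 2 from rfl, pow_mul, s2]; norm_num
        simp only [inner_smul_left, inner_add_left, mul_pow, s4, RCLike.conj_to_real]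
        ring
      have e := integral_congr_ae (μ := ν) (Filter.Eventually.of_forall key)
      rw [integral_add, integral_add, integral_add, integral_const_mul, integral_const_mul,
        integral_const_mul, e1, e2, e3, e4] at e
      · linarith
      all_goals exact integrable_of_continuous (by fun_prop)
  have hsum : ∑ i, ∑ j, ∫ x : Sphere d, ⟪(b i : EuclideanSpace ℝ (Fin d)), x⟫ ^ 2 *
      ⟪(b j : EuclideanSpace ℝ (Fin d)), x⟫ ^ 2 ∂ν ≤ ν.real Set.univ := by
    calc _ = ∫ x : Sphere d, ∑ i, ∑ j, ⟪(b i : EuclideanSpace ℝ (Fin d)), x⟫ ^ 2 *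
          ⟪(b j : EuclideanSpace ℝ (Fin d)), x⟫ ^ 2 ∂ν := by
          rw [integral_finsetSum]
          · refine Finset.sum_congr rfl fun i _ => ?_
            rw [integral_finsetSum]
            intro j _
            exact integrable_of_continuous (by fun_prop)
          · intro i _
            exact integrable_of_continuous (by fun_prop)
      _ ≤ ∫ _ : Sphere d, (1 : ℝ) ∂ν := by
          refine integral_mono (integrable_of_continuous (by fun_prop)) (integrable_const _) ?_
          intro x
          simp only [← Finset.mul_sum, ← Finset.sum_mul, sum_sq_inner_basis b]
          have := norm_orthogonalProjection_le_one (V := V) x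
          have h2 : ‖V.orthogonalProjectionOnto (x : EuclideanSpace ℝ (Fin d))‖ ^ 2 ≤ 1 :=
            pow_le_one₀ (norm_nonneg _) this
          exact mul_le_one₀ h2 (by positivity) h2
      _ = _ := by simp
  have hle : ∑ _i : Fin (Module.finrank ℝ V), ∑ _j : Fin (Module.finrank ℝ V), M / 3 ≤
      ν.real Set.univ :=
    (Finset.sum_le_sum fun i _ => Finset.sum_le_sum fun j _ => hpair i j).trans hsum
  simp only [Finset.sum_const, Finset.card_univ, Fintype.card_fin, nsmul_eq_mul] at hle
  linarith

end Moments

/-! ### Averaging over a plane -/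

/-- On the coordinates with respect to `e₁, e₂` these reflections act through the doubled angle. As
`φ` runs over `[0, π]`, the image of a point runs once around its circle, so reflections alone
produce the average over rotations. -/
lemma reflection_planar {e₁ e₂ : EuclideanSpace ℝ (Fin d)} (h1 : ‖e₁‖ = 1) (h2 : ‖e₂‖ = 1)
    (h12 : ⟪e₁, e₂⟫ = 0) (φ : ℝ) (x : Sphere d) :
    ⟪e₁, (sphereReflection (Real.cos φ • e₁ + Real.sin φ • e₂) x : EuclideanSpace ℝ (Fin d))⟫ =
      -(Real.cos (2 * φ) * ⟪e₁, (x : EuclideanSpace ℝ (Fin d))⟫ +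
        Real.sin (2 * φ) * ⟪e₂, (x : EuclideanSpace ℝ (Fin d))⟫) ∧
    ⟪e₂, (sphereReflection (Real.cos φ • e₁ + Real.sin φ • e₂) x : EuclideanSpace ℝ (Fin d))⟫ =
      -(Real.sin (2 * φ) * ⟪e₁, (x : EuclideanSpace ℝ (Fin d))⟫ -
        Real.cos (2 * φ) * ⟪e₂, (x : EuclideanSpace ℝ (Fin d))⟫) := by
  set f := Real.cos φ • e₁ + Real.sin φ • e₂ with hf
  have h11 : ⟪e₁, e₁⟫ = 1 := by rw [real_inner_self_eq_norm_sq, h1]; norm_num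
  have h22 : ⟪e₂, e₂⟫ = 1 := by rw [real_inner_self_eq_norm_sq, h2]; norm_num
  have h21 : ⟪e₂, e₁⟫ = 0 := by rw [real_inner_comm]; exact h12
  have hff : ‖f‖ = 1 := by
    have : ‖f‖ ^ 2 = 1 := by
      rw [← real_inner_self_eq_norm_sq, hf]
      simp only [inner_add_left, inner_add_right, inner_smul_left, inner_smul_right, h11, h22, h12,
        h21, RCLike.conj_to_real]
      linear_combination Real.cos_sq_add_sin_sq φ
    nlinarith [norm_nonneg f]
  have hr : ∀ g : EuclideanSpace ℝ (Fin d), Submodule.reflection (ℝ ∙ f)ᗮ g = g - (2 * ⟪f, g⟫) • f := by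
    intro g
    rw [Submodule.reflection_orthogonal_apply, Submodule.reflection_singleton_apply, hff]
    simp only [RCLike.ofReal_real_eq_id, id_eq, one_pow, div_one, two_smul, two_mul, add_smul]
    abel
  have hf1 : ⟪f, e₁⟫ = Real.cos φ := by
    simp only [hf, inner_add_left, inner_smul_left, h11, h21, RCLike.conj_to_real]; ring
  have hf2 : ⟪f, e₂⟫ = Real.sin φ := by
    simp only [hf, inner_add_left, inner_smul_left, h22, h12, RCLike.conj_to_real]; ring
  have hfx : ⟪f, (x : EuclideanSpace ℝ (Fin d))⟫ = Real.cos φ * ⟪e₁, (x : EuclideanSpace ℝ (Fin d))⟫ +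
      Real.sin φ * ⟪e₂, (x : EuclideanSpace ℝ (Fin d))⟫ := by
    simp only [hf, inner_add_left, inner_smul_left, RCLike.conj_to_real]
  rw [inner_sphereReflection, inner_sphereReflection, hr, hr, inner_sub_left, inner_sub_left,
    inner_smul_left, inner_smul_left, hf1, hf2, hfx, Real.cos_two_mul, Real.sin_two_mul]
  simp only [RCLike.conj_to_real]
  constructor
  · ring
  · linear_combination (2 * ⟪e₂, (x : EuclideanSpace ℝ (Fin d))⟫) * (-Real.sin_sq_add_cos_sq φ)

/-- The average of `F` over the planar rotations of the point `(s, y)`. -/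
def planarMean (F : ℝ × ℝ → ℝ) (s y : ℝ) : ℝ :=
  (2 * Real.pi)⁻¹ * ∫ t in (-Real.pi)..Real.pi,
    F (√(s ^ 2 + y ^ 2) * Real.cos t, √(s ^ 2 + y ^ 2) * Real.sin t)

lemma integral_reflections (F : ℝ × ℝ → ℝ) (s y : ℝ) :
    ∫ φ in (0 : ℝ)..Real.pi, F (-(Real.cos (2 * φ) * s + Real.sin (2 * φ) * y),
      -(Real.sin (2 * φ) * s - Real.cos (2 * φ) * y)) = Real.pi * planarMean F s y := by
  set r := √(s ^ 2 + y ^ 2) with hr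
  obtain ⟨ψ, hs, hy⟩ : ∃ ψ, s = r * Real.cos ψ ∧ y = r * Real.sin ψ := by
    refine ⟨Complex.arg ⟨s, y⟩, ?_, ?_⟩
    · have := Complex.norm_mul_cos_arg ⟨s, y⟩
      rw [Complex.norm_eq_sqrt_sq_add_sq] at this
      exact this.symm
    · have := Complex.norm_mul_sin_arg ⟨s, y⟩
      rw [Complex.norm_eq_sqrt_sq_add_sq] at this
      exact this.symm
  set G : ℝ → ℝ := fun t => F (r * Real.cos t, r * Real.sin t) with hG
  have hper : Function.Periodic G (2 * Real.pi) := fun t => by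
    simp [hG, Real.cos_add_two_pi, Real.sin_add_two_pi]
  have e : ∀ φ : ℝ, F (-(Real.cos (2 * φ) * s + Real.sin (2 * φ) * y),
      -(Real.sin (2 * φ) * s - Real.cos (2 * φ) * y)) = G (2 * φ + (-ψ + Real.pi)) := by
    intro φ
    have : 2 * φ + (-ψ + Real.pi) = (2 * φ - ψ) + Real.pi := by ring
    simp only [hG]
    rw [this, Real.cos_add_pi, Real.sin_add_pi, Real.cos_sub, Real.sin_sub]
    congr 2
    · linear_combination (-Real.cos (2 * φ)) * hs - Real.sin (2 * φ) * hy
    · linear_combination (-Real.sin (2 * φ)) * hs + Real.cos (2 * φ) * hy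
  simp_rw [e]
  rw [intervalIntegral.integral_comp_mul_add _ (by norm_num : (2 : ℝ) ≠ 0)]
  have hp := hper.intervalIntegral_add_eq (2 * 0 + (-ψ + Real.pi)) (-Real.pi)
  rw [show 2 * Real.pi + (-ψ + Real.pi) = (2 * 0 + (-ψ + Real.pi)) + 2 * Real.pi by ring, hp,
    show -Real.pi + 2 * Real.pi = Real.pi by ring, planarMean, smul_eq_mul]
  have := Real.pi_pos
  simp only [hG, hr]
  field_simp

/-- Each reflection preserves the integral, hence so does the average over `φ`; Fubini moves that
average inside. -/
lemma integral_eq_integral_planarMean (hd : 1 ≤ d) {e₁ e₂ : EuclideanSpace ℝ (Fin d)}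
    (h1 : ‖e₁‖ = 1) (h2 : ‖e₂‖ = 1) (h12 : ⟪e₁, e₂⟫ = 0) {F : ℝ × ℝ → ℝ} (hF : Measurable F)
    {B : ℝ} (hB : ∀ p, |F p| ≤ B) :
    ∫ x, F (⟪e₁, (x : EuclideanSpace ℝ (Fin d))⟫, ⟪e₂, (x : EuclideanSpace ℝ (Fin d))⟫)
        ∂(uniformSphere d) =
      ∫ x, planarMean F ⟪e₁, (x : EuclideanSpace ℝ (Fin d))⟫ ⟪e₂, (x : EuclideanSpace ℝ (Fin d))⟫
        ∂(uniformSphere d) := by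
  have := isProbabilityMeasure_uniformSphere hd
  set I := ∫ x, F (⟪e₁, (x : EuclideanSpace ℝ (Fin d))⟫, ⟪e₂, (x : EuclideanSpace ℝ (Fin d))⟫)
        ∂(uniformSphere d) with hI
  have hφ : ∀ φ : ℝ, ∫ x : Sphere d,
      F (-(Real.cos (2 * φ) * ⟪e₁, (x : EuclideanSpace ℝ (Fin d))⟫ +
        Real.sin (2 * φ) * ⟪e₂, (x : EuclideanSpace ℝ (Fin d))⟫),
        -(Real.sin (2 * φ) * ⟪e₁, (x : EuclideanSpace ℝ (Fin d))⟫ -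
        Real.cos (2 * φ) * ⟪e₂, (x : EuclideanSpace ℝ (Fin d))⟫)) ∂(uniformSphere d) = I := by
    intro φ
    have hm := reflectionInvariant_uniformSphere (d := d) (Real.cos φ • e₁ + Real.sin φ • e₂) trivial
    have hG : Measurable fun x : Sphere d =>
        F (⟪e₁, (x : EuclideanSpace ℝ (Fin d))⟫, ⟪e₂, (x : EuclideanSpace ℝ (Fin d))⟫) :=
      hF.comp (by fun_prop)
    rw [hI]
    nth_rewrite 2 [← hm.map_eq]
    rw [integral_map hm.measurable.aemeasurable hG.aestronglyMeasurable]
    refine integral_congr_ae (Filter.Eventually.of_forall fun x => ?_)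
    simp only [(reflection_planar h1 h2 h12 φ x).1, (reflection_planar h1 h2 h12 φ x).2]
  have key : ∫ φ in (0 : ℝ)..Real.pi, ∫ x : Sphere d,
      F (-(Real.cos (2 * φ) * ⟪e₁, (x : EuclideanSpace ℝ (Fin d))⟫ +
        Real.sin (2 * φ) * ⟪e₂, (x : EuclideanSpace ℝ (Fin d))⟫),
        -(Real.sin (2 * φ) * ⟪e₁, (x : EuclideanSpace ℝ (Fin d))⟫ -
        Real.cos (2 * φ) * ⟪e₂, (x : EuclideanSpace ℝ (Fin d))⟫)) ∂(uniformSphere d) =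
      Real.pi * I := by
    simp_rw [hφ]
    simp
  rw [intervalIntegral.integral_of_le Real.pi_pos.le, integral_integral_swap] at key
  · simp_rw [← intervalIntegral.integral_of_le Real.pi_pos.le, integral_reflections] at key
    rw [integral_const_mul] at key
    exact (mul_left_cancel₀ Real.pi_pos.ne' key).symm
  · refine Integrable.of_bound (C := B) ?_ (Filter.Eventually.of_forall fun p => hB _)
    refine (hF.comp ?_).aestronglyMeasurable
    fun_prop

/-! ### The slab and the disagreement region -/

lemma indicator_abs_le_one (A : Set (ℝ × ℝ)) (p : ℝ × ℝ) :
    |A.indicator (fun _ => (1 : ℝ)) p| ≤ 1 := by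
  by_cases h : p ∈ A <;> simp [h]

lemma planarMean_indicator (A : Set (ℝ × ℝ)) (s y : ℝ) (hA : MeasurableSet A) :
    planarMean (A.indicator fun _ => 1) s y = (2 * Real.pi)⁻¹ *
      volume.real ({t | (√(s ^ 2 + y ^ 2) * Real.cos t, √(s ^ 2 + y ^ 2) * Real.sin t) ∈ A} ∩
        Set.Ioc (-Real.pi) Real.pi) := by
  have hm : MeasurableSet
      {t | (√(s ^ 2 + y ^ 2) * Real.cos t, √(s ^ 2 + y ^ 2) * Real.sin t) ∈ A} :=
    (by fun_prop : Measurable fun t : ℝ =>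
      (√(s ^ 2 + y ^ 2) * Real.cos t, √(s ^ 2 + y ^ 2) * Real.sin t)) hA
  rw [planarMean, intervalIntegral.integral_of_le (by linarith [Real.pi_pos])]
  congr 1
  have := integral_indicator_one (μ := volume.restrict (Set.Ioc (-Real.pi) Real.pi)) hm
  rw [measureReal_restrict_apply hm] at this
  rw [← this]
  rfl

lemma measureReal_eq_integral_planarMean (hd : 1 ≤ d) {e₁ e₂ : EuclideanSpace ℝ (Fin d)}
    (h1 : ‖e₁‖ = 1) (h2 : ‖e₂‖ = 1) (h12 : ⟪e₁, e₂⟫ = 0) {A : Set (ℝ × ℝ)}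
    (hA : MeasurableSet A) :
    (uniformSphere d).real {x | (⟪e₁, (x : EuclideanSpace ℝ (Fin d))⟫,
        ⟪e₂, (x : EuclideanSpace ℝ (Fin d))⟫) ∈ A} =
      ∫ x, planarMean (A.indicator fun _ => 1) ⟪e₁, (x : EuclideanSpace ℝ (Fin d))⟫
        ⟪e₂, (x : EuclideanSpace ℝ (Fin d))⟫ ∂(uniformSphere d) := by
  rw [← integral_eq_integral_planarMean hd h1 h2 h12 (measurable_const.indicator hA)
    (indicator_abs_le_one A)]
  have hm : MeasurableSet {x : Sphere d | (⟪e₁, (x : EuclideanSpace ℝ (Fin d))⟫,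
        ⟪e₂, (x : EuclideanSpace ℝ (Fin d))⟫) ∈ A} :=
    (by fun_prop : Measurable fun x : Sphere d => (⟪e₁, (x : EuclideanSpace ℝ (Fin d))⟫,
        ⟪e₂, (x : EuclideanSpace ℝ (Fin d))⟫)) hA
  rw [← integral_indicator_one hm]
  rfl

/-- On a circle of radius `r`, the angles between `arccos (b / r)` and `arccos (b / (2 r))` lie in
the band. This arc has length at least `b / (2 r)` because the cosine is 1-Lipschitz. The symmetric
arc of negative angles is not counted. -/
lemma planarMean_slab_ge {b s y : ℝ} (hb : 0 < b) (hr : b ≤ √(s ^ 2 + y ^ 2)) :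
    b / (4 * Real.pi * √(s ^ 2 + y ^ 2)) ≤
      planarMean ({p : ℝ × ℝ | p.1 ∈ Set.Icc (b / 2) b}.indicator fun _ => 1) s y := by
  have hm : MeasurableSet {p : ℝ × ℝ | p.1 ∈ Set.Icc (b / 2) b} := measurable_fst measurableSet_Icc
  rw [planarMean_indicator _ _ _ hm]
  set r := √(s ^ 2 + y ^ 2)
  have hr0 : 0 < r := hb.trans_le hr
  have hsub : Set.Ioc (Real.arccos (b / r)) (Real.arccos (b / (2 * r))) ⊆
      {t | (r * Real.cos t, r * Real.sin t) ∈ {p : ℝ × ℝ | p.1 ∈ Set.Icc (b / 2) b}} ∩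
        Set.Ioc (-Real.pi) Real.pi := by
    intro t ht
    have h0 : 0 ≤ t := (Real.arccos_nonneg _).trans ht.1.le
    have hpi : t ≤ Real.pi := ht.2.trans (Real.arccos_le_pi _)
    refine ⟨⟨?_, ?_⟩, by linarith [Real.pi_pos], hpi⟩
    · have : Real.cos (Real.arccos (b / (2 * r))) ≤ Real.cos t :=
        Real.cos_le_cos_of_nonneg_of_le_pi h0 (Real.arccos_le_pi _) ht.2
      rw [Real.cos_arccos (by linarith [show (0 : ℝ) ≤ b / (2 * r) by positivity])
        (by rw [div_le_one (by positivity)]; linarith), div_le_iff₀ (by positivity)] at this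
      show b / 2 ≤ r * Real.cos t
      linarith
    · have : Real.cos t ≤ Real.cos (Real.arccos (b / r)) :=
        Real.cos_le_cos_of_nonneg_of_le_pi (Real.arccos_nonneg _) hpi ht.1.le
      rw [Real.cos_arccos (by linarith [show (0 : ℝ) ≤ b / r by positivity])
        (by rwa [div_le_one (by positivity)]), le_div_iff₀ (by positivity)] at this
      show r * Real.cos t ≤ b
      linarith
  have hlen : b / (2 * r) ≤ Real.arccos (b / (2 * r)) - Real.arccos (b / r) := by
    have h := Real.lipschitzWith_cos.dist_le_mul (Real.arccos (b / (2 * r))) (Real.arccos (b / r))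
    rw [Real.cos_arccos (by linarith [show (0 : ℝ) ≤ b / (2 * r) by positivity])
        (by rw [div_le_one (by positivity)]; linarith),
      Real.cos_arccos (by linarith [show (0 : ℝ) ≤ b / r by positivity])
        (by rwa [div_le_one (by positivity)]), Real.dist_eq, Real.dist_eq,
        NNReal.coe_one, one_mul, abs_of_nonneg (a := Real.arccos (b / (2 * r)) - _)] at h
    · have e : b / (2 * r) - b / r = -(b / (2 * r)) := by field_simp; ring
      rw [e, abs_neg, abs_of_nonneg (by positivity)] at h
      exact h
    · rw [sub_nonneg]
      apply Real.arccos_le_arccos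
      gcongr
      linarith
  have hvol := measureReal_mono (μ := volume) hsub
    (measure_ne_top_of_subset Set.inter_subset_right (by simp))
  rw [Real.volume_real_Ioc_of_le (by linarith [show 0 ≤ b / (2 * r) by positivity])] at hvol
  calc b / (4 * Real.pi * r) = (2 * Real.pi)⁻¹ * (b / (2 * r)) := by
        have := Real.pi_pos
        field_simp; ring
    _ ≤ _ := by
        have := Real.pi_pos
        gcongr
        exact hlen.trans hvol

lemma measurableSet_cone (τ : ℝ) : MeasurableSet
    {p : ℝ × ℝ | |p.1| ≤ τ * √(p.1 ^ 2 + p.2 ^ 2) ∧ 0 < √(p.1 ^ 2 + p.2 ^ 2)} := by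
  have h1 : MeasurableSet {p : ℝ × ℝ | |p.1| ≤ τ * √(p.1 ^ 2 + p.2 ^ 2)} :=
    measurableSet_le (by fun_prop) (by fun_prop)
  have h2 : MeasurableSet {p : ℝ × ℝ | 0 < √(p.1 ^ 2 + p.2 ^ 2)} :=
    measurableSet_lt (by fun_prop) (by fun_prop)
  exact h1.inter h2

/-- The condition is `|cos t| ≤ τ`. By Jordan's inequality it forces `t` to be within `π τ / 2` of
`π / 2` or of `-π / 2`, a set of length at most `2 π τ` out of `2 π`. -/
lemma planarMean_cone_le {τ s y : ℝ} (hτ : 0 ≤ τ) :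
    planarMean ({p : ℝ × ℝ | |p.1| ≤ τ * √(p.1 ^ 2 + p.2 ^ 2) ∧ 0 < √(p.1 ^ 2 + p.2 ^ 2)}.indicator
      fun _ => 1) s y ≤ τ := by
  have hm := measurableSet_cone τ
  rw [planarMean_indicator _ _ _ hm]
  set r := √(s ^ 2 + y ^ 2)
  have hr0 : 0 ≤ r := Real.sqrt_nonneg _
  have hpi := Real.pi_pos
  have hsub : {t | (r * Real.cos t, r * Real.sin t) ∈
        {p : ℝ × ℝ | |p.1| ≤ τ * √(p.1 ^ 2 + p.2 ^ 2) ∧ 0 < √(p.1 ^ 2 + p.2 ^ 2)}} ∩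
        Set.Ioc (-Real.pi) Real.pi ⊆
      closedBall (Real.pi / 2) (Real.pi * τ / 2) ∪ closedBall (-(Real.pi / 2)) (Real.pi * τ / 2) := by
    rintro t ⟨⟨h1, h2⟩, h3, h4⟩
    have e : √((r * Real.cos t) ^ 2 + (r * Real.sin t) ^ 2) = r := by
      rw [mul_pow, mul_pow, ← mul_add, Real.cos_sq_add_sin_sq, mul_one, Real.sqrt_sq hr0]
    simp only [e] at h1 h2
    rw [abs_mul, abs_of_pos h2, mul_comm τ] at h1
    have hcos := le_of_mul_le_mul_left h1 h2
    have hball : ∀ c : ℝ, |c| ≤ Real.pi / 2 → |Real.sin c| = |Real.cos t| → |c| ≤ Real.pi * τ / 2 := by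
      intro c hc hct
      have := Real.mul_abs_le_abs_sin hc
      rw [hct] at this
      have h6 := this.trans hcos
      rw [div_mul_eq_mul_div, div_le_iff₀ hpi] at h6
      linarith
    rcases le_total 0 t with h0 | h0
    · left
      rw [mem_closedBall, Real.dist_eq]
      refine hball _ (abs_le.2 ⟨by linarith, by linarith⟩) ?_
      rw [Real.sin_sub_pi_div_two, abs_neg]
    · right
      rw [mem_closedBall, Real.dist_eq]
      refine hball _ (abs_le.2 ⟨by linarith, by linarith⟩) ?_
      rw [sub_neg_eq_add, Real.sin_add_pi_div_two]
  have hvol : volume.real (closedBall (Real.pi / 2) (Real.pi * τ / 2) ∪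
      closedBall (-(Real.pi / 2)) (Real.pi * τ / 2)) ≤ 2 * Real.pi * τ := by
    refine (measureReal_union_le _ _).trans (le_of_eq ?_)
    rw [Real.volume_real_closedBall (by positivity), Real.volume_real_closedBall (by positivity)]
    ring
  have h := (measureReal_mono (μ := volume) hsub
    (measure_union_ne_top measure_closedBall_lt_top.ne measure_closedBall_lt_top.ne)).trans hvol
  rw [inv_mul_le_iff₀ (by positivity)]
  exact h

lemma measurable_planarMean {F : ℝ × ℝ → ℝ} (hF : Measurable F) :
    Measurable fun p : ℝ × ℝ => planarMean F p.1 p.2 := by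
  unfold planarMean
  simp_rw [intervalIntegral.integral_of_le (neg_le_self Real.pi_pos.le)]
  refine measurable_const.mul (StronglyMeasurable.measurable ?_)
  exact StronglyMeasurable.integral_prod_right (f := fun (p : ℝ × ℝ) (t : ℝ) =>
    F (√(p.1 ^ 2 + p.2 ^ 2) * Real.cos t, √(p.1 ^ 2 + p.2 ^ 2) * Real.sin t))
    (hF.comp (by fun_prop)).stronglyMeasurable

lemma planarMean_indicator_nonneg (A : Set (ℝ × ℝ)) (s y : ℝ) :
    0 ≤ planarMean (A.indicator fun _ => 1) s y := by
  unfold planarMean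
  have := Real.pi_pos
  refine mul_nonneg (by positivity) (intervalIntegral.integral_nonneg (by linarith) fun t _ => ?_)
  exact Set.indicator_nonneg (fun _ _ => zero_le_one) _

lemma planarMean_indicator_le_one {A : Set (ℝ × ℝ)} (hA : MeasurableSet A) (s y : ℝ) :
    planarMean (A.indicator fun _ => 1) s y ≤ 1 := by
  rw [planarMean_indicator _ _ _ hA, inv_mul_le_iff₀ (by linarith [Real.pi_pos])]
  refine (measureReal_mono Set.inter_subset_right (by simp)).trans ?_
  rw [Real.volume_real_Ioc_of_le (by linarith [Real.pi_pos])]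
  linarith

lemma integrable_planarMean_indicator (hd : 1 ≤ d) {A : Set (ℝ × ℝ)} (hA : MeasurableSet A)
    (e₁ e₂ : EuclideanSpace ℝ (Fin d)) :
    Integrable (fun x : Sphere d => planarMean (A.indicator fun _ => 1)
      ⟪e₁, (x : EuclideanSpace ℝ (Fin d))⟫ ⟪e₂, (x : EuclideanSpace ℝ (Fin d))⟫)
      (uniformSphere d) := by
  have := isProbabilityMeasure_uniformSphere hd
  refine Integrable.of_bound (C := 1) ?_ (Filter.Eventually.of_forall fun x => ?_)
  · exact ((measurable_planarMean (measurable_const.indicator hA)).comp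
      (by fun_prop : Measurable fun x : Sphere d => (⟪e₁, (x : EuclideanSpace ℝ (Fin d))⟫,
        ⟪e₂, (x : EuclideanSpace ℝ (Fin d))⟫))).aestronglyMeasurable
  · rw [Real.norm_eq_abs, abs_of_nonneg (planarMean_indicator_nonneg _ _ _)]
    exact planarMean_indicator_le_one hA _ _

lemma finrank_orthogonal_singleton {w : EuclideanSpace ℝ (Fin d)} (hw : ‖w‖ = 1) :
    (Module.finrank ℝ (ℝ ∙ w)ᗮ : ℝ) = d - 1 := by
  have h := Submodule.finrank_add_finrank_orthogonal (ℝ ∙ w)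
  rw [finrank_span_singleton (by rintro rfl; simp at hw), finrank_euclideanSpace_fin] at h
  have h' : (1 : ℝ) + Module.finrank ℝ (ℝ ∙ w)ᗮ = d := by exact_mod_cast h
  linarith

lemma exists_unit_orthogonal (hd : 2 ≤ d) {w : EuclideanSpace ℝ (Fin d)} (hw : ‖w‖ = 1) :
    ∃ e : EuclideanSpace ℝ (Fin d), ‖e‖ = 1 ∧ ⟪w, e⟫ = 0 := by
  have h := finrank_orthogonal_singleton hw
  have h0 : 0 < Module.finrank ℝ (ℝ ∙ w)ᗮ := by
    have : (2 : ℝ) ≤ d := by exact_mod_cast hd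
    have : (0 : ℝ) < Module.finrank ℝ (ℝ ∙ w)ᗮ := by rw [h]; linarith
    exact_mod_cast this
  set b := stdOrthonormalBasis ℝ (ℝ ∙ w)ᗮ
  refine ⟨b ⟨0, h0⟩, ?_, ?_⟩
  · rw [← b.norm_eq_one ⟨0, h0⟩, Submodule.coe_norm]
  · exact Submodule.mem_orthogonal_singleton_iff_inner_right.1 (b ⟨0, h0⟩).2

lemma secondMoment_uniformSphere (hd : 1 ≤ d) {f : EuclideanSpace ℝ (Fin d)} (hf : ‖f‖ = 1) :
    d * ∫ x, ⟪f, (x : EuclideanSpace ℝ (Fin d))⟫ ^ 2 ∂(uniformSphere d) = 1 := by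
  have := isProbabilityMeasure_uniformSphere hd
  have h := reflectionInvariant_uniformSphere.secondMoment (f := f) trivial hf
  rw [finrank_top, finrank_euclideanSpace_fin] at h
  rw [h]
  have : ∀ x : Sphere d, ‖(⊤ : Submodule ℝ (EuclideanSpace ℝ (Fin d))).orthogonalProjectionOnto
      (x : EuclideanSpace ℝ (Fin d))‖ ^ 2 = 1 := by
    intro x
    have hx : (⊤ : Submodule ℝ (EuclideanSpace ℝ (Fin d))).starProjection
        (x : EuclideanSpace ℝ (Fin d)) = x := Submodule.starProjection_eq_self_iff.2 trivial
    rw [Submodule.coe_norm, ← Submodule.starProjection_apply, hx]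
    simp
  rw [integral_congr_ae (Filter.Eventually.of_forall this)]
  simp

lemma fourthMoment_uniformSphere_le (hd : 1 ≤ d) {f : EuclideanSpace ℝ (Fin d)} (hf : ‖f‖ = 1) :
    (d : ℝ) ^ 2 * ∫ x, ⟪f, (x : EuclideanSpace ℝ (Fin d))⟫ ^ 4 ∂(uniformSphere d) ≤ 3 := by
  have := isProbabilityMeasure_uniformSphere hd
  have h := reflectionInvariant_uniformSphere.fourthMoment_le (f := f) trivial hf
  rw [finrank_top, finrank_euclideanSpace_fin] at h
  simpa using h

lemma measurableSet_slab (w : EuclideanSpace ℝ (Fin d)) (I : Set ℝ) (hI : MeasurableSet I) :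
    MeasurableSet {x : Sphere d | ⟪w, (x : EuclideanSpace ℝ (Fin d))⟫ ∈ I} :=
  (by fun_prop : Measurable fun x : Sphere d => ⟪w, (x : EuclideanSpace ℝ (Fin d))⟫) hI

/-- At distance `r` from the origin of the plane the fraction of the circle inside the band is at
least `b / (4 π r)`. It remains to bound the mean of `1 / r` from below by second and fourth
moments. -/
lemma le_measure_slab (hd : 2 ≤ d) {w : EuclideanSpace ℝ (Fin d)} (hw : ‖w‖ = 1) {b : ℝ}
    (hb : 0 < b) (hbd : b * √d ≤ 1 / 2) :
    b * √d / 1000 ≤ (uniformSphere d).real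
      {x | ⟪w, (x : EuclideanSpace ℝ (Fin d))⟫ ∈ Set.Icc (b / 2) b} := by
  have hd1 : 1 ≤ d := by omega
  have := isProbabilityMeasure_uniformSphere hd1
  obtain ⟨e, he, hwe⟩ := exists_unit_orthogonal hd hw
  have hA : MeasurableSet {p : ℝ × ℝ | p.1 ∈ Set.Icc (b / 2) b} := measurable_fst measurableSet_Icc
  have hd0 : (0 : ℝ) < d := by exact_mod_cast hd1
  have hsd : 0 < √(d : ℝ) := Real.sqrt_pos.2 hd0
  have hpi := Real.pi_pos
  -- With `q = √d r`, the polynomial `q² / 27 - q⁴ / 243` lies below `1 / q`. Subtracting `1 / 108`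
  -- makes it nonpositive for `q ≤ 1 / 2`, which covers the circles of radius less than `b`. The
  -- bound `q⁴ ≤ 2 (d² s⁴ + d² y⁴)` separates the coordinates, and the mean is then at least `2/27 -
  -- 12/243 - 1/108 = 5/324`.
  have hpt : ∀ s y : ℝ, b * √d / (4 * Real.pi) * (1 / 27 * (d * s ^ 2) + 1 / 27 * (d * y ^ 2) -
      2 / 243 * (d ^ 2 * s ^ 4) - 2 / 243 * (d ^ 2 * y ^ 4) - 1 / 27 * (1 / 4)) ≤
      planarMean ({p : ℝ × ℝ | p.1 ∈ Set.Icc (b / 2) b}.indicator fun _ => 1) s y := by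
    intro s y
    have hq : d * s ^ 2 + d * y ^ 2 = (√d * √(s ^ 2 + y ^ 2)) ^ 2 := by
      rw [mul_pow, Real.sq_sqrt hd0.le, Real.sq_sqrt (by positivity)]; ring
    set q := √d * √(s ^ 2 + y ^ 2) with hqdef
    have hq0 : 0 ≤ q := by positivity
    have hle : 1 / 27 * (d * s ^ 2) + 1 / 27 * (d * y ^ 2) -
      2 / 243 * (d ^ 2 * s ^ 4) - 2 / 243 * (d ^ 2 * y ^ 4) - 1 / 27 * (1 / 4) ≤
      1 / 27 * q ^ 2 - 1 / 243 * q ^ 4 - 1 / 27 * (1 / 4) := by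
      have : q ^ 4 = (d * s ^ 2 + d * y ^ 2) ^ 2 := by rw [hq]; ring
      rw [this, ← hq]
      nlinarith [sq_nonneg (d * s ^ 2 - d * y ^ 2)]
    refine (mul_le_mul_of_nonneg_left hle (by positivity)).trans ?_
    rcases le_or_gt b (√(s ^ 2 + y ^ 2)) with hr | hr
    · refine le_trans ?_ (planarMean_slab_ge hb hr)
      have hr0 : 0 < √(s ^ 2 + y ^ 2) := hb.trans_le hr
      have hqp : 0 < q := by positivity
      have : b / (4 * Real.pi * √(s ^ 2 + y ^ 2)) = b * √d / (4 * Real.pi) * (1 / q) := by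
        rw [hqdef]; field_simp
      rw [this]
      refine mul_le_mul_of_nonneg_left ?_ (by positivity)
      rw [le_div_iff₀ hqp]
      rcases le_total q 3 with h3 | h3
      · have h27 : q ^ 3 ≤ 3 ^ 3 := pow_le_pow_left₀ hq0 h3 3
        nlinarith [pow_nonneg hq0 5]
      · have : 0 ≤ q ^ 3 * (q ^ 2 - 9) := mul_nonneg (by positivity) (by nlinarith)
        nlinarith
    · refine le_trans ?_ (planarMean_indicator_nonneg _ _ _)
      refine mul_nonpos_of_nonneg_of_nonpos (by positivity) ?_
      have hqh : q ≤ 1 / 2 := by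
        refine le_trans ?_ hbd
        rw [mul_comm b]
        exact mul_le_mul_of_nonneg_left hr.le hsd.le
      nlinarith [pow_nonneg hq0 4]
  rw [show {x : Sphere d | ⟪w, (x : EuclideanSpace ℝ (Fin d))⟫ ∈ Set.Icc (b / 2) b} =
    {x : Sphere d | (⟪w, (x : EuclideanSpace ℝ (Fin d))⟫, ⟪e, (x : EuclideanSpace ℝ (Fin d))⟫) ∈
      {p : ℝ × ℝ | p.1 ∈ Set.Icc (b / 2) b}} from rfl,
    measureReal_eq_integral_planarMean hd1 hw he hwe hA]
  refine le_trans ?_ (integral_mono (integrable_of_continuous ?_)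
    (integrable_planarMean_indicator hd1 hA w e) fun x => hpt _ _)
  · rw [integral_const_mul, integral_sub, integral_sub, integral_sub, integral_add,
      integral_const_mul, integral_const_mul, integral_const_mul, integral_const_mul,
      integral_const_mul, integral_const_mul, integral_const_mul, integral_const_mul,
      secondMoment_uniformSphere hd1 hw, secondMoment_uniformSphere hd1 he]
    · have h1 := fourthMoment_uniformSphere_le hd1 hw
      have h2 := fourthMoment_uniformSphere_le hd1 he
      simp only [integral_const, probReal_univ, smul_eq_mul, one_mul]
      calc b * √d / 1000 ≤ b * √d / (4 * Real.pi) * (5 / 324) := by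
            rw [div_mul_eq_mul_div, div_le_div_iff₀ (by norm_num) (by positivity)]
            have := Real.pi_lt_d2
            have : 0 < b * √d := by positivity
            nlinarith
        _ ≤ _ := by
            refine mul_le_mul_of_nonneg_left ?_ (by positivity)
            linarith
    all_goals exact integrable_of_continuous (by fun_prop)
  · fun_prop

/-- A unit vector `u` in terms of a unit vector `w` and a unit vector orthogonal to it. -/
lemma exists_orthogonal_decomposition (hd : 2 ≤ d) {w u : EuclideanSpace ℝ (Fin d)} (hw : ‖w‖ = 1)
    (hu : ‖u‖ = 1) : ∃ e : EuclideanSpace ℝ (Fin d), ‖e‖ = 1 ∧ ⟪w, e⟫ = 0 ∧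
      u = ⟪w, u⟫ • w + √(1 - ⟪w, u⟫ ^ 2) • e := by
  have hww : ⟪w, w⟫ = 1 := by rw [real_inner_self_eq_norm_sq, hw]; norm_num
  have hnorm : ‖u - ⟪w, u⟫ • w‖ = √(1 - ⟪w, u⟫ ^ 2) := by
    have h := norm_sub_sq_real u (⟪w, u⟫ • w)
    rw [hu, inner_smul_right, real_inner_comm w u, norm_smul, hw, mul_one, Real.norm_eq_abs,
      sq_abs] at h
    rw [← Real.sqrt_sq (norm_nonneg (u - ⟪w, u⟫ • w)), h]
    congr 1; ring
  rcases (norm_nonneg (u - ⟪w, u⟫ • w)).eq_or_lt with h0 | h0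
  · obtain ⟨e, he, hwe⟩ := exists_unit_orthogonal hd hw
    refine ⟨e, he, hwe, ?_⟩
    rw [← hnorm, ← h0, zero_smul, add_zero]
    exact sub_eq_zero.1 (norm_eq_zero.1 h0.symm)
  · refine ⟨(√(1 - ⟪w, u⟫ ^ 2))⁻¹ • (u - ⟪w, u⟫ • w), ?_, ?_, ?_⟩
    · rw [← hnorm, norm_smul, norm_inv, norm_norm, inv_mul_cancel₀ h0.ne']
    · rw [inner_smul_right, inner_sub_right, inner_smul_right, hww]; ring
    · rw [smul_smul, mul_inv_cancel₀ (by rw [← hnorm]; exact h0.ne'), one_smul]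
      abel

lemma halfspace_eq_iff {w v x : Sphere d} : halfspace w x ≠ halfspace v x ↔
    ¬ ((0 ≤ ⟪(w : EuclideanSpace ℝ (Fin d)), (x : EuclideanSpace ℝ (Fin d))⟫) ↔
      (0 ≤ ⟪(v : EuclideanSpace ℝ (Fin d)), (x : EuclideanSpace ℝ (Fin d))⟫)) := by
  unfold halfspace
  split_ifs <;> simp [*]

/-- Where the halfspaces disagree, `s = u ⬝ x` and `α s + S y` have opposite signs, so `α |s| ≤ S
|y|`. With `α ≥ 1 / 2` this is a cone of relative width `2 S` around the hyperplane of `u`. -/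
lemma measure_disagreement_le (hd : 2 ≤ d) {u v : Sphere d}
    (h : 1 / 2 ≤ ⟪(u : EuclideanSpace ℝ (Fin d)), (v : EuclideanSpace ℝ (Fin d))⟫) :
    (uniformSphere d).real {x | halfspace v x ≠ halfspace u x} ≤
      2 * √(1 - ⟪(u : EuclideanSpace ℝ (Fin d)), (v : EuclideanSpace ℝ (Fin d))⟫ ^ 2) := by
  have hd1 : 1 ≤ d := by omega
  have := isProbabilityMeasure_uniformSphere hd1
  have hu : ‖(u : EuclideanSpace ℝ (Fin d))‖ = 1 := by simp
  have hv : ‖(v : EuclideanSpace ℝ (Fin d))‖ = 1 := by simp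
  obtain ⟨e, he, hue, hdec⟩ := exists_orthogonal_decomposition hd hu hv
  set α := ⟪(u : EuclideanSpace ℝ (Fin d)), (v : EuclideanSpace ℝ (Fin d))⟫
  set S := √(1 - α ^ 2)
  have hS : 0 ≤ S := Real.sqrt_nonneg _
  have hsub : {x | halfspace v x ≠ halfspace u x} ⊆
      {x : Sphere d | (⟪(u : EuclideanSpace ℝ (Fin d)), (x : EuclideanSpace ℝ (Fin d))⟫,
        ⟪e, (x : EuclideanSpace ℝ (Fin d))⟫) ∈
      {p : ℝ × ℝ | |p.1| ≤ (2 * S) * √(p.1 ^ 2 + p.2 ^ 2) ∧ 0 < √(p.1 ^ 2 + p.2 ^ 2)}} := by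
    intro x hx
    rw [Set.mem_ofPred_eq, halfspace_eq_iff, hdec, inner_add_left, inner_smul_left, inner_smul_left] at hx
    simp only [RCLike.conj_to_real] at hx
    simp only [Set.mem_ofPred_eq]
    set s := ⟪(u : EuclideanSpace ℝ (Fin d)), (x : EuclideanSpace ℝ (Fin d))⟫
    set y := ⟪e, (x : EuclideanSpace ℝ (Fin d))⟫
    have hpos : 0 < s ^ 2 + y ^ 2 := by
      by_contra hcon
      have hs : s = 0 := by nlinarith [sq_nonneg s, sq_nonneg y]
      have hy : y = 0 := by nlinarith [sq_nonneg s, sq_nonneg y]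
      simp [hs, hy] at hx
    refine ⟨?_, Real.sqrt_pos.2 hpos⟩
    have hy : |y| ≤ √(s ^ 2 + y ^ 2) := Real.abs_le_sqrt (by nlinarith [sq_nonneg s])
    have hsy : |s| ≤ 2 * S * |y| := by
      have hSy : |S * y| = S * |y| := by rw [abs_mul, abs_of_nonneg hS]
      rw [mul_assoc, ← hSy]
      rw [not_iff] at hx
      rcases le_or_gt 0 s with h0 | h0
      · have h1 : α * s + S * y < 0 := by
          by_contra hc
          exact (hx.2 h0) (not_lt.1 hc)
        rw [abs_of_nonneg h0]
        nlinarith [neg_le_abs (S * y)]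
      · have h1 : 0 ≤ α * s + S * y := by
          by_contra hc
          exact absurd (hx.1 hc) (not_le.2 h0)
        rw [abs_of_neg h0]
        nlinarith [le_abs_self (S * y)]
    exact hsy.trans (mul_le_mul_of_nonneg_left hy (by positivity))
  refine (measureReal_mono hsub).trans ?_
  rw [measureReal_eq_integral_planarMean hd1 hu he hue (measurableSet_cone _)]
  refine (integral_mono (integrable_planarMean_indicator hd1 (measurableSet_cone _) _ _)
    (integrable_const (2 * S)) fun x => planarMean_cone_le (by positivity)).trans ?_
  simp

/-! ### Moments within a slab -/

/-- The region `b / 2 ≤ w ⬝ x ≤ b`. -/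
def slab (w : EuclideanSpace ℝ (Fin d)) (b : ℝ) : Set (Sphere d) :=
  {x | ⟪w, (x : EuclideanSpace ℝ (Fin d))⟫ ∈ Set.Icc (b / 2) b}

lemma measurableSet_slab' (w : EuclideanSpace ℝ (Fin d)) (b : ℝ) : MeasurableSet (slab w b) :=
  measurableSet_slab w _ measurableSet_Icc

lemma norm_sq_projection_orthogonal {w : EuclideanSpace ℝ (Fin d)} (hw : ‖w‖ = 1) (x : Sphere d) :
    ‖(ℝ ∙ w)ᗮ.orthogonalProjectionOnto (x : EuclideanSpace ℝ (Fin d))‖ ^ 2 =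
      1 - ⟪w, (x : EuclideanSpace ℝ (Fin d))⟫ ^ 2 := by
  have h := Submodule.norm_sq_eq_add_norm_sq_projection (x : EuclideanSpace ℝ (Fin d)) (ℝ ∙ w)
  have h2 : ‖(ℝ ∙ w).orthogonalProjectionOnto (x : EuclideanSpace ℝ (Fin d))‖ ^ 2 =
      ⟪w, (x : EuclideanSpace ℝ (Fin d))⟫ ^ 2 := by
    rw [Submodule.coe_norm, ← Submodule.starProjection_apply,
      Submodule.starProjection_unit_singleton ℝ hw, norm_smul, hw, mul_one, Real.norm_eq_abs, sq_abs]
  rw [h2] at h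
  simp only [norm_eq_of_mem_sphere, one_pow] at h
  linarith

lemma reflectionInvariant_slab (w : EuclideanSpace ℝ (Fin d)) (b : ℝ) :
    ReflectionInvariant ((uniformSphere d).restrict (slab w b)) (ℝ ∙ w)ᗮ :=
  reflectionInvariant_uniformSphere.restrict w measurableSet_Icc

lemma slab_secondMoment_le (hd : 2 ≤ d) {w e : EuclideanSpace ℝ (Fin d)} (hw : ‖w‖ = 1)
    (he : ‖e‖ = 1) (hwe : ⟪w, e⟫ = 0) (b : ℝ) :
    (d - 1) * ∫ x in slab w b, ⟪e, (x : EuclideanSpace ℝ (Fin d))⟫ ^ 2 ∂(uniformSphere d) ≤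
      (uniformSphere d).real (slab w b) := by
  have := isProbabilityMeasure_uniformSphere (show 1 ≤ d by omega)
  have h := (reflectionInvariant_slab w b).secondMoment
    (Submodule.mem_orthogonal_singleton_iff_inner_right.2 hwe) he
  rw [finrank_orthogonal_singleton hw] at h
  rw [h]
  calc _ ≤ ∫ _ in slab w b, (1 : ℝ) ∂(uniformSphere d) := by
        refine integral_mono (integrable_of_continuous (by fun_prop)) (integrable_const _) fun x => ?_
        exact pow_le_one₀ (norm_nonneg _) (norm_orthogonalProjection_le_one x)
    _ = _ := by simp

lemma slab_secondMoment_ge (hd : 2 ≤ d) {w e : EuclideanSpace ℝ (Fin d)} (hw : ‖w‖ = 1)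
    (he : ‖e‖ = 1) (hwe : ⟪w, e⟫ = 0) (b : ℝ) (hb : 0 ≤ b) :
    (1 - b ^ 2) * (uniformSphere d).real (slab w b) ≤
    (d - 1) * ∫ x in slab w b, ⟪e, (x : EuclideanSpace ℝ (Fin d))⟫ ^ 2 ∂(uniformSphere d) := by
  have := isProbabilityMeasure_uniformSphere (show 1 ≤ d by omega)
  have h := (reflectionInvariant_slab w b).secondMoment
    (Submodule.mem_orthogonal_singleton_iff_inner_right.2 hwe) he
  rw [finrank_orthogonal_singleton hw] at h
  rw [h]
  calc _ = ∫ _ in slab w b, (1 - b ^ 2) ∂(uniformSphere d) := by simp [mul_comm]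
    _ ≤ _ := by
        refine setIntegral_mono_on (integrable_const _) (integrable_of_continuous (by fun_prop))
          (measurableSet_slab' w b) fun x hx => ?_
        rw [norm_sq_projection_orthogonal hw]
        have h1 : b / 2 ≤ ⟪w, (x : EuclideanSpace ℝ (Fin d))⟫ := hx.1
        have h2 : ⟪w, (x : EuclideanSpace ℝ (Fin d))⟫ ≤ b := hx.2
        nlinarith

lemma slab_fourthMoment_le (hd : 2 ≤ d) {w e : EuclideanSpace ℝ (Fin d)} (hw : ‖w‖ = 1)
    (he : ‖e‖ = 1) (hwe : ⟪w, e⟫ = 0) (b : ℝ) :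
    ((d : ℝ) - 1) ^ 2 * ∫ x in slab w b, ⟪e, (x : EuclideanSpace ℝ (Fin d))⟫ ^ 4 ∂(uniformSphere d) ≤
      3 * (uniformSphere d).real (slab w b) := by
  have := isProbabilityMeasure_uniformSphere (show 1 ≤ d by omega)
  have h := (reflectionInvariant_slab w b).fourthMoment_le
    (Submodule.mem_orthogonal_singleton_iff_inner_right.2 hwe) he
  rw [finrank_orthogonal_singleton hw] at h
  simpa using h

/-- The inequality `q ≥ q² / 3 - q⁴ / 27` for `q ≥ 0` bounds the first absolute moment below by the
second and fourth moments: `(1 - b²) / 3 - 3 / 27 ≥ 1 / 9`. It is used with `q = √(d - 1) |e ⬝ x|`.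
-/
lemma slab_absMoment_ge (hd : 2 ≤ d) {w e : EuclideanSpace ℝ (Fin d)} (hw : ‖w‖ = 1)
    (he : ‖e‖ = 1) (hwe : ⟪w, e⟫ = 0) (b : ℝ) (hb : 0 ≤ b) (hb3 : b ^ 2 ≤ 1 / 3) :
    (uniformSphere d).real (slab w b) / (9 * √d) ≤
      ∫ x in slab w b, |⟪e, (x : EuclideanSpace ℝ (Fin d))⟫| ∂(uniformSphere d) := by
  have := isProbabilityMeasure_uniformSphere (show 1 ≤ d by omega)
  have hd2 : (2 : ℝ) ≤ d := by exact_mod_cast hd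
  set n : ℝ := d - 1 with hn
  have hn0 : 0 < n := by linarith
  have hsn : 0 < √n := Real.sqrt_pos.2 hn0
  have hpt : ∀ t : ℝ, 1 / 3 * (n * t ^ 2) - 1 / 27 * (n ^ 2 * t ^ 4) ≤ √n * |t| := by
    intro t
    set q := √n * |t|
    have hq0 : 0 ≤ q := by positivity
    have h2 : n * t ^ 2 = q ^ 2 := by rw [mul_pow, Real.sq_sqrt hn0.le, sq_abs]
    have h4 : n ^ 2 * t ^ 4 = q ^ 4 := by
      rw [show q ^ 4 = (q ^ 2) ^ 2 by ring, ← h2]; ring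
    rw [h2, h4]
    rcases le_total q 3 with h3 | h3
    · nlinarith [pow_nonneg hq0 4]
    · have : 0 ≤ q ^ 2 * (q ^ 2 - 9) := mul_nonneg (by positivity) (by nlinarith)
      nlinarith
  have hint := integral_mono (μ := (uniformSphere d).restrict (slab w b))
    (integrable_of_continuous (by fun_prop)) (integrable_of_continuous (by fun_prop))
    fun x : Sphere d => hpt ⟪e, (x : EuclideanSpace ℝ (Fin d))⟫
  rw [integral_sub (integrable_of_continuous (by fun_prop)) (integrable_of_continuous (by fun_prop)),
    integral_const_mul, integral_const_mul, integral_const_mul, integral_const_mul,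
    integral_const_mul] at hint
  have h2 := slab_secondMoment_ge hd hw he hwe b hb
  have h4 := slab_fourthMoment_le hd hw he hwe b
  set P := (uniformSphere d).real (slab w b)
  have hP : 0 ≤ P := measureReal_nonneg
  set A := ∫ x in slab w b, |⟪e, (x : EuclideanSpace ℝ (Fin d))⟫| ∂(uniformSphere d)
  have hA : 0 ≤ A := integral_nonneg fun x => abs_nonneg _
  have hb2 : b ^ 2 * P ≤ 1 / 3 * P := mul_le_mul_of_nonneg_right hb3 hP
  have h9 : P / 9 ≤ √n * A := by linarith
  have hsd : √n ≤ √d := Real.sqrt_le_sqrt (by linarith)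
  have hd0 : 0 < √(d : ℝ) := hsn.trans_le hsd
  rw [div_le_iff₀ (by positivity)]
  nlinarith [mul_le_mul_of_nonneg_right hsd hA]

/-- By the symmetry between `e` and `-e`, the negative part carries half of the absolute moment. -/
lemma slab_negMoment_ge (hd : 2 ≤ d) {w e : EuclideanSpace ℝ (Fin d)} (hw : ‖w‖ = 1)
    (he : ‖e‖ = 1) (hwe : ⟪w, e⟫ = 0) (b : ℝ) (hb : 0 ≤ b) (hb3 : b ^ 2 ≤ 1 / 3) :
    (uniformSphere d).real (slab w b) / (18 * √d) ≤
      ∫ x in slab w b, max (-⟪e, (x : EuclideanSpace ℝ (Fin d))⟫) 0 ∂(uniformSphere d) := by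
  have := isProbabilityMeasure_uniformSphere (show 1 ≤ d by omega)
  have h := slab_absMoment_ge hd hw he hwe b hb hb3
  have hmem : e ∈ (ℝ ∙ w)ᗮ := Submodule.mem_orthogonal_singleton_iff_inner_right.2 hwe
  have hsymm := (reflectionInvariant_slab w b).integral_eq (F := fun t => max t 0)
    hmem (Submodule.neg_mem _ hmem) (by rw [norm_neg]) (by fun_prop)
  simp only [inner_neg_left] at hsymm
  have habs : ∀ x : Sphere d, |⟪e, (x : EuclideanSpace ℝ (Fin d))⟫| =
      max ⟪e, (x : EuclideanSpace ℝ (Fin d))⟫ 0 + max (-⟪e, (x : EuclideanSpace ℝ (Fin d))⟫) 0 := by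
    intro x
    rcases le_total 0 ⟪e, (x : EuclideanSpace ℝ (Fin d))⟫ with h0 | h0
    · rw [abs_of_nonneg h0, max_eq_left h0, max_eq_right (by linarith), add_zero]
    · rw [abs_of_nonpos h0, max_eq_right h0, max_eq_left (by linarith), zero_add]
  simp_rw [habs] at h
  rw [integral_add (integrable_of_continuous (by fun_prop)) (integrable_of_continuous (by fun_prop)),
    hsymm] at h
  have e1 : (uniformSphere d).real (slab w b) / (9 * √d) =
      2 * ((uniformSphere d).real (slab w b) / (18 * √d)) := by
    rw [show (18 : ℝ) * √d = 9 * √d * 2 by ring, ← div_div]; ring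
  linarith

lemma slab_width_le (hd : 2 ≤ d) {w u : EuclideanSpace ℝ (Fin d)} {b : ℝ} (hb : 0 ≤ b)
    (hbS : b * √d ≤ √(1 - ⟪w, u⟫ ^ 2) / 1000) : b ≤ √(1 - ⟪w, u⟫ ^ 2) / 1000 ∧ b ^ 2 ≤ 1 / 3 := by
  have hd1 : (1 : ℝ) ≤ d := by exact_mod_cast (by omega : 1 ≤ d)
  have h1 : 1 ≤ √(d : ℝ) := Real.one_le_sqrt.2 hd1
  have hS1 : √(1 - ⟪w, u⟫ ^ 2) ≤ 1 := Real.sqrt_le_one.2 (by nlinarith [sq_nonneg ⟪w, u⟫])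
  have hb1 : b ≤ √(1 - ⟪w, u⟫ ^ 2) / 1000 := (le_mul_of_one_le_right hb h1).trans hbS
  exact ⟨hb1, by nlinarith⟩

/-- In `u = α w + S e` the first component contributes at most `b`, which is negligible against `S /
√d`. The second is controlled by the second moment of `e ⬝ x`, with `1 / (d - 1) ≤ 2 / d`. -/
lemma slab_margin_sq_le (hd : 2 ≤ d) {w u : EuclideanSpace ℝ (Fin d)} (hw : ‖w‖ = 1) (hu : ‖u‖ = 1)
    {b : ℝ} (hb : 0 ≤ b) (hbS : b * √d ≤ √(1 - ⟪w, u⟫ ^ 2) / 1000) :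
    ∫ x in slab w b, ⟪u, (x : EuclideanSpace ℝ (Fin d))⟫ ^ 2 ∂(uniformSphere d) ≤
      5 * (1 - ⟪w, u⟫ ^ 2) / d * (uniformSphere d).real (slab w b) := by
  have := isProbabilityMeasure_uniformSphere (show 1 ≤ d by omega)
  obtain ⟨e, he, hwe, hdec⟩ := exists_orthogonal_decomposition hd hw hu
  have hα : |⟪w, u⟫| ≤ 1 := by simpa [hw, hu] using abs_real_inner_le_norm w u
  have hα2 : ⟪w, u⟫ ^ 2 ≤ 1 := by rw [← sq_abs]; exact pow_le_one₀ (abs_nonneg _) hα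
  set α := ⟪w, u⟫
  have hS2 : √(1 - α ^ 2) ^ 2 = 1 - α ^ 2 := Real.sq_sqrt (by linarith)
  set S := √(1 - α ^ 2)
  have hd2 : (2 : ℝ) ≤ d := by exact_mod_cast hd
  have hpt : ∀ x ∈ slab w b, ⟪u, (x : EuclideanSpace ℝ (Fin d))⟫ ^ 2 ≤
      2 * b ^ 2 + 2 * S ^ 2 * ⟪e, (x : EuclideanSpace ℝ (Fin d))⟫ ^ 2 := by
    intro x hx
    have h1 : b / 2 ≤ ⟪w, (x : EuclideanSpace ℝ (Fin d))⟫ := hx.1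
    have h2 : ⟪w, (x : EuclideanSpace ℝ (Fin d))⟫ ≤ b := hx.2
    rw [hdec, inner_add_left, inner_smul_left, inner_smul_left]
    simp only [RCLike.conj_to_real]
    set s := ⟪w, (x : EuclideanSpace ℝ (Fin d))⟫
    set y := ⟪e, (x : EuclideanSpace ℝ (Fin d))⟫
    have h3 : (α * s) ^ 2 ≤ b ^ 2 := by
      rw [mul_pow]
      nlinarith [sq_nonneg s]
    nlinarith [sq_nonneg (α * s - S * y)]
  have hint := setIntegral_mono_on (μ := uniformSphere d)
    (integrable_of_continuous (ν := (uniformSphere d).restrict (slab w b)) (by fun_prop))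
    (integrable_of_continuous (ν := (uniformSphere d).restrict (slab w b)) (by fun_prop))
    (measurableSet_slab' w b) hpt
  refine hint.trans ?_
  rw [integral_add (integrable_const _) (integrable_of_continuous (by fun_prop)),
    integral_const_mul, integral_const_mul]
  have h2 := slab_secondMoment_le hd hw he hwe b
  simp only [integral_const, measureReal_restrict_apply_univ, smul_eq_mul]
  set P := (uniformSphere d).real (slab w b)
  have hP : 0 ≤ P := measureReal_nonneg
  set M := ∫ x in slab w b, ⟪e, (x : EuclideanSpace ℝ (Fin d))⟫ ^ 2 ∂(uniformSphere d)
  have hM : 0 ≤ M := integral_nonneg fun x => sq_nonneg _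
  have hdM : d * M ≤ 3 / 2 * P + (M * d - 3 / 2 * (d - 1) * M) := by linarith
  have hdM2 : d * M ≤ 2 * P := by nlinarith
  have hbd : d * b ^ 2 ≤ S ^ 2 / 4 := by
    have h3 : (b * √d) ^ 2 ≤ (S / 1000) ^ 2 :=
      pow_le_pow_left₀ (by positivity) hbS 2
    rw [mul_pow, Real.sq_sqrt (by linarith)] at h3
    nlinarith [sq_nonneg S]
  rw [← hS2, div_mul_eq_mul_div, le_div_iff₀ (by linarith)]
  nlinarith [mul_le_mul_of_nonneg_left hdM2 (sq_nonneg S), mul_le_mul_of_nonneg_right hbd hP,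
    mul_nonneg (sq_nonneg S) hP, mul_nonneg (mul_nonneg (sq_nonneg S) hM) (show (0 : ℝ) ≤ d by linarith),
    mul_nonneg (sq_nonneg b) hP]

lemma slab_margin_neg_ge (hd : 2 ≤ d) {w u : EuclideanSpace ℝ (Fin d)} (hw : ‖w‖ = 1) (hu : ‖u‖ = 1)
    {b : ℝ} (hb : 0 ≤ b) (hbS : b * √d ≤ √(1 - ⟪w, u⟫ ^ 2) / 1000) :
    (√(1 - ⟪w, u⟫ ^ 2) / (18 * √d) - b) * (uniformSphere d).real (slab w b) ≤
    ∫ x in slab w b, max (-⟪u, (x : EuclideanSpace ℝ (Fin d))⟫) 0 ∂(uniformSphere d) := by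
  have := isProbabilityMeasure_uniformSphere (show 1 ≤ d by omega)
  obtain ⟨e, he, hwe, hdec⟩ := exists_orthogonal_decomposition hd hw hu
  have hα : |⟪w, u⟫| ≤ 1 := by simpa [hw, hu] using abs_real_inner_le_norm w u
  have hb3 := (slab_width_le hd hb hbS).2
  set α := ⟪w, u⟫
  set S := √(1 - α ^ 2)
  have hS : 0 ≤ S := Real.sqrt_nonneg _
  have hpt : ∀ x ∈ slab w b, S * max (-⟪e, (x : EuclideanSpace ℝ (Fin d))⟫) 0 - b ≤
      max (-⟪u, (x : EuclideanSpace ℝ (Fin d))⟫) 0 := by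
    intro x hx
    have h1 : b / 2 ≤ ⟪w, (x : EuclideanSpace ℝ (Fin d))⟫ := hx.1
    have h2 : ⟪w, (x : EuclideanSpace ℝ (Fin d))⟫ ≤ b := hx.2
    rw [hdec, inner_add_left, inner_smul_left, inner_smul_left]
    simp only [RCLike.conj_to_real]
    set s := ⟪w, (x : EuclideanSpace ℝ (Fin d))⟫
    set y := ⟪e, (x : EuclideanSpace ℝ (Fin d))⟫
    have h3 : α * s ≤ b := by nlinarith [(abs_le.1 hα).2]
    rcases le_total (-y) 0 with h0 | h0
    · rw [max_eq_right h0]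
      exact le_max_of_le_right (by linarith)
    · rw [max_eq_left h0]
      exact le_max_of_le_left (by linarith)
  have hint := setIntegral_mono_on (μ := uniformSphere d)
    (integrable_of_continuous (ν := (uniformSphere d).restrict (slab w b)) (by fun_prop))
    (integrable_of_continuous (ν := (uniformSphere d).restrict (slab w b)) (by fun_prop))
    (measurableSet_slab' w b) hpt
  refine le_trans ?_ hint
  rw [integral_sub (integrable_of_continuous (by fun_prop)) (integrable_const _),
    integral_const_mul]
  have h2 := slab_negMoment_ge hd hw he hwe b hb hb3
  simp only [integral_const, measureReal_restrict_apply_univ, smul_eq_mul]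
  have h4 := mul_le_mul_of_nonneg_left h2 hS
  have e1 : S * ((uniformSphere d).real (slab w b) / (18 * √d)) =
    S / (18 * √d) * (uniformSphere d).real (slab w b) := by ring
  rw [sub_mul]
  linarith

/-! ### One step of the perceptron -/

instance measurableSingletonClass_units_int : MeasurableSingletonClass ℤˣ where
  measurableSet_singleton a :=
    ⟨{(a : ℤ)}, measurableSet_singleton _, by ext b; simp [Units.ext_iff]⟩

/-- The increase of `1 - u ⬝ w` in a perceptron step on the example `z`. -/
def angleGain (u w : EuclideanSpace ℝ (Fin d)) (z : Example d) : ℝ :=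
  if z.2 = -1 then 2 * ⟪w, (z.1 : EuclideanSpace ℝ (Fin d))⟫ * ⟪u, (z.1 : EuclideanSpace ℝ (Fin d))⟫
  else 0

lemma measurable_angleGain (u w : EuclideanSpace ℝ (Fin d)) : Measurable (angleGain u w) := by
  unfold angleGain
  refine Measurable.ite (measurable_snd (measurableSet_singleton (-1))) ?_ measurable_const
  fun_prop

lemma measurable_halfspace (u : Sphere d) : Measurable (halfspace u) := by
  unfold halfspace
  refine Measurable.ite (measurableSet_le measurable_const ?_) measurable_const measurable_const
  fun_prop

lemma measurableSet_flip (u : Sphere d) : MeasurableSet {z : Example d | z.2 ≠ halfspace u z.1} :=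
  (measurableSet_eq_fun measurable_snd ((measurable_halfspace u).comp measurable_fst)).compl

/-! ### Exponential drift of `Φ` in one step inside the band -/

section Drift

variable {D : Measure (Example d)}

lemma setIntegral_marginal (hD : D.map Prod.fst = uniformSphere d) (A : Set (Sphere d))
    (hA : MeasurableSet A) {F : Sphere d → ℝ} (hF : Continuous F) :
    ∫ z in Prod.fst ⁻¹' A, F z.1 ∂D = ∫ x in A, F x ∂(uniformSphere d) := by
  rw [← hD, Measure.restrict_map measurable_fst hA,
    integral_map measurable_fst.aemeasurable hF.aestronglyMeasurable]

lemma measureReal_marginal (hD : D.map Prod.fst = uniformSphere d) (A : Set (Sphere d))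
    (hA : MeasurableSet A) : D.real (Prod.fst ⁻¹' A) = (uniformSphere d).real A := by
  rw [← hD, map_measureReal_apply measurable_fst hA]

lemma exp_le_quadratic {x : ℝ} (hx : |x| ≤ 1) : Real.exp x ≤ 1 + x + x ^ 2 := by
  have h := Real.abs_exp_sub_one_sub_id_le hx
  linarith [(abs_le.1 h).2]

lemma abs_inner_le_of_mem_slab {w u : EuclideanSpace ℝ (Fin d)} (hd : 2 ≤ d) (hw : ‖w‖ = 1)
    (hu : ‖u‖ = 1) {b : ℝ} (hb : 0 ≤ b) {x : Sphere d} (hx : x ∈ slab w b) :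
    |⟪u, (x : EuclideanSpace ℝ (Fin d))⟫| ≤ b + √(1 - ⟪w, u⟫ ^ 2) := by
  obtain ⟨e, he, hwe, hdec⟩ := exists_orthogonal_decomposition hd hw hu
  have hα : |⟪w, u⟫| ≤ 1 := by simpa [hw, hu] using abs_real_inner_le_norm w u
  have hy : |⟪e, (x : EuclideanSpace ℝ (Fin d))⟫| ≤ 1 := by
    simpa [he] using abs_real_inner_le_norm e (x : EuclideanSpace ℝ (Fin d))
  have h1 : b / 2 ≤ ⟪w, (x : EuclideanSpace ℝ (Fin d))⟫ := hx.1
  have h2 : ⟪w, (x : EuclideanSpace ℝ (Fin d))⟫ ≤ b := hx.2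
  set α := ⟪w, u⟫
  have hS : 0 ≤ √(1 - α ^ 2) := Real.sqrt_nonneg _
  rw [hdec, inner_add_left, inner_smul_left, inner_smul_left]
  simp only [RCLike.conj_to_real]
  refine (abs_add_le _ _).trans (add_le_add ?_ ?_)
  · rw [abs_mul, abs_of_nonneg (a := ⟪w, (x : EuclideanSpace ℝ (Fin d))⟫) (by linarith)]
    exact (mul_le_of_le_one_left (by linarith) hα).trans h2
  · rw [abs_mul, abs_of_nonneg hS]
    exact mul_le_of_le_one_right hS hy

lemma abs_angleGain_le {w u : EuclideanSpace ℝ (Fin d)} (hd : 2 ≤ d) (hw : ‖w‖ = 1)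
    (hu : ‖u‖ = 1) {b : ℝ} (hb : 0 ≤ b) {z : Example d} (hz : z.1 ∈ slab w b) :
    |angleGain u w z| ≤ 2 * b * (b + √(1 - ⟪w, u⟫ ^ 2)) := by
  have h := abs_inner_le_of_mem_slab hd hw hu hb hz
  have h1 : b / 2 ≤ ⟪w, (z.1 : EuclideanSpace ℝ (Fin d))⟫ := hz.1
  have h2 : ⟪w, (z.1 : EuclideanSpace ℝ (Fin d))⟫ ≤ b := hz.2
  unfold angleGain
  split_ifs
  · rw [abs_mul, abs_mul, abs_of_nonneg (a := ⟪w, (z.1 : EuclideanSpace ℝ (Fin d))⟫) (by linarith)]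
    norm_num
    gcongr
  · rw [abs_zero]; positivity

/-- Clean label, with `a = u ⬝ x` and `s = w ⬝ x`: the step never increases `Φ`, and `2 s ≥ b` makes
the decrease at least `b |a|` when `a < 0`. The term with `r` is slack, present so that the bound
has the form needed for noisy labels. -/
lemma exp_gain_le {b r Λ s a g : ℝ} (hb : 0 < b) (hΛ : 0 < Λ) (hr : 0 < r) (h1 : b / 2 ≤ s)
    (h2 : s ≤ b) (habs : |Λ * g| ≤ 1) (hg : (g = 0 ∧ 0 ≤ a) ∨ (g = 2 * s * a ∧ a < 0)) :
    Real.exp (Λ * g) ≤ 1 - Λ * b * max (-a) 0 + (Λ * b * r / 500 + 4 * Λ ^ 2 * b ^ 2) * a ^ 2 := by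
  refine (exp_le_quadratic habs).trans ?_
  have hs : s ^ 2 ≤ b ^ 2 := pow_le_pow_left₀ (by linarith) h2 2
  have hq : 0 ≤ Λ * b * r / 500 * a ^ 2 := by positivity
  have hΛ2 : 0 ≤ Λ ^ 2 * a ^ 2 := by positivity
  rcases hg with ⟨rfl, ha⟩ | ⟨rfl, ha⟩
  · rw [max_eq_right (by linarith)]
    have : 0 ≤ (Λ * b * r / 500 + 4 * Λ ^ 2 * b ^ 2) * a ^ 2 := by positivity
    linarith
  · rw [max_eq_left (by linarith)]
    have h3 : (Λ * (2 * s * a)) ^ 2 ≤ 4 * Λ ^ 2 * b ^ 2 * a ^ 2 := by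
      have := mul_le_mul_of_nonneg_left hs hΛ2
      linarith
    have h4 : Λ * (2 * s * a) ≤ - (Λ * b * -a) := by
      have : 0 ≤ Λ * -a * (2 * s - b) := mul_nonneg (mul_nonneg hΛ.le (by linarith)) (by linarith)
      linarith
    linarith

/-- Noisy label: either a decrease is lost or an increase of at most `2 b |a|` occurs. By AM-GM, `2
|a| ≤ (r / 500) a² + 500 / r`. The noise then costs a constant per noisy example plus a small
multiple of `a²`, which is integrated over the whole band, so no tail bound for `a` is needed. -/
lemma exp_gain_flip_le {b r Λ s a g : ℝ} (hb : 0 < b) (hΛ : 0 < Λ) (hr : 0 < r) (h1 : b / 2 ≤ s)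
    (h2 : s ≤ b) (habs : |Λ * g| ≤ 1) (hg : g = 0 ∨ (g = 2 * s * a ∧ 0 ≤ a)) :
    Real.exp (Λ * g) ≤ 1 - Λ * b * max (-a) 0 + (Λ * b * r / 500 + 4 * Λ ^ 2 * b ^ 2) * a ^ 2 +
      500 * (Λ * b * r⁻¹) := by
  refine (exp_le_quadratic habs).trans ?_
  have hs : s ^ 2 ≤ b ^ 2 := pow_le_pow_left₀ (by linarith) h2 2
  have hΛ2 : 0 ≤ Λ ^ 2 * a ^ 2 := by positivity
  have hamgm : 2 * |a| ≤ r / 500 * a ^ 2 + 500 * r⁻¹ := by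
    have h5 : 0 ≤ 500 * r⁻¹ * (r / 500 * |a| - 1) ^ 2 := by positivity
    have h6 : 500 * r⁻¹ * (r / 500 * |a| - 1) ^ 2 = r / 500 * a ^ 2 + 500 * r⁻¹ - 2 * |a| := by
      have : r * r⁻¹ = 1 := mul_inv_cancel₀ hr.ne'
      rw [← sq_abs a]
      linear_combination (r / 500 * |a| ^ 2 - 2 * |a|) * this
    linarith
  have hΛa := mul_le_mul_of_nonneg_left hamgm (mul_pos hΛ hb).le
  have hmax : Λ * b * max (-a) 0 ≤ Λ * b * |a| :=
    mul_le_mul_of_nonneg_left (max_le (neg_le_abs a) (abs_nonneg a)) (mul_pos hΛ hb).le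
  have hnn : 0 ≤ Λ * b * |a| := by positivity
  have hq : 0 ≤ 4 * Λ ^ 2 * b ^ 2 * a ^ 2 := by positivity
  rcases hg with rfl | ⟨rfl, ha⟩
  · linarith
  · have h3 : (Λ * (2 * s * a)) ^ 2 ≤ 4 * Λ ^ 2 * b ^ 2 * a ^ 2 := by
      have := mul_le_mul_of_nonneg_left hs hΛ2
      linarith
    have h4 : Λ * (2 * s * a) ≤ Λ * b * (2 * |a|) := by
      rw [abs_of_nonneg ha]
      have : 0 ≤ Λ * a * (b - s) := mul_nonneg (mul_nonneg hΛ.le ha) (by linarith)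
      linarith
    rw [max_eq_right (by linarith)]
    linarith

lemma integral_exp_angleGain_le [IsProbabilityMeasure D] (hd : 2 ≤ d) (hD : D.map Prod.fst = uniformSphere d)
    {w : EuclideanSpace ℝ (Fin d)} (hw : ‖w‖ = 1) (u : Sphere d) {b ν Λ : ℝ} (hb : 0 < b)
    (hΛ : 0 < Λ) (hbS : b * √d ≤ √(1 - ⟪w, (u : EuclideanSpace ℝ (Fin d))⟫ ^ 2) / 1000)
    (hΛS : Λ * b * √(1 - ⟪w, (u : EuclideanSpace ℝ (Fin d))⟫ ^ 2) ≤ 1 / 1600)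
    (hnoise : AdversarialNoise D ν u) (hν : ν ≤ (uniformSphere d).real (slab w b) / 50000) :
    ∫ z in Prod.fst ⁻¹' slab w b, Real.exp (Λ * angleGain (u : EuclideanSpace ℝ (Fin d)) w z) ∂D ≤
      (uniformSphere d).real (slab w b) *
        (1 - Λ * b * √(1 - ⟪w, (u : EuclideanSpace ℝ (Fin d))⟫ ^ 2) / (50 * √d)) := by
  have := isProbabilityMeasure_uniformSphere (show 1 ≤ d by omega)
  have hu : ‖(u : EuclideanSpace ℝ (Fin d))‖ = 1 := by simp
  have hA := measurableSet_slab' w b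
  have hd1 : (1 : ℝ) ≤ d := by exact_mod_cast (by omega : 1 ≤ d)
  have hsd1 : 1 ≤ √(d : ℝ) := Real.one_le_sqrt.2 hd1
  have hsd0 : 0 < √(d : ℝ) := by linarith
  have hα : ⟪w, (u : EuclideanSpace ℝ (Fin d))⟫ ^ 2 ≤ 1 := by
    rw [← sq_abs]
    have h := abs_real_inner_le_norm w (u : EuclideanSpace ℝ (Fin d))
    rw [hw, hu, one_mul] at h
    exact pow_le_one₀ (abs_nonneg _) h
  have hsq := slab_margin_sq_le hd hw hu hb.le hbS
  have hneg := slab_margin_neg_ge hd hw hu hb.le hbS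
  have hbS1 := (slab_width_le hd hb.le hbS).1
  have hgain : ∀ z : Example d, z.1 ∈ slab w b →
      |angleGain (u : EuclideanSpace ℝ (Fin d)) w z| ≤ 2 * b * (b + √(1 - ⟪w, (u : EuclideanSpace ℝ (Fin d))⟫ ^ 2)) :=
    fun z hz => abs_angleGain_le hd hw hu hb.le hz
  rw [← Real.sq_sqrt (show 0 ≤ 1 - ⟪w, (u : EuclideanSpace ℝ (Fin d))⟫ ^ 2 by linarith)] at hsq
  set S := √(1 - ⟪w, (u : EuclideanSpace ℝ (Fin d))⟫ ^ 2) with hSdef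
  have hS : 0 < S := by
    have : 0 < b * √d := by positivity
    linarith
  set P := (uniformSphere d).real (slab w b) with hP
  have hP0 : 0 ≤ P := measureReal_nonneg
  set N := {z : Example d | z.2 ≠ halfspace u z.1} with hN
  -- The weight in AM-GM is `r = √d / S`, the inverse of the typical size of `u ⬝ x`.
  set c₁ := Λ * b * (√d / S) / 500 + 4 * Λ ^ 2 * b ^ 2 with hc₁
  set c₂ := 500 * (Λ * b * S / √d) with hc₂
  have hpt : ∀ z ∈ Prod.fst ⁻¹' slab w b,
      Real.exp (Λ * angleGain (u : EuclideanSpace ℝ (Fin d)) w z) ≤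
      1 - Λ * b * max (-⟪(u : EuclideanSpace ℝ (Fin d)), (z.1 : EuclideanSpace ℝ (Fin d))⟫) 0 +
      c₁ * ⟪(u : EuclideanSpace ℝ (Fin d)), (z.1 : EuclideanSpace ℝ (Fin d))⟫ ^ 2 +
      N.indicator (fun _ => c₂) z := by
    intro z hz
    have h1 : b / 2 ≤ ⟪w, (z.1 : EuclideanSpace ℝ (Fin d))⟫ := hz.1
    have h2 : ⟪w, (z.1 : EuclideanSpace ℝ (Fin d))⟫ ≤ b := hz.2
    have hg := hgain z hz
    have habs : |Λ * angleGain (u : EuclideanSpace ℝ (Fin d)) w z| ≤ 1 := by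
      rw [abs_mul, abs_of_pos hΛ]
      have h3 : 2 * b * (b + S) ≤ 4 * b * S := by nlinarith
      calc Λ * _ ≤ Λ * (4 * b * S) := mul_le_mul_of_nonneg_left (hg.trans h3) hΛ.le
        _ ≤ 1 := by linarith
    have hr : 0 < √d / S := by positivity
    by_cases hzN : z ∈ N
    · rw [Set.indicator_of_mem hzN]
      have hzN' : z.2 ≠ halfspace u z.1 := hzN
      have e2 : c₂ = 500 * (Λ * b * (√d / S)⁻¹) := by rw [hc₂, inv_div]; ring
      rw [e2]
      refine exp_gain_flip_le hb hΛ hr h1 h2 habs ?_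
      unfold angleGain
      split_ifs with hy
      · refine Or.inr ⟨rfl, ?_⟩
        by_contra hneg
        apply hzN'
        rw [hy, halfspace, if_neg hneg]
      · exact Or.inl rfl
    · rw [Set.indicator_of_notMem hzN, add_zero]
      have hzN' : z.2 = halfspace u z.1 := not_not.1 hzN
      refine exp_gain_le hb hΛ hr h1 h2 habs ?_
      unfold angleGain
      split_ifs with hy
      · refine Or.inr ⟨rfl, ?_⟩
        by_contra hneg
        rw [hzN', halfspace, if_pos (not_lt.1 hneg)] at hy
        exact absurd hy (by decide)
      · refine Or.inl ⟨rfl, ?_⟩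
        by_contra hneg
        apply hy
        rw [hzN', halfspace, if_neg hneg]
  have hNm : MeasurableSet N := measurableSet_flip u
  have hcont : Continuous fun x : Sphere d =>
      1 - Λ * b * max (-⟪(u : EuclideanSpace ℝ (Fin d)), (x : EuclideanSpace ℝ (Fin d))⟫) 0 +
      c₁ * ⟪(u : EuclideanSpace ℝ (Fin d)), (x : EuclideanSpace ℝ (Fin d))⟫ ^ 2 := by fun_prop
  have hi1 : IntegrableOn (fun z : Example d =>
      1 - Λ * b * max (-⟪(u : EuclideanSpace ℝ (Fin d)), (z.1 : EuclideanSpace ℝ (Fin d))⟫) 0 +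
      c₁ * ⟪(u : EuclideanSpace ℝ (Fin d)), (z.1 : EuclideanSpace ℝ (Fin d))⟫ ^ 2)
      (Prod.fst ⁻¹' slab w b) D := by
    have h : Integrable (fun x : Sphere d =>
      1 - Λ * b * max (-⟪(u : EuclideanSpace ℝ (Fin d)), (x : EuclideanSpace ℝ (Fin d))⟫) 0 +
      c₁ * ⟪(u : EuclideanSpace ℝ (Fin d)), (x : EuclideanSpace ℝ (Fin d))⟫ ^ 2) (D.map Prod.fst) := by
      rw [hD]; exact integrable_of_continuous hcont
    exact (h.comp_measurable measurable_fst).integrableOn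
  have hi2 : Integrable (N.indicator fun _ => c₂) D := (integrable_const _).indicator hNm
  have hexp : IntegrableOn (fun z => Real.exp (Λ * angleGain (u : EuclideanSpace ℝ (Fin d)) w z))
      (Prod.fst ⁻¹' slab w b) D := by
    refine Measure.integrableOn_of_bounded (M := Real.exp (Λ * (2 * b * (b + S))))
      (measure_ne_top _ _) (((measurable_angleGain _ _).const_mul Λ).exp.aestronglyMeasurable) ?_
    refine (ae_restrict_iff' (hA.preimage measurable_fst)).2
      (Filter.Eventually.of_forall fun z hz => ?_)
    rw [Real.norm_eq_abs, Real.abs_exp, Real.exp_le_exp]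
    exact mul_le_mul_of_nonneg_left ((le_abs_self _).trans (hgain z hz)) hΛ.le
  refine (setIntegral_mono_on hexp (hi1.add hi2.integrableOn) (hA.preimage measurable_fst) hpt).trans ?_
  have hadd := integral_add hi1 hi2.integrableOn
  simp only [Pi.add_apply] at hadd ⊢
  rw [hadd, setIntegral_marginal hD _ hA hcont, integral_add, integral_sub, integral_const_mul,
    integral_const_mul]
  · have hind : ∫ z in Prod.fst ⁻¹' slab w b, N.indicator (fun _ => c₂) z ∂D ≤ c₂ * ν := by
      calc _ ≤ ∫ z, N.indicator (fun _ => c₂) z ∂D := by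
            refine setIntegral_le_integral hi2 (Filter.Eventually.of_forall fun z => ?_)
            exact Set.indicator_nonneg (fun _ _ => by positivity) _
        _ = c₂ * D.real N := by
            rw [integral_indicator hNm]; simp [mul_comm]
        _ ≤ c₂ * ν := mul_le_mul_of_nonneg_left hnoise (by positivity)
    simp only [integral_const, measureReal_restrict_apply_univ, smul_eq_mul, mul_one, ← hP]
    set A := ∫ x in slab w b, max (-⟪(u : EuclideanSpace ℝ (Fin d)), (x : EuclideanSpace ℝ (Fin d))⟫) 0
      ∂(uniformSphere d)
    set M := ∫ x in slab w b, ⟪(u : EuclideanSpace ℝ (Fin d)), (x : EuclideanSpace ℝ (Fin d))⟫ ^ 2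
      ∂(uniformSphere d)
    have hc₁0 : 0 ≤ c₁ := by positivity
    have hΛb : 0 < Λ * b := by positivity
    have i1 : Λ * b * ((S / (18 * √d) - b) * P) ≤ Λ * b * A := mul_le_mul_of_nonneg_left hneg hΛb.le
    have i2 : c₁ * M ≤ c₁ * (5 * S ^ 2 / d * P) := mul_le_mul_of_nonneg_left hsq hc₁0
    have i3 : c₂ * ν ≤ c₂ * (P / 50000) := mul_le_mul_of_nonneg_left hν (by positivity)
    -- Budget in units of `U`, per unit mass of the band: a gain of `1/18`; losses of at most
    -- `1/1000` from the width of the band, `1/100` from the AM-GM term, `1/80` from the quadratic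
    -- term and `1/100` from the noise. More than `1/50` remains.
    set U := Λ * b * S / √d with hU
    have hU0 : 0 ≤ U := by positivity
    have hdd : √(d : ℝ) * √d = d := Real.mul_self_sqrt (by linarith)
    have j1 : Λ * b * ((S / (18 * √d) - b) * P) = U / 18 * P - Λ * b * b * P := by
      rw [hU]; field_simp
    have j1' : Λ * b * b ≤ U / 1000 := by
      rw [hU, div_div, le_div_iff₀ (by positivity)]
      calc Λ * b * b * (√d * 1000) = Λ * b * (b * √d) * 1000 := by ring
        _ ≤ Λ * b * (S / 1000) * 1000 := by gcongr
        _ = Λ * b * S := by ring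
    have j2 : c₁ * (5 * S ^ 2 / d * P) = U * (10 / 1000) * P + 20 * (Λ * b * S) * (Λ * b * S) / d * P := by
      have q1 : 5 * S ^ 2 / (d : ℝ) = 5 * S ^ 2 / (√d * √d) := by rw [hdd]
      have q2 : 20 * (Λ * b * S) * (Λ * b * S) / (d : ℝ) =
        20 * (Λ * b * S) * (Λ * b * S) / (√d * √d) := by rw [hdd]
      rw [hU, hc₁, q1, q2]; field_simp; ring
    have j2' : 20 * (Λ * b * S) * (Λ * b * S) / d ≤ U / 80 := by
      rw [hU]
      calc 20 * (Λ * b * S) * (Λ * b * S) / d ≤ 20 * (1 / 1600) * (Λ * b * S) / √d := by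
            gcongr
            exact Real.sqrt_le_self_iff.2 (Or.inr hd1)
        _ = _ := by ring
    have j3 : c₂ * (P / 50000) = U / 100 * P := by rw [hc₂, hU]; ring
    have j4 : Λ * b * S / (50 * √d) = U / 50 := by rw [hU]; field_simp
    rw [j4]
    have k1 := mul_le_mul_of_nonneg_right j1' hP0
    have k2 := mul_le_mul_of_nonneg_right j2' hP0
    have hUP : 0 ≤ U * P := by positivity
    linarith
  all_goals exact integrable_of_continuous (by fun_prop)

end Drift

/-! ### Execution of the program on a fixed stream -/

lemma RAM.bind_apply {α β : Type} (p : RAM d α) (f : α → RAM d β) (z : ℕ → Example d) (s : Usage) :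
    (p >>= f) z s = (p z s).bind fun r => f r.1 z r.2 := rfl

lemma RAM.pure_apply {α : Type} (a : α) (z : ℕ → Example d) (s : Usage) :
    (pure a : RAM d α) z s = some (a, s) := rfl

lemma RAM.charge_apply {α : Type} (c : ℕ) (a : α) (z : ℕ → Example d) (s : Usage) :
    (RAM.charge c a : RAM d α) z s = some (a, ⟨s.drawn, s.steps + c⟩) := rfl

lemma RAM.dot_apply (w x : Fin d → ℝ) (z : ℕ → Example d) (s : Usage) :
    RAM.dot w x z s = some (∑ i, w i * x i, ⟨s.drawn, s.steps + 3 * d⟩) := by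
  have key : ∀ (l : List (Fin d)) (acc : ℝ) (s : Usage),
      (l.foldlM (init := acc) fun acc i => (do
        RAM.tick
        let p ← RAM.mul (w i) (x i)
        RAM.add acc p : RAM d ℝ)) z s =
      some (acc + (l.map fun i => w i * x i).sum, ⟨s.drawn, s.steps + 3 * l.length⟩) := by
    intro l
    induction l with
    | nil => intro acc s; simp [RAM.pure_apply]
    | cons a l ih =>
      intro acc s
      rw [List.foldlM_cons]
      refine (ih (acc + w a * x a) ⟨s.drawn, s.steps + 1 + 1 + 1⟩).trans ?_
      rw [List.map_cons, List.sum_cons, List.length_cons]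
      congr 2
      · ring
      · congr 1; ring
  rw [RAM.dot, key, zero_add, List.length_finRange, Fin.sum_univ_def]

lemma RAM.subSmul_apply (w : Fin d → ℝ) (c : ℝ) (x : Fin d → ℝ) (z : ℕ → Example d) (s : Usage) :
    RAM.subSmul w c x z s = some (fun i => w i - c * x i, ⟨s.drawn, s.steps + 3 * d⟩) := by
  have key : ∀ (l : List (Fin d)) (v : Fin d → ℝ) (s : Usage),
      (l.foldlM (init := v) fun v i => (do
        RAM.tick
        let p ← RAM.mul c (x i)
        let q ← RAM.sub (w i) p
        return Function.update v i q : RAM d (Fin d → ℝ))) z s =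
      some (fun i => if i ∈ l then w i - c * x i else v i,
        ⟨s.drawn, s.steps + 3 * l.length⟩) := by
    intro l
    induction l with
    | nil => intro acc s; simp [RAM.pure_apply]
    | cons a l ih =>
      intro v s
      rw [List.foldlM_cons]
      refine (ih (Function.update v a (w a - c * x a)) ⟨s.drawn, s.steps + 1 + 1 + 1⟩).trans ?_
      rw [List.length_cons]
      congr 3
      · funext i
        by_cases h1 : i ∈ l
        · simp [h1]
        · by_cases h2 : i = a
          · subst h2; simp [h1]
          · simp [h1, h2]
      · ring
  rw [RAM.subSmul, key]
  simp

/-- The perceptron update of `w` on the example `z`. -/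
def update (w : EuclideanSpace ℝ (Fin d)) (z : Example d) : EuclideanSpace ℝ (Fin d) :=
  if ((z.2 : ℤ) : ℝ) * ⟪w, (z.1 : EuclideanSpace ℝ (Fin d))⟫ < 0 then
    w - (2 * ⟪w, (z.1 : EuclideanSpace ℝ (Fin d))⟫) • (z.1 : EuclideanSpace ℝ (Fin d))
  else w

lemma sum_mul_eq_inner (w x : EuclideanSpace ℝ (Fin d)) : ∑ i, w i * x i = ⟪w, x⟫ := by
  rw [PiLp.inner_apply]
  exact Finset.sum_congr rfl fun i _ => by simp [mul_comm]

lemma perceptronUpdate_apply (w : EuclideanSpace ℝ (Fin d)) (e : Example d) (z : ℕ → Example d)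
    (s : Usage) : ∃ c ≤ 6 * d + 3,
    perceptronUpdate (fun i => w i) (fun i => (e.1 : EuclideanSpace ℝ (Fin d)) i)
      (((e.2 : ℤ) : ℝ)) z s = some (fun i => update w e i, ⟨s.drawn, s.steps + c⟩) := by
  unfold perceptronUpdate update
  simp only [RAM.bind_apply, RAM.dot_apply, sum_mul_eq_inner, RAM.mul, RAM.lt, RAM.charge_apply,
    Option.bind_some]
  by_cases h : ((e.2 : ℤ) : ℝ) * ⟪w, (e.1 : EuclideanSpace ℝ (Fin d))⟫ < 0
  · refine ⟨6 * d + 3, le_rfl, ?_⟩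
    simp only [h, decide_true, if_true, RAM.bind_apply, RAM.charge_apply, Option.bind_some,
      RAM.subSmul_apply]
    congr 3
    ring
  · refine ⟨3 * d + 2, by omega, ?_⟩
    simp only [h, decide_false, if_false, Bool.false_eq_true, RAM.pure_apply]
    congr 3

lemma rejectionSample_succ_apply (w : EuclideanSpace ℝ (Fin d)) (b : ℝ) (N : ℕ)
    (z : ℕ → Example d) (s : Usage) [Decidable ((z s.drawn).1 ∈ slab w b)] :
    rejectionSample (fun i => w i) b (N + 1) z s =
      if (z s.drawn).1 ∈ slab w b then
        some ((fun i => ((z s.drawn).1 : EuclideanSpace ℝ (Fin d)) i, (((z s.drawn).2 : ℤ) : ℝ)),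
          ⟨s.drawn + 1, s.steps + (4 * d + 5)⟩)
      else rejectionSample (fun i => w i) b N z ⟨s.drawn + 1, s.steps + (4 * d + 5)⟩ := by
  rw [rejectionSample]
  simp only [RAM.bind_apply, RAM.tick, RAM.draw, RAM.dot_apply, sum_mul_eq_inner, RAM.div, RAM.le,
    RAM.charge_apply, Option.bind_some]
  have hs : s.steps + 1 + (d + 1) + 3 * d + 1 + 1 + 1 = s.steps + (4 * d + 5) := by ring
  rw [hs]
  by_cases h : (z s.drawn).1 ∈ slab w b
  · have h1 : b / 2 ≤ ⟪w, ((z s.drawn).1 : EuclideanSpace ℝ (Fin d))⟫ := h.1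
    have h2 : ⟪w, ((z s.drawn).1 : EuclideanSpace ℝ (Fin d))⟫ ≤ b := h.2
    simp [h, h1, h2, RAM.pure_apply]
  · rw [if_neg h]
    have h12 : ¬ (b / 2 ≤ ⟪w, ((z s.drawn).1 : EuclideanSpace ℝ (Fin d))⟫ ∧
      ⟪w, ((z s.drawn).1 : EuclideanSpace ℝ (Fin d))⟫ ≤ b) := h
    rw [if_neg (by simpa using h12)]

open Classical in
/-- Within the next `n` examples of the stream, the algorithm finishes with a vector in `G`, when
`t` iterations of epoch `k` with current vector `w` and then `j` further epochs remain. -/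
def Succeeds (m : ℕ → ℕ) (b : ℕ → ℝ) (G : Set (EuclideanSpace ℝ (Fin d))) :
    ℕ → ℕ → ℕ → ℕ → EuclideanSpace ℝ (Fin d) → (ℕ → Example d) → Prop
  | _, 0, _, 0, w, _ => w ∈ G
  | n, j + 1, k, 0, w, z => Succeeds m b G n j (k + 1) (m (k + 1)) w z
  | 0, _, _, _ + 1, _, _ => False
  | n + 1, j, k, t + 1, w, z =>
    if (z 0).1 ∈ slab w (b k) then Succeeds m b G n j k t (update w (z 0)) fun i => z (i + 1)
    else Succeeds m b G n j k (t + 1) w fun i => z (i + 1)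
  termination_by n j => (n, j)

/-- The conclusion of a run that starts with the resources `s`. -/
def RunsTo (G : Set (EuclideanSpace ℝ (Fin d))) (n a : ℕ) (s : Usage)
    (r : Option ((Fin d → ℝ) × Usage)) : Prop :=
  ∃ v ∈ G, ∃ n' ≤ n, ∃ T ≤ (10 * d + 9) * n' + a,
    r = some (fun i => v i, ⟨s.drawn + n', s.steps + T⟩)

lemma RunsTo.mono {G : Set (EuclideanSpace ℝ (Fin d))} {n a n₁ a₁ c e : ℕ} {s : Usage}
    {r : Option ((Fin d → ℝ) × Usage)} (h : RunsTo G n a ⟨s.drawn + e, s.steps + c⟩ r)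
    (hn : n + e ≤ n₁) (ha : a + c ≤ (10 * d + 9) * e + a₁) : RunsTo G n₁ a₁ s r := by
  obtain ⟨v, hv, n', hn', T, hT, rfl⟩ := h
  refine ⟨v, hv, e + n', by omega, c + T, ?_, by simp only [add_assoc]⟩
  rw [mul_add]
  omega

/-- The run from the start of an iteration: `t` iterations of epoch `k` and `j` epochs remain. -/
def epochRun (N : ℕ) (δ : ℝ) (m : ℕ → ℕ) (b : ℕ → ℝ) (j k t : ℕ) (θ : ℝ) (w : Fin d → ℝ) :
    RAM d (Fin d → ℝ) :=
  passiveModifiedPerceptron.iter N (b k) t w >>= fun v =>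
    passivePerceptron.epochs N δ m b j (k + 1) θ v

/-- The run from a point within an iteration, with at most `N₀` further trials of its loop, after
which `t` iterations of epoch `k` and `j` epochs remain. -/
def trialRun (N₀ N : ℕ) (δ : ℝ) (m : ℕ → ℕ) (b : ℕ → ℝ) (j k t : ℕ) (θ : ℝ) (w : Fin d → ℝ) :
    RAM d (Fin d → ℝ) :=
  rejectionSample w (b k) N₀ >>= fun r => perceptronUpdate w r.1 r.2 >>= fun w' =>
    epochRun N δ m b j k t θ w'

lemma epochRun_succ_apply (N : ℕ) (δ : ℝ) (m : ℕ → ℕ) (b : ℕ → ℝ) (j k t : ℕ) (θ : ℝ)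
    (w : Fin d → ℝ) (z : ℕ → Example d) (s : Usage) :
    epochRun N δ m b j k (t + 1) θ w z s =
      trialRun N N δ m b j k t θ w z ⟨s.drawn, s.steps + 1⟩ := by
  rw [epochRun, passiveModifiedPerceptron.iter, trialRun]
  simp only [RAM.bind_apply, RAM.tick, RAM.charge_apply, Option.bind_some, Option.bind_assoc,
    epochRun]

lemma epochRun_zero_succ_apply (N : ℕ) (δ : ℝ) (m : ℕ → ℕ) (b : ℕ → ℝ) (j k : ℕ) (θ : ℝ)
    (w : Fin d → ℝ) (z : ℕ → Example d) (s : Usage) :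
    epochRun N δ m b (j + 1) k 0 θ w z s =
      epochRun N δ m b j (k + 1) (m (k + 1)) (θ / 2) w z ⟨s.drawn, s.steps + 7⟩ := by
  rw [epochRun, passiveModifiedPerceptron.iter, epochRun]
  simp only [RAM.bind_apply, RAM.pure_apply, Option.bind_some, passivePerceptron.epochs, RAM.tick,
    RAM.div, RAM.add, RAM.mul, RAM.read, RAM.charge_apply, passiveModifiedPerceptron, add_assoc]
  rfl

lemma epochRun_zero_zero_apply (N : ℕ) (δ : ℝ) (m : ℕ → ℕ) (b : ℕ → ℝ) (k : ℕ) (θ : ℝ)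
    (w : Fin d → ℝ) (z : ℕ → Example d) (s : Usage) :
    epochRun N δ m b 0 k 0 θ w z s = some (w, s) := by
  rw [epochRun, passiveModifiedPerceptron.iter]
  simp only [RAM.bind_apply, RAM.pure_apply, Option.bind_some, passivePerceptron.epochs]

section Run

variable {m : ℕ → ℕ} {b : ℕ → ℝ} {G : Set (EuclideanSpace ℝ (Fin d))} {δ : ℝ}
  {z : ℕ → Example d} {N n : ℕ}

/-- Passing to the next epoch consumes no example, so this is an induction on `j` for fixed `n`. The
hypothesis `h` is the conclusion of `runsTo_trialRun` for the same `n`, which lets the two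
statements be proved by mutual induction. Each epoch costs `7` steps of overhead, and entering an
iteration one more. -/
lemma runsTo_epochRun
    (h : ∀ (j k t : ℕ) (θ : ℝ) (w : EuclideanSpace ℝ (Fin d)) (s : Usage),
      Succeeds m b G n j k (t + 1) w (fun i => z (s.drawn + i)) →
      RunsTo G n (8 * j) s (trialRun N N δ m b j k t θ (fun i => w i) z s))
    (j k t : ℕ) (θ : ℝ) (w : EuclideanSpace ℝ (Fin d)) (s : Usage)
    (hs : Succeeds m b G n j k t w (fun i => z (s.drawn + i))) :
    RunsTo G n (8 * j + 1) s (epochRun N δ m b j k t θ (fun i => w i) z s) := by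
  have hsucc : ∀ (j k t : ℕ) (θ : ℝ) (s : Usage),
      Succeeds m b G n j k (t + 1) w (fun i => z (s.drawn + i)) →
      RunsTo G n (8 * j + 1) s (epochRun N δ m b j k (t + 1) θ (fun i => w i) z s) := by
    intro j k t θ s hs
    rw [epochRun_succ_apply]
    exact (h j k t θ w ⟨s.drawn, s.steps + 1⟩ hs).mono (e := 0) (by omega) (by omega)
  induction j generalizing k t θ s with
  | zero =>
    cases t with
    | zero =>
      rw [Succeeds] at hs
      rw [epochRun_zero_zero_apply]
      exact ⟨w, hs, 0, by omega, 0, by omega, rfl⟩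
    | succ t => exact hsucc 0 k t θ s hs
  | succ j ih =>
    cases t with
    | zero =>
      rw [Succeeds] at hs
      rw [epochRun_zero_succ_apply]
      exact (ih (k + 1) (m (k + 1)) (θ / 2) ⟨s.drawn, s.steps + 7⟩ hs).mono (e := 0)
        (by omega) (by omega)
    | succ t => exact hsucc (j + 1) k t θ s hs

/-- Induction on the available examples `n`. No rejection loop can exceed its limit, as it uses at
most `n ≤ N` examples. An example costs at most `4 d + 5` for the trial, `6 d + 3` for the update
and `1` for entering the next iteration, in total `10 d + 9`. -/
lemma runsTo_trialRun (N₀ : ℕ) (hN : n ≤ N) (hN₀ : n ≤ N₀) (j k t : ℕ) (θ : ℝ)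
    (w : EuclideanSpace ℝ (Fin d)) (s : Usage)
    (hs : Succeeds m b G n j k (t + 1) w (fun i => z (s.drawn + i))) :
    RunsTo G n (8 * j) s (trialRun N₀ N δ m b j k t θ (fun i => w i) z s) := by
  classical
  induction n generalizing N₀ j k t θ w s with
  | zero => rw [Succeeds] at hs; exact hs.elim
  | succ n ih =>
    obtain ⟨N₀, rfl⟩ : ∃ N₁, N₀ = N₁ + 1 := ⟨N₀ - 1, by omega⟩
    have hz : (fun i => z (s.drawn + (i + 1))) = fun i => z (s.drawn + 1 + i) := by
      funext i; congr 1; ring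
    rw [Succeeds, hz, add_zero] at hs
    rw [trialRun, RAM.bind_apply, rejectionSample_succ_apply]
    split_ifs at hs ⊢ with hx
    · rw [Option.bind_some, RAM.bind_apply]
      obtain ⟨c, hc, hpu⟩ := perceptronUpdate_apply w (z s.drawn) z
        ⟨s.drawn + 1, s.steps + (4 * d + 5)⟩
      dsimp only
      rw [hpu, Option.bind_some]
      have := runsTo_epochRun (N := N) (δ := δ) (fun j k t θ w s hs => ih N (by omega) (by omega) j k t θ w s hs)
        j k t θ (update w (z s.drawn)) ⟨s.drawn + 1, s.steps + (4 * d + 5 + c)⟩ hs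
      simp only [add_assoc] at this ⊢
      exact this.mono (by omega) (by omega)
    · exact (ih N₀ (by omega) (by omega) j k t θ w ⟨s.drawn + 1, s.steps + (4 * d + 5)⟩ hs).mono
        (by omega) (by omega)

end Run

lemma passivePerceptron_of_succeeds {m : ℕ → ℕ} {b : ℕ → ℝ} {G : Set (EuclideanSpace ℝ (Fin d))}
    {ε δ : ℝ} {z : ℕ → Example d} {n : ℕ} {v₀ : EuclideanSpace ℝ (Fin d)}
    (hs : Succeeds m b G n ⌈Real.logb 2 (1 / ε)⌉₊ 0 0 v₀ z) :
    ∃ v ∈ G, ∃ n' ≤ n, ∃ T ≤ (10 * d + 9) * n' + (10 * ⌈Real.logb 2 (1 / ε)⌉₊ + 4),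
      passivePerceptron n (fun i => v₀ i) ε δ m b z ⟨0, 0⟩ = some (fun i => v i, ⟨n', T⟩) := by
  set k₀ := ⌈Real.logb 2 (1 / ε)⌉₊ with hk₀
  -- The initial state is encoded as a fictitious epoch `0` with no iterations left and `k₀` epochs
  -- to come. The steps already charged are those of `1 / ε` and of its rounded logarithm. The bound
  -- `n` on all examples serves as limit for each loop.
  have h := runsTo_epochRun (N := n) (δ := δ) (z := z)
    (fun j k t θ w s hs => runsTo_trialRun n le_rfl le_rfl j k t θ w s hs) k₀ 0 0 Real.pi v₀
    ⟨0, 0 + 1 + 2 * (k₀ + 1)⟩ (by simpa using hs)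
  have e : passivePerceptron n (fun i => v₀ i) ε δ m b z ⟨0, 0⟩ =
      epochRun n δ m b k₀ 0 0 Real.pi (fun i => v₀ i) z ⟨0, 0 + 1 + 2 * (k₀ + 1)⟩ := by
    rw [epochRun, passiveModifiedPerceptron.iter, passivePerceptron]
    simp only [RAM.bind_apply, RAM.pure_apply, Option.bind_some, RAM.div, RAM.ceilLogTwo,
      RAM.charge_apply, ← hk₀]
  rw [e]
  obtain ⟨v, hv, n', hn', T, hT, hr⟩ := h
  refine ⟨v, hv, n', hn', 0 + 1 + 2 * (k₀ + 1) + T, by omega, ?_⟩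
  rw [hr, zero_add]

/-! ### Probability of success -/

section Stream

variable {X : Type*} [MeasurableSpace X]

/-- Put an element in front of a stream. -/
def consStream (p : X × (ℕ → X)) : ℕ → X := fun i => Nat.casesOn i p.1 p.2

lemma measurable_consStream : Measurable (consStream (X := X)) := by
  refine measurable_pi_lambda _ fun i => ?_
  cases i with
  | zero => exact measurable_fst
  | succ i => exact (measurable_pi_apply i).comp measurable_snd

/-- The first example is independent of the shifted stream, which has the law of the whole stream;
this is checked on cylinder sets. -/
lemma map_consStream (D : Measure X) [IsProbabilityMeasure D] :
    (D.prod (Measure.infinitePi fun _ : ℕ => D)).map consStream =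
      Measure.infinitePi fun _ : ℕ => D := by
  refine Measure.eq_infinitePi _ fun s t ht => ?_
  rw [Measure.map_apply measurable_consStream
    (MeasurableSet.pi s.countable_toSet fun i _ => ht i)]
  set s' : Finset ℕ := s.preimage Nat.succ (Nat.succ_injective.injOn) with hs'
  have hpre : consStream ⁻¹' (Set.pi s t) =
      (if 0 ∈ s then t 0 else Set.univ) ×ˢ (Set.pi s' fun i => t (i + 1)) := by
    ext ⟨x, z⟩
    simp only [Set.mem_preimage, Set.mem_pi, Set.mem_prod, hs', Finset.mem_coe,
      Finset.mem_preimage]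
    constructor
    · intro h
      refine ⟨?_, fun i hi => h (i + 1) hi⟩
      split_ifs with h0
      · exact h 0 h0
      · trivial
    · rintro ⟨h0, h1⟩ i hi
      cases i with
      | zero => rw [if_pos hi] at h0; exact h0
      | succ i => exact h1 i hi
  rw [hpre, Measure.prod_prod, Measure.infinitePi_pi _ (fun i _ => ht (i + 1))]
  have hprod : ∏ i ∈ s', D (t (i + 1)) = ∏ i ∈ s.erase 0, D (t i) := by
    have := Finset.prod_preimage Nat.succ (s.erase 0) (Nat.succ_injective.injOn) (fun i => D (t i))
      (by
        intro x hx hx'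
        exact absurd ⟨x - 1, by have := Finset.ne_of_mem_erase hx; omega⟩ hx')
    rw [← this]
    refine Finset.prod_congr ?_ fun _ _ => rfl
    ext i; simp [hs']
  rw [hprod]
  split_ifs with h0
  · rw [← Finset.mul_prod_erase s (fun i => D (t i)) h0]
  · rw [measure_univ, one_mul, Finset.erase_eq_of_notMem h0]

lemma infinitePi_eq_lintegral (D : Measure X) [IsProbabilityMeasure D] {A : Set (ℕ → X)}
    (hA : MeasurableSet A) : (Measure.infinitePi fun _ : ℕ => D) A =
      ∫⁻ x, (Measure.infinitePi fun _ : ℕ => D) {z | consStream (x, z) ∈ A} ∂D := by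
  conv_lhs => rw [← map_consStream D]
  rw [Measure.map_apply measurable_consStream hA,
    Measure.prod_apply (measurable_consStream hA)]
  rfl

end Stream

lemma measurable_update : Measurable fun p : EuclideanSpace ℝ (Fin d) × Example d =>
    update p.1 p.2 := by
  have h : Measurable fun p : EuclideanSpace ℝ (Fin d) × Example d => (((p.2.2 : ℤ) : ℝ)) :=
    (measurable_from_top (f := fun a : ℤ => (a : ℝ))).comp
      ((Measurable.of_discrete (f := fun a : ℤˣ => (a : ℤ))).comp
        (measurable_snd.comp measurable_snd))
  unfold update
  refine Measurable.ite (measurableSet_lt (h.mul ?_) measurable_const) ?_ measurable_fst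
  · fun_prop
  · fun_prop

lemma measurableSet_succeeds (m : ℕ → ℕ) (b : ℕ → ℝ) {G : Set (EuclideanSpace ℝ (Fin d))}
    (hG : MeasurableSet G) (n j k t : ℕ) :
    MeasurableSet {p : EuclideanSpace ℝ (Fin d) × (ℕ → Example d) |
      Succeeds m b G n j k t p.1 p.2} := by
  -- States with no iterations left are resolved without reading an example, by an inner induction
  -- on `j`. Only states with an iteration pending need the induction on `n`.
  have hzero : ∀ n, (∀ j k t, MeasurableSet {p : EuclideanSpace ℝ (Fin d) × (ℕ → Example d) |
      Succeeds m b G n j k (t + 1) p.1 p.2}) → ∀ j k t,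
      MeasurableSet {p : EuclideanSpace ℝ (Fin d) × (ℕ → Example d) |
      Succeeds m b G n j k t p.1 p.2} := by
    intro n h j
    induction j with
    | zero =>
      intro k t
      cases t with
      | zero => simp only [Succeeds]; exact measurable_fst hG
      | succ t => exact h 0 k t
    | succ j ih =>
      intro k t
      cases t with
      | zero => simp only [Succeeds]; exact ih _ _
      | succ t => exact h (j + 1) k t
  induction n generalizing j k t with
  | zero =>
    refine hzero 0 (fun j k t => ?_) j k t
    simp [Succeeds]
  | succ n ih =>
    refine hzero (n + 1) (fun j k t => ?_) j k t
    simp only [Succeeds]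
    have hshift : Measurable fun p : EuclideanSpace ℝ (Fin d) × (ℕ → Example d) =>
        fun i => p.2 (i + 1) :=
      measurable_pi_lambda _ fun i => (measurable_pi_apply (i + 1)).comp measurable_snd
    have hz0 : Measurable fun p : EuclideanSpace ℝ (Fin d) × (ℕ → Example d) => p.2 0 :=
      (measurable_pi_apply 0).comp measurable_snd
    have hslab : MeasurableSet {p : EuclideanSpace ℝ (Fin d) × (ℕ → Example d) |
        (p.2 0).1 ∈ slab p.1 (b k)} := by
      have : Measurable fun p : EuclideanSpace ℝ (Fin d) × (ℕ → Example d) =>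
          ⟪p.1, ((p.2 0).1 : EuclideanSpace ℝ (Fin d))⟫ :=
        measurable_fst.inner (measurable_subtype_coe.comp (measurable_fst.comp hz0))
      exact this measurableSet_Icc
    have h1 : MeasurableSet {p : EuclideanSpace ℝ (Fin d) × (ℕ → Example d) |
        Succeeds m b G n j k t (update p.1 (p.2 0)) fun i => p.2 (i + 1)} :=
      ((measurable_update.comp (measurable_fst.prodMk hz0)).prodMk hshift) (ih j k t)
    have h2 : MeasurableSet {p : EuclideanSpace ℝ (Fin d) × (ℕ → Example d) |
        Succeeds m b G n j k (t + 1) p.1 fun i => p.2 (i + 1)} :=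
      (measurable_fst.prodMk hshift) (ih j k (t + 1))
    convert (hslab.inter h1).union (hslab.compl.inter h2) using 1
    ext p
    simp only [Set.mem_ofPred_eq, Set.mem_union, Set.mem_inter_iff, Set.mem_compl_iff]
    split_ifs with h <;> simp [h]

/-- The probability that the algorithm does not succeed within `n` examples. -/
def failProb (D : Measure (Example d)) [IsProbabilityMeasure D] (m : ℕ → ℕ) (b : ℕ → ℝ)
    (G : Set (EuclideanSpace ℝ (Fin d))) (n j k t : ℕ) (w : EuclideanSpace ℝ (Fin d)) : ℝ≥0∞ :=
  (Measure.infinitePi fun _ : ℕ => D) {z | ¬ Succeeds m b G n j k t w z}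

section FailProb

variable {D : Measure (Example d)} [IsProbabilityMeasure D] {m : ℕ → ℕ} {b : ℕ → ℝ}
  {G : Set (EuclideanSpace ℝ (Fin d))}

lemma measurableSet_succeeds_stream (hG : MeasurableSet G) (n j k t : ℕ)
    (w : EuclideanSpace ℝ (Fin d)) : MeasurableSet {z | Succeeds m b G n j k t w z} :=
  (measurable_prodMk_left (x := w)) (measurableSet_succeeds m b hG n j k t)

lemma failProb_le_one (n j k t : ℕ) (w : EuclideanSpace ℝ (Fin d)) :
    failProb D m b G n j k t w ≤ 1 := prob_le_one

lemma failProb_succ (hG : MeasurableSet G) (n j k t : ℕ) (w : EuclideanSpace ℝ (Fin d))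
    [DecidablePred fun x : Example d => x.1 ∈ slab w (b k)] :
    failProb D m b G (n + 1) j k (t + 1) w =
      ∫⁻ x, (if x.1 ∈ slab w (b k) then failProb D m b G n j k t (update w x)
        else failProb D m b G n j k (t + 1) w) ∂D := by
  have hc : MeasurableSet {z | ¬ Succeeds m b G (n + 1) j k (t + 1) w z} :=
    (measurableSet_succeeds_stream hG (n + 1) j k (t + 1) w).compl
  rw [failProb, infinitePi_eq_lintegral D hc]
  refine lintegral_congr fun x => ?_
  have e : ∀ z, Succeeds m b G (n + 1) j k (t + 1) w (consStream (x, z)) ↔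
      if x.1 ∈ slab w (b k) then Succeeds m b G n j k t (update w x) z
      else Succeeds m b G n j k (t + 1) w z := by
    intro z
    rw [Succeeds]
    by_cases hx : x.1 ∈ slab w (b k)
    · rw [if_pos hx, if_pos (show (consStream (x, z) 0).1 ∈ slab w (b k) from hx)]
      rfl
    · rw [if_neg hx, if_neg (show ¬ (consStream (x, z) 0).1 ∈ slab w (b k) from hx)]
      rfl
  simp only [Set.mem_ofPred_eq, e]
  split_ifs <;> rfl

/-- The correction is the reflection of `w` in the hyperplane orthogonal to the unit vector `x`. -/
lemma norm_update {w : EuclideanSpace ℝ (Fin d)} (hw : ‖w‖ = 1) (x : Example d) :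
    ‖update w x‖ = 1 := by
  unfold update
  split_ifs
  · have h := norm_sub_sq_real w ((2 * ⟪w, (x.1 : EuclideanSpace ℝ (Fin d))⟫) •
      (x.1 : EuclideanSpace ℝ (Fin d)))
    rw [inner_smul_right, norm_smul, hw, norm_eq_of_mem_sphere, Real.norm_eq_abs, mul_one, sq_abs] at h
    have h2 : ‖w - (2 * ⟪w, (x.1 : EuclideanSpace ℝ (Fin d))⟫) •
      (x.1 : EuclideanSpace ℝ (Fin d))‖ ^ 2 = 1 := by rw [h]; ring
    exact (pow_eq_one_iff_of_nonneg (norm_nonneg _) two_ne_zero).1 h2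
  · exact hw

/-- The potential `B` bounds the probability that an epoch ends outside of its target, `f i` is the
value of the potential at the beginning of epoch `i`, and `p` bounds the probability of a slab
from below. -/
theorem failProb_le (hG : MeasurableSet G) {B : ℕ → ℕ → EuclideanSpace ℝ (Fin d) → ℝ} {f : ℕ → ℝ}
    {p : ℝ} {k₀ : ℕ} (hB0 : ∀ k t w, 0 ≤ B k t w) (hf0 : ∀ k, 0 ≤ f k)
    (hp : ∀ k ∈ Set.Icc 1 k₀, ∀ w, ‖w‖ = 1 → p ≤ D.real (Prod.fst ⁻¹' slab w (b k)))
    (hBm : ∀ k t w, IntegrableOn (fun x => B k t (update w x)) (Prod.fst ⁻¹' slab w (b k)) D)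
    (hB : ∀ k ∈ Set.Icc 1 k₀, ∀ t w, ‖w‖ = 1 → B k (t + 1) w < 1 →
      ∫ x in Prod.fst ⁻¹' slab w (b k), B k t (update w x) ∂D ≤
        D.real (Prod.fst ⁻¹' slab w (b k)) * B k (t + 1) w)
    (hend : ∀ w, ‖w‖ = 1 → w ∉ G → 1 ≤ B k₀ 0 w)
    (hnext : ∀ k ∈ Set.Ico 1 k₀, ∀ w, ‖w‖ = 1 → B k 0 w < 1 → B (k + 1) (m (k + 1)) w ≤ f (k + 1))
    (n j k t : ℕ) (w : EuclideanSpace ℝ (Fin d)) (hk : 1 ≤ k) (hjk : k + j = k₀) (hw : ‖w‖ = 1) :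
    failProb D m b G n j k t w ≤ ENNReal.ofReal (B k t w + ∑ i ∈ Finset.Ioc k k₀, f i +
      2 ^ (t + ∑ i ∈ Finset.Ioc k k₀, m i) * (1 - p / 2) ^ n) := by
  classical
  have hp1 : p ≤ 1 := (hp k ⟨hk, by omega⟩ w hw).trans measureReal_le_one
  have hr0 : 0 ≤ 1 - p / 2 := by linarith
  have hsum0 : ∀ k, 0 ≤ ∑ i ∈ Finset.Ioc k k₀, f i := fun k => Finset.sum_nonneg fun i _ => hf0 i
  have hpow0 : ∀ k t n, 0 ≤ (2 : ℝ) ^ (t + ∑ i ∈ Finset.Ioc k k₀, m i) * (1 - p / 2) ^ n :=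
    fun k t n => by positivity
  -- The bound is trivial once the potential reaches `1`; this replaces stopping the process at that
  -- time.
  have hbig : ∀ n j k t w, 1 ≤ B k t w → failProb D m b G n j k t w ≤
      ENNReal.ofReal (B k t w + ∑ i ∈ Finset.Ioc k k₀, f i +
      2 ^ (t + ∑ i ∈ Finset.Ioc k k₀, m i) * (1 - p / 2) ^ n) := by
    intro n j k t w h
    refine (failProb_le_one _ _ _ _ _).trans ?_
    rw [← ENNReal.ofReal_one]
    exact ENNReal.ofReal_le_ofReal (by linarith [hsum0 k, hpow0 k t n])
  have hzero : ∀ n, (∀ j k t w, 1 ≤ k → k + j = k₀ → ‖w‖ = 1 →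
      failProb D m b G n j k (t + 1) w ≤ ENNReal.ofReal (B k (t + 1) w +
        ∑ i ∈ Finset.Ioc k k₀, f i +
        2 ^ (t + 1 + ∑ i ∈ Finset.Ioc k k₀, m i) * (1 - p / 2) ^ n)) →
      ∀ j k t w, 1 ≤ k → k + j = k₀ → ‖w‖ = 1 →
      failProb D m b G n j k t w ≤ ENNReal.ofReal (B k t w + ∑ i ∈ Finset.Ioc k k₀, f i +
        2 ^ (t + ∑ i ∈ Finset.Ioc k k₀, m i) * (1 - p / 2) ^ n) := by
    intro n h j
    induction j with
    | zero =>
      intro k t w hk hjk hw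
      cases t with
      | zero =>
        by_cases hwG : w ∈ G
        · have : failProb D m b G n 0 k 0 w = 0 := by simp [failProb, Succeeds, hwG]
          rw [this]; exact zero_le
        · exact hbig _ _ _ _ _ (by rw [show k = k₀ by omega]; exact hend w hw hwG)
      | succ t => exact h 0 k t w hk hjk hw
    | succ j ih =>
      intro k t w hk hjk hw
      cases t with
      | zero =>
        rcases le_or_gt 1 (B k 0 w) with h1 | h1
        · exact hbig _ _ _ _ _ h1
        · have e : failProb D m b G n (j + 1) k 0 w =
              failProb D m b G n j (k + 1) (m (k + 1)) w := by simp only [failProb, Succeeds]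
          rw [e]
          refine (ih (k + 1) (m (k + 1)) w (by omega) (by omega) hw).trans
            (ENNReal.ofReal_le_ofReal ?_)
          have hnx := hnext k ⟨hk, by omega⟩ w hw h1
          have hI : Finset.Ioc k k₀ = insert (k + 1) (Finset.Ioc (k + 1) k₀) := by
            ext i; simp only [Finset.mem_Ioc, Finset.mem_insert]; omega
          rw [hI, Finset.sum_insert (by simp), Finset.sum_insert (by simp), zero_add]
          linarith [hB0 k 0 w]
      | succ t => exact h (j + 1) k t w hk hjk hw
  induction n generalizing j k t w with
  | zero =>
    refine hzero 0 (fun j k t w hk hjk hw => ?_) j k t w hk hjk hw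
    refine (failProb_le_one _ _ _ _ _).trans ?_
    rw [← ENNReal.ofReal_one]
    refine ENNReal.ofReal_le_ofReal ?_
    have h2 : (1 : ℝ) ≤ 2 ^ (t + 1 + ∑ i ∈ Finset.Ioc k k₀, m i) := one_le_pow₀ (by norm_num)
    have := hB0 k (t + 1) w
    have := hsum0 k
    rw [pow_zero, mul_one]
    linarith
  | succ n ih =>
    refine hzero (n + 1) (fun j k t w hk hjk hw => ?_) j k t w hk hjk hw
    rcases le_or_gt 1 (B k (t + 1) w) with h1 | h1
    · exact hbig _ _ _ _ _ h1
    rw [failProb_succ hG]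
    set R : Set (Example d) := Prod.fst ⁻¹' slab w (b k) with hR
    have hRm : MeasurableSet R := measurable_fst (measurableSet_slab' w (b k))
    set F := ∑ i ∈ Finset.Ioc k k₀, f i
    set M := ∑ i ∈ Finset.Ioc k k₀, m i
    set q : ℝ := 2 ^ (t + M) * (1 - p / 2) ^ n with hq
    have hq0 : 0 ≤ q := by positivity
    have hF0 : 0 ≤ F := hsum0 k
    have hk' : k ∈ Set.Icc 1 k₀ := ⟨hk, by omega⟩
    have e2 : (2 : ℝ) ^ (t + 1 + M) * (1 - p / 2) ^ n = 2 * q := by rw [hq]; ring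
    have e3 : (2 : ℝ) ^ (t + 1 + M) * (1 - p / 2) ^ (n + 1) = 2 * q * (1 - p / 2) := by
      rw [hq]; ring
    have hi : Integrable (fun x => R.indicator (fun x => B k t (update w x) + F + q) x +
        Rᶜ.indicator (fun _ => B k (t + 1) w + F + 2 * q) x) D := by
      refine Integrable.add ?_ ((integrable_const _).indicator hRm.compl)
      rw [integrable_indicator_iff hRm]
      exact ((hBm k t w).add (integrable_const _)).add (integrable_const _)
    calc _ ≤ ∫⁻ x, ENNReal.ofReal (R.indicator (fun x => B k t (update w x) + F + q) x +
          Rᶜ.indicator (fun _ => B k (t + 1) w + F + 2 * q) x) ∂D := by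
          refine lintegral_mono fun x => ?_
          by_cases hx : x.1 ∈ slab w (b k)
          · have hxR : x ∈ R := hx
            rw [if_pos hx, Set.indicator_of_mem hxR, Set.indicator_of_notMem (by simpa using hxR),
              add_zero]
            exact ih j k t (update w x) hk hjk (norm_update hw x)
          · have hxR : x ∉ R := hx
            rw [if_neg hx, Set.indicator_of_notMem hxR, Set.indicator_of_mem hxR, zero_add, ← e2]
            exact ih j k (t + 1) w hk hjk hw
      _ = ENNReal.ofReal (∫ x, (R.indicator (fun x => B k t (update w x) + F + q) x +
          Rᶜ.indicator (fun _ => B k (t + 1) w + F + 2 * q) x) ∂D) := by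
          refine (ofReal_integral_eq_lintegral_ofReal hi (Filter.Eventually.of_forall fun x => ?_)).symm
          refine add_nonneg (Set.indicator_nonneg (fun x _ => ?_) _)
            (Set.indicator_nonneg (fun x _ => ?_) _)
          · have := hB0 k t (update w x); linarith
          · have := hB0 k (t + 1) w; linarith
      _ ≤ _ := by
          refine ENNReal.ofReal_le_ofReal ?_
          rw [integral_add, integral_indicator hRm, integral_indicator hRm.compl,
            integral_add, integral_add (hBm k t w) (integrable_const _), e3]
          · have hstep := hB k hk' t w hw h1
            have hpR := hp k hk' w hw
            have hcompl : D.real Rᶜ = 1 - D.real R := probReal_compl_eq_one_sub hRm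
            simp only [integral_const, measureReal_restrict_apply_univ, smul_eq_mul, hcompl]
            rw [← hR] at hstep hpR
            -- With `P ≥ p` the mass of the band, an accepted example halves `2 q` and a rejected
            -- one keeps it: `P q + (1 - P) 2 q = 2 q (1 - P / 2) ≤ 2 q (1 - p / 2)`. The potential
            -- averages to at most its old value by `hstep`.
            nlinarith
          · exact (hBm k t w).add (integrable_const _)
          · exact integrable_const _
          · rw [integrable_indicator_iff hRm]
            exact ((hBm k t w).add (integrable_const _)).add (integrable_const _)
          · exact (integrable_const _).indicator hRm.compl

end FailProb

/-! ### The potential of an epoch -/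

/-- The potential of a vector `w` with `t` iterations to go in an epoch with angle scale `τ`
and logarithmic factor `L`; `ρ` is the contraction per update. -/
def potential (u : EuclideanSpace ℝ (Fin d)) (τ L ρ : ℝ) (t : ℕ) (w : EuclideanSpace ℝ (Fin d)) : ℝ :=
  ρ ^ t * Real.exp (64 * L / τ ^ 2 * ((1 - ⟪u, w⟫) - τ ^ 2 / 8)) +
    Real.exp (64 * L / τ ^ 2 * ((1 - ⟪u, w⟫) - 6 * τ ^ 2)) + 2 * t * Real.exp (-2 * L)

/-- In the band `w ⬝ x > 0`, so a mistake occurs exactly for `y = -1`. -/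
lemma inner_update {w : EuclideanSpace ℝ (Fin d)} {b : ℝ} (hb : 0 < b)
    (u : EuclideanSpace ℝ (Fin d)) {z : Example d} (hz : z.1 ∈ slab w b) :
    1 - ⟪u, update w z⟫ = (1 - ⟪u, w⟫) + angleGain u w z := by
  have h1 : b / 2 ≤ ⟪w, (z.1 : EuclideanSpace ℝ (Fin d))⟫ := hz.1
  unfold update angleGain
  rcases Int.units_eq_one_or z.2 with h | h
  · rw [h, if_neg, if_neg]
    · ring
    · decide
    · simp only [Units.val_one, Int.cast_one, one_mul, not_lt]; linarith
  · rw [h, if_pos, if_pos rfl]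
    · rw [inner_sub_right, inner_smul_right]; ring
    · simp only [Units.val_neg, Units.val_one, Int.cast_neg, Int.cast_one, neg_mul, one_mul]; linarith

/-! ### The potential is a supermartingale within an epoch -/

section Epoch

variable {D : Measure (Example d)} [IsProbabilityMeasure D]

lemma integrableOn_exp_inner_update (u : EuclideanSpace ℝ (Fin d)) (a c : ℝ)
    (hu : ‖u‖ = 1) (w : EuclideanSpace ℝ (Fin d)) (b : ℝ) :
    IntegrableOn (fun z => Real.exp (a * ((1 - ⟪u, update w z⟫) - c)))
      (Prod.fst ⁻¹' slab w b) D := by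
  have hm : Measurable fun z : Example d => update w z :=
    measurable_update.comp measurable_prodMk_left
  refine Integrable.integrableOn (Integrable.of_bound (C := Real.exp (|a| * (1 + 3 * ‖w‖ + |c|))) ?_
    (Filter.Eventually.of_forall fun z => ?_))
  · exact (by fun_prop : Measurable fun z : Example d =>
      Real.exp (a * ((1 - ⟪u, update w z⟫) - c))).aestronglyMeasurable
  · rw [Real.norm_eq_abs, Real.abs_exp, Real.exp_le_exp]
    have hx : ‖(z.1 : EuclideanSpace ℝ (Fin d))‖ = 1 := by simp
    have h1 : ‖update w z‖ ≤ 3 * ‖w‖ := by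
      unfold update
      split_ifs
      · refine (norm_sub_le _ _).trans ?_
        rw [norm_smul, hx, mul_one, norm_mul, Real.norm_eq_abs, Real.norm_eq_abs]
        have := abs_real_inner_le_norm w (z.1 : EuclideanSpace ℝ (Fin d))
        rw [hx, mul_one] at this
        norm_num
        linarith
      · linarith [norm_nonneg w]
    have h2 : |⟪u, update w z⟫| ≤ 3 * ‖w‖ := by
      have := abs_real_inner_le_norm u (update w z)
      rw [hu, one_mul] at this
      exact this.trans h1
    refine (le_abs_self _).trans ?_
    rw [abs_mul]
    refine mul_le_mul_of_nonneg_left ?_ (abs_nonneg a)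
    refine (abs_sub _ _).trans (add_le_add ((abs_sub _ _).trans ?_) le_rfl)
    rw [abs_one]
    linarith

lemma potential_nonneg (u : EuclideanSpace ℝ (Fin d)) (τ L : ℝ) {ρ : ℝ} (hρ : 0 ≤ ρ) (t : ℕ)
    (w : EuclideanSpace ℝ (Fin d)) : 0 ≤ potential u τ L ρ t w := by
  unfold potential
  positivity

lemma integrableOn_potential (u : Sphere d) (τ L ρ : ℝ) (t : ℕ)
    (w : EuclideanSpace ℝ (Fin d)) (b : ℝ) :
    IntegrableOn (fun z => potential (u : EuclideanSpace ℝ (Fin d)) τ L ρ t (update w z))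
      (Prod.fst ⁻¹' slab w b) D := by
  have hu : ‖(u : EuclideanSpace ℝ (Fin d))‖ = 1 := by simp
  unfold potential
  exact (((integrableOn_exp_inner_update _ _ _ hu w b).const_mul _).add
    (integrableOn_exp_inner_update _ _ _ hu w b)).add (integrable_const _)

/-- Integrated form of the drift: below the low level the potential stays small, above it the
exponential contracts. -/
lemma integral_exp_le (hd : 2 ≤ d) (hD : D.map Prod.fst = uniformSphere d) (u : Sphere d)
    {w : EuclideanSpace ℝ (Fin d)} (hw : ‖w‖ = 1) {τ L b β ν : ℝ} (hτ0 : 0 < τ) (hτ : τ ≤ 1 / 2)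
    (hL : 1 ≤ L) (hb : 0 < b) (hβ0 : 0 < β) (hβ : β ≤ 1 / 10 ^ 6)
    (hb1 : β * (τ / L) ≤ b * √d) (hb2 : b * √d ≤ 1 / 10 ^ 6 * (τ / L))
    (hnoise : AdversarialNoise D ν u) (hν : ν ≤ (uniformSphere d).real (slab w b) / 50000)
    (hhigh : 1 - ⟪(u : EuclideanSpace ℝ (Fin d)), w⟫ < 6 * τ ^ 2) :
    ∫ z in Prod.fst ⁻¹' slab w b,
        Real.exp (64 * L / τ ^ 2 * (1 - ⟪(u : EuclideanSpace ℝ (Fin d)), update w z⟫)) ∂D ≤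
      (uniformSphere d).real (slab w b) * ((1 - β / (5 * d)) *
        Real.exp (64 * L / τ ^ 2 * (1 - ⟪(u : EuclideanSpace ℝ (Fin d)), w⟫)) +
        Real.exp (64 * L / τ ^ 2 * (3 * τ ^ 2 / 32))) := by
  have hu : ‖(u : EuclideanSpace ℝ (Fin d))‖ = 1 := by simp
  have hRm : MeasurableSet (Prod.fst ⁻¹' slab w b : Set (Example d)) :=
    measurable_fst (measurableSet_slab' w b)
  have hPR := measureReal_marginal hD _ (measurableSet_slab' w b)
  have hd1 : (1 : ℝ) ≤ d := by exact_mod_cast (by omega : 1 ≤ d)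
  have hsd : 1 ≤ √(d : ℝ) := Real.one_le_sqrt.2 hd1
  set Λ := 64 * L / τ ^ 2 with hΛ
  have hΛ0 : 0 < Λ := by positivity
  set Φ := 1 - ⟪(u : EuclideanSpace ℝ (Fin d)), w⟫ with hΦ
  have hΦ0 : 0 ≤ Φ := by
    have := real_inner_le_norm (u : EuclideanSpace ℝ (Fin d)) w
    rw [hu, hw] at this
    linarith
  have hS2 : 1 - ⟪w, (u : EuclideanSpace ℝ (Fin d))⟫ ^ 2 = Φ * (2 - Φ) := by
    rw [real_inner_comm, hΦ]; ring
  have hΦ2 : Φ ≤ 3 / 2 := by nlinarith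
  set P := (uniformSphere d).real (slab w b)
  have hP0 : 0 ≤ P := measureReal_nonneg
  have hρ0 : 0 ≤ 1 - β / (5 * d) := by
    have : β / (5 * d) ≤ 1 := by rw [div_le_one (by positivity)]; linarith
    linarith
  have hτL : τ / L ≤ τ := div_le_self hτ0.le hL
  have hbτ : b ≤ 1 / 10 ^ 6 * τ := by
    have := le_mul_of_one_le_right hb.le hsd
    linarith
  -- Below `τ² / 16` the sine may be too small for the drift lemma, but one step moves `Φ` so little
  -- that it stays below `3 τ² / 32`. Above, `Φ < 6 τ²` places the sine between `τ / 6` and `4 τ`,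
  -- and the drift lemma applies.
  rcases lt_or_ge Φ (τ ^ 2 / 16) with hlow | hlow
  · have hpt : ∀ z ∈ (Prod.fst ⁻¹' slab w b : Set (Example d)),
        Real.exp (Λ * (1 - ⟪(u : EuclideanSpace ℝ (Fin d)), update w z⟫)) ≤
          Real.exp (Λ * (3 * τ ^ 2 / 32)) := by
      intro z hz
      rw [Real.exp_le_exp]
      refine mul_le_mul_of_nonneg_left ?_ hΛ0.le
      have hg := (le_abs_self _).trans (abs_angleGain_le hd hw hu hb.le hz)
      rw [hS2] at hg
      have hS : √(Φ * (2 - Φ)) ≤ τ := Real.sqrt_le_iff.2 ⟨hτ0.le, by nlinarith⟩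
      rw [inner_update hb _ hz]
      have : 2 * b * (b + √(Φ * (2 - Φ))) ≤ 2 * (1 / 10 ^ 6 * τ) * (1 / 10 ^ 6 * τ + τ) := by
        gcongr
      nlinarith [sq_nonneg τ]
    have hint : IntegrableOn (fun z => Real.exp (Λ * (1 - ⟪(u : EuclideanSpace ℝ (Fin d)), update w z⟫)))
        (Prod.fst ⁻¹' slab w b) D := by
      simpa using integrableOn_exp_inner_update (D := D) (u : EuclideanSpace ℝ (Fin d)) Λ 0 hu w b
    refine (setIntegral_mono_on hint (integrable_const _) hRm hpt).trans ?_
    simp only [integral_const, measureReal_restrict_apply_univ, smul_eq_mul, hPR]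
    refine mul_le_mul_of_nonneg_left ?_ hP0
    have : 0 ≤ (1 - β / (5 * d)) * Real.exp (Λ * Φ) := mul_nonneg hρ0 (Real.exp_pos _).le
    linarith
  · have hSlow : τ / 6 ≤ √(Φ * (2 - Φ)) := Real.le_sqrt_of_sq_le (by nlinarith)
    have hShigh : √(Φ * (2 - Φ)) ≤ 4 * τ := Real.sqrt_le_iff.2 ⟨by positivity, by nlinarith⟩
    have hstep := integral_exp_angleGain_le (Λ := Λ) hd hD hw u hb hΛ0 ?_ ?_ hnoise hν
    · have heq : ∫ z in Prod.fst ⁻¹' slab w b,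
          Real.exp (Λ * (1 - ⟪(u : EuclideanSpace ℝ (Fin d)), update w z⟫)) ∂D =
          Real.exp (Λ * Φ) * ∫ z in Prod.fst ⁻¹' slab w b,
            Real.exp (Λ * angleGain (u : EuclideanSpace ℝ (Fin d)) w z) ∂D := by
        rw [← integral_const_mul]
        refine setIntegral_congr_fun hRm fun z hz => ?_
        simp only [inner_update hb _ hz, mul_add, Real.exp_add, hΦ]
      rw [heq]
      have hγ : β / (5 * d) ≤ Λ * b * √(1 - ⟪w, (u : EuclideanSpace ℝ (Fin d))⟫ ^ 2) / (50 * √d) := by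
        rw [hS2]
        have e : Λ * b * √(Φ * (2 - Φ)) / (50 * √d) = Λ * (b * √d) * √(Φ * (2 - Φ)) / (50 * (√d * √d)) := by
          field_simp
        rw [e, Real.mul_self_sqrt (by linarith)]
        -- The contraction rate is at least `64 β / (6 * 50 * d)`, slightly more than `β / (5 d)`.
        have h1 : Λ * (β * (τ / L)) * (τ / 6) ≤ Λ * (b * √d) * √(Φ * (2 - Φ)) := by gcongr
        have h2 : Λ * (β * (τ / L)) * (τ / 6) = 64 / 6 * β := by rw [hΛ]; field_simp
        rw [h2] at h1
        rw [div_le_div_iff₀ (by positivity) (by positivity)]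
        nlinarith
      calc _ ≤ Real.exp (Λ * Φ) * (P * (1 - β / (5 * d))) := by
            refine mul_le_mul_of_nonneg_left (hstep.trans ?_) (Real.exp_pos _).le
            exact mul_le_mul_of_nonneg_left (by linarith) hP0
        _ ≤ _ := by
            have : 0 ≤ P * Real.exp (Λ * (3 * τ ^ 2 / 32)) := mul_nonneg hP0 (Real.exp_pos _).le
            linarith
    · rw [hS2]; linarith
    · rw [hS2]
      have hbb : b ≤ 1 / 10 ^ 6 * (τ / L) := (le_mul_of_one_le_right hb.le hsd).trans hb2
      calc Λ * b * √(Φ * (2 - Φ)) ≤ Λ * (1 / 10 ^ 6 * (τ / L)) * (4 * τ) := by gcongr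
        _ = 256 / 10 ^ 6 := by rw [hΛ]; field_simp; norm_num
        _ ≤ _ := by norm_num

/-- Both exponentials of the potential are multiples of `exp (Λ Φ)`. The contraction turns `ρ ^ t`
into `ρ ^ (t + 1)` in the first and is discarded in the second. The additive error, due to low
values of `Φ`, is paid by the decrease of the linear term. -/
lemma integral_potential_le (hd : 2 ≤ d) (hD : D.map Prod.fst = uniformSphere d) (u : Sphere d)
    {w : EuclideanSpace ℝ (Fin d)} (hw : ‖w‖ = 1) {τ L b β ν : ℝ} (hτ0 : 0 < τ) (hτ : τ ≤ 1 / 2)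
    (hL : 1 ≤ L) (hb : 0 < b) (hβ0 : 0 < β) (hβ : β ≤ 1 / 10 ^ 6)
    (hb1 : β * (τ / L) ≤ b * √d) (hb2 : b * √d ≤ 1 / 10 ^ 6 * (τ / L))
    (hnoise : AdversarialNoise D ν u) (hν : ν ≤ (uniformSphere d).real (slab w b) / 50000) (t : ℕ)
    (hlt : potential (u : EuclideanSpace ℝ (Fin d)) τ L (1 - β / (5 * d)) (t + 1) w < 1) :
    ∫ z in Prod.fst ⁻¹' slab w b,
        potential (u : EuclideanSpace ℝ (Fin d)) τ L (1 - β / (5 * d)) t (update w z) ∂D ≤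
      D.real (Prod.fst ⁻¹' slab w b) *
        potential (u : EuclideanSpace ℝ (Fin d)) τ L (1 - β / (5 * d)) (t + 1) w := by
  have hu : ‖(u : EuclideanSpace ℝ (Fin d))‖ = 1 := by simp
  have hd1 : (1 : ℝ) ≤ d := by exact_mod_cast (by omega : 1 ≤ d)
  have hPR := measureReal_marginal hD _ (measurableSet_slab' w b)
  have hq : 0 ≤ β / (5 * d) := by positivity
  have hq1 : β / (5 * d) ≤ 1 := by rw [div_le_one (by positivity)]; linarith
  set ρ := 1 - β / (5 * d) with hρ
  have hρ0 : 0 ≤ ρ := by linarith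
  have hρ1 : ρ ≤ 1 := by linarith
  -- Beyond the barrier the second exponential alone would make the potential at least `1`.
  have hhigh : 1 - ⟪(u : EuclideanSpace ℝ (Fin d)), w⟫ < 6 * τ ^ 2 := by
    by_contra hcon
    have h1 : 1 ≤ Real.exp (64 * L / τ ^ 2 * ((1 - ⟪(u : EuclideanSpace ℝ (Fin d)), w⟫) - 6 * τ ^ 2)) :=
      Real.one_le_exp (mul_nonneg (by positivity) (by linarith))
    unfold potential at hlt
    have h2 : 0 ≤ ρ ^ (t + 1) * Real.exp (64 * L / τ ^ 2 *
      ((1 - ⟪(u : EuclideanSpace ℝ (Fin d)), w⟫) - τ ^ 2 / 8)) := by positivity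
    have h3 : 0 ≤ 2 * ((t + 1 : ℕ) : ℝ) * Real.exp (-2 * L) := by positivity
    linarith
  have hmain := integral_exp_le hd hD u hw hτ0 hτ hL hb hβ0 hβ hb1 hb2 hnoise hν hhigh
  rw [hPR]
  set P := (uniformSphere d).real (slab w b)
  have hP0 : 0 ≤ P := measureReal_nonneg
  rw [← hρ] at hmain
  set Λ := 64 * L / τ ^ 2 with hΛ
  have hsplit : ∀ Φ c : ℝ, Real.exp (Λ * (Φ - c)) = Real.exp (-(Λ * c)) * Real.exp (Λ * Φ) := by
    intro Φ c; rw [← Real.exp_add]; congr 1; ring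
  -- The gap between the target `τ² / 8` and the level `3 τ² / 32` is `τ² / 32`, and `Λ τ² / 32 = 2
  -- L`.
  have hKT : Real.exp (-(Λ * (τ ^ 2 / 8))) * Real.exp (Λ * (3 * τ ^ 2 / 32)) = Real.exp (-2 * L) := by
    rw [← Real.exp_add, hΛ]; congr 1; field_simp; ring
  have hTH : Real.exp (-(Λ * (6 * τ ^ 2))) ≤ Real.exp (-(Λ * (τ ^ 2 / 8))) := by
    rw [Real.exp_le_exp, neg_le_neg_iff]
    exact mul_le_mul_of_nonneg_left (by nlinarith [sq_nonneg τ]) (by positivity)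
  have hint : IntegrableOn (fun z => Real.exp (Λ * (1 - ⟪(u : EuclideanSpace ℝ (Fin d)), update w z⟫)))
      (Prod.fst ⁻¹' slab w b) D := by
    simpa using integrableOn_exp_inner_update (D := D) (u : EuclideanSpace ℝ (Fin d)) Λ 0 hu w b
  have e : ∀ z, potential (u : EuclideanSpace ℝ (Fin d)) τ L ρ t (update w z) =
      (ρ ^ t * Real.exp (-(Λ * (τ ^ 2 / 8))) + Real.exp (-(Λ * (6 * τ ^ 2)))) *
        Real.exp (Λ * (1 - ⟪(u : EuclideanSpace ℝ (Fin d)), update w z⟫)) +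
      2 * t * Real.exp (-2 * L) := by
    intro z
    rw [potential, ← hΛ, hsplit, hsplit _ (6 * τ ^ 2)]
    ring
  simp_rw [e]
  rw [integral_add (hint.const_mul _) (integrable_const _), integral_const_mul]
  simp only [integral_const, measureReal_restrict_apply_univ, smul_eq_mul, hPR]
  rw [potential, ← hΛ, hsplit, hsplit _ (6 * τ ^ 2)]
  set eT := Real.exp (-(Λ * (τ ^ 2 / 8)))
  set eH := Real.exp (-(Λ * (6 * τ ^ 2)))
  set K := Real.exp (Λ * (3 * τ ^ 2 / 32))
  set Z := Real.exp (Λ * (1 - ⟪(u : EuclideanSpace ℝ (Fin d)), w⟫))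
  have hK0 : 0 < K := Real.exp_pos _
  have hZ0 : 0 < Z := Real.exp_pos _
  have hT0 : 0 < eT := Real.exp_pos _
  have hH0 : 0 < eH := Real.exp_pos _
  have hρt0 : 0 ≤ ρ ^ t := by positivity
  have hρt1 : ρ ^ t ≤ 1 := pow_le_one₀ hρ0 hρ1
  have hc0 : 0 ≤ ρ ^ t * eT + eH := by positivity
  -- Each of the two exponentials contributes at most `exp (-2 L)`, whence the coefficient `2 t` in
  -- the potential.
  have hcK : (ρ ^ t * eT + eH) * K ≤ 2 * Real.exp (-2 * L) := by
    have h1 : ρ ^ t * eT + eH ≤ 2 * eT := by nlinarith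
    have := mul_le_mul_of_nonneg_right h1 hK0.le
    rw [mul_assoc, hKT] at this
    exact this
  have hcZ : (ρ ^ t * eT + eH) * (ρ * Z) ≤ ρ ^ (t + 1) * (eT * Z) + eH * Z := by
    have : eH * Z * ρ ≤ eH * Z := mul_le_of_le_one_right (by positivity) hρ1
    rw [pow_succ]
    linarith
  have h1 := mul_le_mul_of_nonneg_left hmain hc0
  have h2 : (ρ ^ t * eT + eH) * (P * (ρ * Z + K)) ≤
      P * (ρ ^ (t + 1) * (eT * Z) + eH * Z + 2 * Real.exp (-2 * L)) := by
    have := mul_le_mul_of_nonneg_left (add_le_add hcZ hcK) hP0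
    linarith
  push_cast
  linarith

lemma one_le_potential_zero (u : EuclideanSpace ℝ (Fin d)) {τ L ρ : ℝ} (hL : 0 ≤ L)
    {w : EuclideanSpace ℝ (Fin d)} (h : τ ^ 2 / 8 < 1 - ⟪u, w⟫) : 1 ≤ potential u τ L ρ 0 w := by
  have h1 : 1 ≤ Real.exp (64 * L / τ ^ 2 * ((1 - ⟪u, w⟫) - τ ^ 2 / 8)) :=
    Real.one_le_exp (mul_nonneg (by positivity) (by linarith))
  have h2 := Real.exp_pos (64 * L / τ ^ 2 * ((1 - ⟪u, w⟫) - 6 * τ ^ 2))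
  simp only [potential, pow_zero, one_mul, Nat.cast_zero, mul_zero, zero_mul, add_zero]
  linarith

/-- At `Φ ≤ 4 τ²` the first exponential is at most `exp (248 L)`, and `m` iterations contribute the
factor `ρ ^ m ≤ exp (-258 L)`. The second is at most `exp (-128 L)`. With the linear term the sum is
at most `(2 + 2 m) exp (-2 L)`. -/
lemma potential_le_of_init (hd : 1 ≤ d) (u : EuclideanSpace ℝ (Fin d)) {τ L β : ℝ} {m : ℕ} (hτ : 0 < τ)
    (hL : 0 ≤ L) (hβ : β ≤ 1) (hm : 1 ≤ m) (hmL : 1290 * (d * L) ≤ β * m)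
    {w : EuclideanSpace ℝ (Fin d)} (h : 1 - ⟪u, w⟫ ≤ 4 * τ ^ 2) :
    potential u τ L (1 - β / (5 * d)) m w ≤ 4 * m * Real.exp (-2 * L) := by
  have hd1 : (1 : ℝ) ≤ d := by exact_mod_cast hd
  have hq1 : β / (5 * d) ≤ 1 := by rw [div_le_one (by positivity)]; linarith
  have hm1 : (1 : ℝ) ≤ m := by exact_mod_cast hm
  have hρ : (1 - β / (5 * d)) ^ m ≤ Real.exp (-(258 * L)) := by
    have h1 : 1 - β / (5 * d) ≤ Real.exp (-(β / (5 * d))) := by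
      have := Real.add_one_le_exp (-(β / (5 * d))); linarith
    refine (pow_le_pow_left₀ (by linarith) h1 m).trans ?_
    rw [← Real.exp_nat_mul, Real.exp_le_exp, mul_neg, neg_le_neg_iff, ← mul_div_assoc,
      le_div_iff₀ (by positivity)]
    linarith
  have hexp : ∀ c : ℝ, Real.exp (64 * L / τ ^ 2 * ((1 - ⟪u, w⟫) - c * τ ^ 2)) ≤
      Real.exp (64 * L * (4 - c)) := by
    intro c
    rw [Real.exp_le_exp]
    calc _ ≤ 64 * L / τ ^ 2 * (4 * τ ^ 2 - c * τ ^ 2) :=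
          mul_le_mul_of_nonneg_left (by linarith) (by positivity)
      _ = _ := by field_simp
  have h1 := hexp (1 / 8)
  have h2 := hexp 6
  rw [show 1 / 8 * τ ^ 2 = τ ^ 2 / 8 by ring] at h1
  have h3 : Real.exp (-(258 * L)) * Real.exp (64 * L * (4 - 1 / 8)) ≤ Real.exp (-2 * L) := by
    rw [← Real.exp_add, Real.exp_le_exp]; linarith
  have h4 : Real.exp (64 * L * (4 - 6)) ≤ Real.exp (-2 * L) := by
    rw [Real.exp_le_exp]; linarith
  have h5 : (1 - β / (5 * d)) ^ m * Real.exp (64 * L / τ ^ 2 * ((1 - ⟪u, w⟫) - τ ^ 2 / 8)) ≤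
      Real.exp (-2 * L) :=
    (mul_le_mul hρ h1 (Real.exp_pos _).le (Real.exp_pos _).le).trans h3
  have h6 := Real.exp_pos (-2 * L)
  have h7 := le_mul_of_one_le_left h6.le hm1
  unfold potential
  refine (add_le_add (add_le_add h5 (h2.trans h4)) le_rfl).trans ?_
  linarith

end Epoch

/-! ### Consequences of the schedules -/

lemma log_three_gt_one : 1 < Real.log 3 := by
  rw [Real.lt_log_iff_exp_lt (by norm_num)]
  have := Real.exp_one_lt_d9
  linarith

lemma two_add_log_le {M : ℝ} (hM : 0 < M) : 2 + Real.log M ≤ 2 * √M := by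
  have h1 := Real.log_le_sub_one_of_pos (Real.sqrt_pos.2 hM)
  rw [Real.log_sqrt hM.le] at h1
  linarith

/-- The logarithm `L` contains `m` itself. Writing `m = M d L'` with `μ₁ ≤ M ≤ μ₂` and using `ln L'
≤ L'` gives `L ≤ (2 + ln M) L'`, so `L` is comparable with `L'` up to a constant. -/
lemma schedule_facts {d k m : ℕ} {δ β μ₁ μ₂ : ℝ} (hd : 3 ≤ d) (hk : 1 ≤ k) (hδ0 : 0 < δ)
    (hδ1 : δ < 1) (hβ0 : 0 < β) (hβ1 : β ≤ 1) (hμ : (2580 / β) ^ 2 ≤ μ₁)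
    (hm1 : μ₁ * (d * (Real.log d + Real.log (k / δ))) ≤ m)
    (hm2 : m ≤ μ₂ * (d * (Real.log d + Real.log (k / δ)))) :
    16 ≤ (m : ℝ) ∧ 1 ≤ Real.log (k * m / δ) ∧ 1290 * (d * Real.log (k * m / δ)) ≤ β * m ∧
      Real.log (k * m / δ) ≤ (2 + Real.log μ₂) * (Real.log d + Real.log (k / δ)) := by
  have hd3 : (3 : ℝ) ≤ d := by exact_mod_cast hd
  have hk1 : (1 : ℝ) ≤ k := by exact_mod_cast hk
  have hkδ : 1 ≤ (k : ℝ) / δ := by rw [le_div_iff₀ hδ0]; linarith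
  have hL1 : 1 ≤ Real.log d + Real.log (k / δ) := by
    have h1 : Real.log 3 ≤ Real.log d := Real.log_le_log (by norm_num) hd3
    have h2 := Real.log_nonneg hkδ
    linarith [log_three_gt_one]
  set L' := Real.log d + Real.log (k / δ) with hL'
  have hdL : 3 ≤ d * L' := by nlinarith
  have h2580 : 2580 ≤ 2580 / β := by rw [le_div_iff₀ hβ0]; nlinarith
  have hμ1 : 16 ≤ μ₁ := by nlinarith
  have hm16 : 16 ≤ (m : ℝ) := by nlinarith
  set M : ℝ := m / (d * L') with hM
  have hdL0 : 0 < d * L' := by linarith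
  have hM1 : μ₁ ≤ M := by rw [hM, le_div_iff₀ hdL0]; exact hm1
  have hM2 : M ≤ μ₂ := by rw [hM, div_le_iff₀ hdL0]; exact hm2
  have hM0 : 0 < M := by linarith
  have hmM : (m : ℝ) = M * (d * L') := by rw [hM]; field_simp
  have hlogm : Real.log m ≤ Real.log M + Real.log d + L' := by
    rw [hmM, Real.log_mul hM0.ne' hdL0.ne', Real.log_mul (by linarith) (by linarith)]
    have := Real.log_le_sub_one_of_pos (show 0 < L' by linarith)
    linarith
  have hL : Real.log (k * m / δ) ≤ (2 + Real.log M) * L' := by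
    rw [show (k : ℝ) * m / δ = k / δ * m by ring, Real.log_mul (by linarith) (by linarith)]
    have hM1' : 0 ≤ Real.log M := Real.log_nonneg (by linarith)
    nlinarith
  refine ⟨hm16, ?_, ?_, ?_⟩
  · rw [Real.le_log_iff_exp_le (by positivity)]
    have := Real.exp_one_lt_d9
    have : (m : ℝ) ≤ k / δ * m := le_mul_of_one_le_left (by linarith) hkδ
    rw [show (k : ℝ) * m / δ = k / δ * m by ring]
    linarith
  · have hsM : 2580 / β ≤ √M := Real.le_sqrt_of_sq_le (hμ.trans hM1)
    rw [div_le_iff₀ hβ0] at hsM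
    have hs0 : 0 < √M := Real.sqrt_pos.2 hM0
    have h1 : 1290 * (2 + Real.log M) ≤ β * M := by
      have h2 := two_add_log_le hM0
      have h3 : √M * √M = M := Real.mul_self_sqrt hM0.le
      nlinarith
    rw [hmM]
    calc 1290 * (d * Real.log (k * (M * (d * L')) / δ)) ≤ 1290 * (d * ((2 + Real.log M) * L')) := by
          rw [← hmM]; gcongr
      _ = 1290 * (2 + Real.log M) * (d * L') := by ring
      _ ≤ β * M * (d * L') := by gcongr
      _ = _ := by ring
  · refine hL.trans (mul_le_mul_of_nonneg_right ?_ (by linarith))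
    linarith [Real.log_le_log hM0 hM2]

/-- The left side is `4 δ² / (k² m)`, and `m ≥ 16` gives `8 (k + 1) ≤ k m`. The right side is
summable in `k`, with sum at most `δ / 2`. -/
lemma four_mul_exp_le {k m : ℕ} {δ : ℝ} (hk : 1 ≤ k) (hm : 16 ≤ (m : ℝ)) (hδ0 : 0 < δ) (hδ1 : δ < 1) :
    4 * m * Real.exp (-2 * Real.log (k * m / δ)) ≤ δ / 2 * (1 / (k * (k + 1))) := by
  have hk1 : (1 : ℝ) ≤ k := by exact_mod_cast hk
  have hm0 : (0 : ℝ) < m := by linarith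
  have e : Real.exp (-2 * Real.log (k * m / δ)) = ((k * m / δ) ^ 2)⁻¹ := by
    rw [show -2 * Real.log (k * m / δ) = -(Real.log (k * m / δ) + Real.log (k * m / δ)) by ring,
      Real.exp_neg, Real.exp_add, Real.exp_log (by positivity), sq]
  rw [e, ← div_eq_mul_inv, div_pow, div_div_eq_mul_div, mul_one_div, div_div,
    div_le_div_iff₀ (by positivity) (by positivity)]
  have h1 : 8 * ((k : ℝ) + 1) ≤ k * m := by nlinarith
  have h2 : δ * δ ≤ δ := by nlinarith
  calc 4 * (m : ℝ) * δ ^ 2 * (2 * (k * (k + 1))) = (δ * δ) * (8 * (k + 1)) * (k * m) := by ring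
    _ ≤ δ * (k * m) * (k * m) := by gcongr
    _ = δ * (k * m) ^ 2 := by ring

lemma sum_one_div_le (n : ℕ) : ∑ i ∈ Finset.Ioc 0 n, (1 : ℝ) / (i * (i + 1)) ≤ 1 := by
  have h : ∑ i ∈ Finset.Ioc 0 n, (1 : ℝ) / (i * (i + 1)) = 1 - 1 / (n + 1) := by
    induction n with
    | zero => simp
    | succ n ih =>
      rw [Finset.sum_Ioc_succ_top (by omega), ih]
      push_cast
      field_simp
      ring
  rw [h]
  have : (0 : ℝ) ≤ 1 / (n + 1) := by positivity
  linarith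

/-- The squared sine is at most `2 Φ ≤ τ² / 4`, so the disagreement region has mass at most `2 (τ /
2) = τ`. -/
lemma err_le {d : ℕ} (hd : 2 ≤ d) {D : Measure (Example d)} [IsProbabilityMeasure D]
    (hD : D.map Prod.fst = uniformSphere d) {u v : Sphere d} {τ : ℝ} (hτ0 : 0 ≤ τ) (hτ1 : τ ≤ 1)
    (h : 1 - ⟪(u : EuclideanSpace ℝ (Fin d)), (v : EuclideanSpace ℝ (Fin d))⟫ ≤ τ ^ 2 / 8) :
    err D v ≤ err D u + τ := by
  set α := ⟪(u : EuclideanSpace ℝ (Fin d)), (v : EuclideanSpace ℝ (Fin d))⟫ with hα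
  have hτ2 : τ ^ 2 ≤ 1 := pow_le_one₀ hτ0 hτ1
  have hα1 : α ≤ 1 := by
    have := real_inner_le_norm (u : EuclideanSpace ℝ (Fin d)) v
    simpa using this
  have hdis := measure_disagreement_le hd (u := u) (v := v) (by linarith)
  have hS : 2 * √(1 - α ^ 2) ≤ τ := by
    have : √(1 - α ^ 2) ≤ τ / 2 := Real.sqrt_le_iff.2 ⟨by linarith, by nlinarith⟩
    linarith
  have hm : MeasurableSet {x | halfspace v x ≠ halfspace u x} :=
    (measurableSet_eq_fun (measurable_halfspace v) (measurable_halfspace u)).compl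
  have hP := measureReal_marginal hD _ hm
  have hsub : {z : Example d | halfspace v z.1 ≠ z.2} ⊆ {z : Example d | halfspace u z.1 ≠ z.2} ∪
      Prod.fst ⁻¹' {x | halfspace v x ≠ halfspace u x} := by
    intro z hz
    by_contra hcon
    rw [Set.mem_union, not_or] at hcon
    apply hz
    have h1 : halfspace u z.1 = z.2 := not_not.1 hcon.1
    have h2 : halfspace v z.1 = halfspace u z.1 := not_not.1 hcon.2
    rw [h2, h1]
  unfold err
  refine (measureReal_mono hsub).trans ((measureReal_union_le _ _).trans ?_)
  rw [hP]
  linarith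

/-- The probability bound for the whole run, in terms of the number `n` of examples. -/
lemma failProb_run_le {d : ℕ} (hd : 3 ≤ d) {D : Measure (Example d)} [IsProbabilityMeasure D]
    (hD : D.map Prod.fst = uniformSphere d) {u v₀ : Sphere d} {δ ν β₁ β₂ μ₁ μ₂ p : ℝ}
    {m : ℕ → ℕ} {b : ℕ → ℝ} {k₀ : ℕ} (hk₀ : 1 ≤ k₀)
    (hβ0 : 0 < β₁) (hβ12 : β₁ ≤ β₂) (hβ2 : β₂ ≤ 1 / 10 ^ 6) (hμ : (2580 / β₁) ^ 2 ≤ μ₁)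
    (hangle : InnerProductGeometry.angle (v₀ : EuclideanSpace ℝ (Fin d)) u ≤ Real.pi / 2)
    (hδ0 : 0 < δ) (hδ1 : δ < 1) (hm : SampleSchedule d δ μ₁ μ₂ m) (hb : BandSchedule d δ β₁ β₂ m b)
    (hnoise : AdversarialNoise D ν u) (hνp : ν ≤ p / 50000)
    (hp : ∀ k ∈ Set.Icc 1 k₀, p ≤ β₁ * ((1 / 2) ^ k / Real.log (k * m k / δ)) / 1000) (n : ℕ) :
    failProb D m b {w | ‖w‖ = 1 ∧ 1 - ⟪(u : EuclideanSpace ℝ (Fin d)), w⟫ ≤ ((1 / 2) ^ k₀) ^ 2 / 8}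
      n k₀ 0 0 v₀ ≤ ENNReal.ofReal (δ / 2 +
        2 ^ (∑ i ∈ Finset.Ioc 0 k₀, m i) * (1 - p / 2) ^ n) := by
  have hd2 : 2 ≤ d := by omega
  have hd0 : (0 : ℝ) < d := by exact_mod_cast (by omega : 0 < d)
  have hsd : 0 < √(d : ℝ) := Real.sqrt_pos.2 hd0
  set G := {w : EuclideanSpace ℝ (Fin d) | ‖w‖ = 1 ∧ 1 - ⟪(u : EuclideanSpace ℝ (Fin d)), w⟫ ≤ ((1 / 2) ^ k₀) ^ 2 / 8}
    with hGdef
  have hGm : MeasurableSet G := by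
    have h1 : MeasurableSet {w : EuclideanSpace ℝ (Fin d) | ‖w‖ = 1} :=
      measurableSet_eq_fun (by fun_prop) (by fun_prop)
    have h2 : MeasurableSet {w : EuclideanSpace ℝ (Fin d) |
        1 - ⟪(u : EuclideanSpace ℝ (Fin d)), w⟫ ≤ ((1 / 2) ^ k₀) ^ 2 / 8} :=
      measurableSet_le (by fun_prop) (by fun_prop)
    exact h1.inter h2
  set L : ℕ → ℝ := fun k => Real.log (k * m k / δ) with hL
  set τ : ℕ → ℝ := fun k => (1 / 2) ^ k with hτ
  set B : ℕ → ℕ → EuclideanSpace ℝ (Fin d) → ℝ := fun k t w =>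
    potential (u : EuclideanSpace ℝ (Fin d)) (τ k) (L k) (1 - β₁ / (5 * d)) t w with hB
  set f : ℕ → ℝ := fun k => δ / 2 * (1 / (k * (k + 1))) with hf
  have hfacts : ∀ k, 1 ≤ k → 16 ≤ (m k : ℝ) ∧ 1 ≤ L k ∧ 1290 * (d * L k) ≤ β₁ * m k := by
    intro k hk
    have h := schedule_facts (m := m k) hd hk hδ0 hδ1 hβ0 (by linarith) hμ (hm k hk).1 (hm k hk).2
    exact ⟨h.1, h.2.1, h.2.2.1⟩
  have hτ0 : ∀ k, 0 < τ k := fun k => by positivity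
  have hτ1 : ∀ k, 1 ≤ k → τ k ≤ 1 / 2 := fun k hk => by
    have h := pow_le_pow_of_le_one (by norm_num : (0 : ℝ) ≤ 1 / 2) (by norm_num) hk
    rwa [pow_one] at h
  have hband : ∀ k, 1 ≤ k → 0 < b k ∧ β₁ * (τ k / L k) ≤ b k * √d ∧
      b k * √d ≤ 1 / 10 ^ 6 * (τ k / L k) := by
    intro k hk
    obtain ⟨h1, h2⟩ := hb k hk
    have hLk := (hfacts k hk).2.1
    have e : ∀ β : ℝ, β * ((1 / 2) ^ k / (√d * Real.log (k * m k / δ))) * √d = β * (τ k / L k) := by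
      intro β
      simp only [hτ, hL]
      field_simp
    have hτk := hτ0 k
    have hLk0 : 0 < L k := by linarith
    refine ⟨lt_of_lt_of_le ?_ h1, ?_, ?_⟩
    · exact mul_pos hβ0 (div_pos hτk (mul_pos hsd hLk0))
    · rw [← e]; exact mul_le_mul_of_nonneg_right h1 hsd.le
    · refine (mul_le_mul_of_nonneg_right h2 hsd.le).trans ?_
      rw [e]
      exact mul_le_mul_of_nonneg_right hβ2 (by positivity)
  have hslab : ∀ k ∈ Set.Icc 1 k₀, ∀ w : EuclideanSpace ℝ (Fin d), ‖w‖ = 1 →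
      p ≤ (uniformSphere d).real (slab w (b k)) := by
    intro k hk w hw
    obtain ⟨h0, h1, h2⟩ := hband k hk.1
    have hLk := (hfacts k hk.1).2.1
    have h3 : τ k / L k ≤ 1 / 2 := (div_le_self (hτ0 k).le hLk).trans (hτ1 k hk.1)
    refine ((hp k hk).trans ?_).trans (le_measure_slab hd2 hw h0 (by linarith))
    exact div_le_div_of_nonneg_right h1 (by norm_num)
  have hinit : ∀ k, 1 ≤ k → ∀ w : EuclideanSpace ℝ (Fin d),
      1 - ⟪(u : EuclideanSpace ℝ (Fin d)), w⟫ ≤ 4 * τ k ^ 2 → B k (m k) w ≤ f k := by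
    intro k hk w hw
    obtain ⟨h1, h2, h3⟩ := hfacts k hk
    have hm1 : 1 ≤ m k := by
      have : (1 : ℝ) ≤ m k := by linarith
      exact_mod_cast this
    exact (potential_le_of_init (by omega) _ (hτ0 k) (by linarith) (by linarith) hm1 h3 hw).trans
      (four_mul_exp_le hk h1 hδ0 hδ1)
  have hρ0 : 0 ≤ 1 - β₁ / (5 * d) := by
    have : β₁ / (5 * d) ≤ 1 := by
      rw [div_le_one (by positivity)]
      have : (3 : ℝ) ≤ d := by exact_mod_cast hd
      linarith
    linarith
  have hv₀ : ‖(v₀ : EuclideanSpace ℝ (Fin d))‖ = 1 := by simp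
  have hmain := failProb_le (D := D) (m := m) (b := b) hGm (B := B) (f := f) (p := p) (k₀ := k₀)
    (fun k t w => potential_nonneg _ _ _ hρ0 t w) (fun k => by positivity)
    (fun k hk w hw => by
      rw [measureReal_marginal hD _ (measurableSet_slab' w _)]; exact hslab k hk w hw)
    (fun k t w => integrableOn_potential u _ _ _ t w _)
    (fun k hk t w hw hlt => by
      obtain ⟨h0, h1, h2⟩ := hband k hk.1
      refine integral_potential_le hd2 hD u hw (hτ0 k) (hτ1 k hk.1) (hfacts k hk.1).2.1 h0 hβ0
        (hβ12.trans hβ2) h1 h2 hnoise ?_ t hlt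
      exact hνp.trans (div_le_div_of_nonneg_right (hslab k hk w hw) (by norm_num)))
    (fun w hw hwG => by
      refine one_le_potential_zero _ (by linarith [(hfacts k₀ hk₀).2.1]) ?_
      by_contra hcon
      exact hwG ⟨hw, not_lt.1 hcon⟩)
    -- An epoch that ends with potential below `1` has `Φ ≤ τ_k² / 8 = τ_{k+1}² / 2`, well below the
    -- `4 τ_{k+1}²` required at the start of the next one.
    (fun k hk w hw hlt => by
      refine hinit (k + 1) (by omega) w ?_
      by_contra hcon
      refine absurd hlt (not_lt.2 (one_le_potential_zero _ (by linarith [(hfacts k hk.1).2.1]) ?_))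
      have : τ (k + 1) = τ k / 2 := by simp only [hτ, pow_succ]; ring
      rw [this] at hcon
      nlinarith [hτ0 k])
    n (k₀ - 1) 1 (m 1) v₀ le_rfl (by omega) hv₀
  have hstart : failProb D m b G n k₀ 0 0 v₀ = failProb D m b G n (k₀ - 1) 1 (m 1) v₀ := by
    obtain ⟨j, rfl⟩ : ∃ j, k₀ = j + 1 := ⟨k₀ - 1, by omega⟩
    simp only [failProb, Succeeds, zero_add, Nat.add_sub_cancel]
  rw [hstart]
  refine hmain.trans (ENNReal.ofReal_le_ofReal ?_)
  have hI : Finset.Ioc 0 k₀ = insert 1 (Finset.Ioc 1 k₀) := by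
    ext i; simp only [Finset.mem_Ioc, Finset.mem_insert]; omega
  have hsum := sum_one_div_le k₀
  have hsumf : ∑ i ∈ Finset.Ioc 0 k₀, f i ≤ δ / 2 := by
    rw [hf, ← Finset.mul_sum]
    nlinarith
  have hinner : 0 ≤ ⟪(u : EuclideanSpace ℝ (Fin d)), (v₀ : EuclideanSpace ℝ (Fin d))⟫ := by
    rw [real_inner_comm, ← InnerProductGeometry.cos_angle_mul_norm_mul_norm]
    refine mul_nonneg (Real.cos_nonneg_of_neg_pi_div_two_le_of_le ?_ hangle) (by positivity)
    linarith [InnerProductGeometry.angle_nonneg (v₀ : EuclideanSpace ℝ (Fin d)) u, Real.pi_pos]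
  -- An initial angle of at most `π / 2` gives `Φ ≤ 1`, which is `4 τ²` for `τ = 1 / 2`. The factor
  -- `4` is needed only for this first epoch.
  have hB1 : B 1 (m 1) v₀ ≤ f 1 := by
    refine hinit 1 le_rfl v₀ ?_
    simp only [hτ]
    norm_num
    exact hinner
  rw [hI, Finset.sum_insert (by simp)] at hsumf ⊢
  linarith

/-! ### Numerical estimates -/

lemma epochs_facts {ε : ℝ} (hε0 : 0 < ε) (hε : ε ≤ 1 / 2) :
    1 ≤ ⌈Real.logb 2 (1 / ε)⌉₊ ∧ (⌈Real.logb 2 (1 / ε)⌉₊ : ℝ) ≤ 3 * Real.log (1 / ε) ∧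
      (1 / 2 : ℝ) ^ ⌈Real.logb 2 (1 / ε)⌉₊ ≤ ε ∧ ε / 2 ≤ (1 / 2 : ℝ) ^ ⌈Real.logb 2 (1 / ε)⌉₊ := by
  have h2 : 2 ≤ 1 / ε := by rw [le_div_iff₀ hε0]; linarith
  set x := Real.logb 2 (1 / ε) with hx
  have hx1 : 1 ≤ x := by
    rw [hx, Real.le_logb_iff_rpow_le (by norm_num) (by linarith), Real.rpow_one]
    exact h2
  have hpow : (2 : ℝ) ^ x = 1 / ε := Real.rpow_logb (by norm_num) (by norm_num) (by linarith)
  have hle : x ≤ ⌈x⌉₊ := Nat.le_ceil x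
  have hlt : (⌈x⌉₊ : ℝ) < x + 1 := Nat.ceil_lt_add_one (by linarith)
  refine ⟨?_, ?_, ?_, ?_⟩
  · exact Nat.one_le_ceil_iff.2 (by linarith)
  · have hlog : x * Real.log 2 = Real.log (1 / ε) := by
      rw [hx, Real.logb, div_mul_cancel₀ _ (Real.log_pos (by norm_num)).ne']
    have := Real.log_two_gt_d9
    nlinarith
  · have : 1 / ε ≤ (2 : ℝ) ^ ⌈x⌉₊ := by
      rw [← hpow, ← Real.rpow_natCast]
      exact Real.rpow_le_rpow_of_exponent_le (by norm_num) hle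
    rw [one_div_pow, one_div_le (by positivity) hε0]
    exact this
  · have : (2 : ℝ) ^ ⌈x⌉₊ ≤ 2 * (1 / ε) := by
      rw [← hpow, ← Real.rpow_natCast, mul_comm, ← Real.rpow_add_one (by norm_num)]
      exact Real.rpow_le_rpow_of_exponent_le (by norm_num) hlt.le
    rw [one_div_pow, le_div_iff₀ (by positivity)]
    calc ε / 2 * 2 ^ ⌈x⌉₊ ≤ ε / 2 * (2 * (1 / ε)) := by gcongr
      _ = 1 := by field_simp

/-- As `d ≥ 3`, `d ℓ ≥ 3 ln 2 ≥ 2`; this keeps the factor away from `0` although `ln ℓ` may be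
negative. For `k ≤ 3 ℓ` the excess `ln 3 ≤ 2 ln 2` is absorbed by two more copies of the factor. -/
lemma log_factor_facts {d : ℕ} {δ ℓ : ℝ} (hd : 3 ≤ d) (hδ0 : 0 < δ) (hδ1 : δ < 1)
    (hℓ : Real.log 2 ≤ ℓ) :
    1 / 2 ≤ Real.log d + Real.log (1 / δ) + Real.log ℓ ∧
    Real.log 2 + Real.log (1 / δ) ≤ Real.log d + Real.log (1 / δ) + Real.log ℓ ∧
    ∀ k : ℕ, 1 ≤ k → (k : ℝ) ≤ 3 * ℓ → Real.log d + Real.log (k / δ) ≤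
      3 * (Real.log d + Real.log (1 / δ) + Real.log ℓ) := by
  have hd3 : (3 : ℝ) ≤ d := by exact_mod_cast hd
  have hlog2 := Real.log_two_gt_d9
  have hℓ0 : 0 < ℓ := by linarith
  have h1 : Real.log 2 ≤ Real.log d + Real.log ℓ := by
    rw [← Real.log_mul (by linarith) hℓ0.ne']
    exact Real.log_le_log (by norm_num) (by nlinarith)
  have h2 : 0 ≤ Real.log (1 / δ) := Real.log_nonneg (by rw [le_div_iff₀ hδ0]; linarith)
  refine ⟨by linarith, by linarith, fun k hk hkℓ => ?_⟩
  have hk0 : (0 : ℝ) < k := by exact_mod_cast hk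
  have h3 : Real.log (k / δ) = Real.log k + Real.log (1 / δ) := by
    rw [← Real.log_mul hk0.ne' (by positivity)]; congr 1; ring
  have h4 : Real.log k ≤ Real.log 3 + Real.log ℓ := by
    rw [← Real.log_mul (by norm_num) hℓ0.ne']
    exact Real.log_le_log hk0 hkℓ
  have h5 : Real.log 3 ≤ 2 * Real.log 2 := by
    have : Real.log 4 = 2 * Real.log 2 := by
      rw [show (4 : ℝ) = 2 ^ 2 by norm_num, Real.log_pow]; norm_num
    rw [← this]
    exact Real.log_le_log (by norm_num) (by norm_num)
  linarith

lemma two_pow_mul_pow_le {p δ Γ : ℝ} {M n : ℕ} (hp0 : 0 < p) (hp1 : p ≤ 1) (hδ : 0 < δ)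
    (hΓ : Real.log 2 + Real.log (1 / δ) ≤ Γ) (hn : 2 / p * (M + Γ) ≤ n) :
    2 ^ M * (1 - p / 2) ^ n ≤ δ / 2 := by
  have h1 : (2 : ℝ) ^ M ≤ Real.exp M := by
    rw [← mul_one (M : ℝ), Real.exp_nat_mul]
    have := Real.add_one_le_exp (1 : ℝ)
    exact pow_le_pow_left₀ (by norm_num) (by linarith) M
  have h2 : (1 - p / 2) ^ n ≤ Real.exp (-(n * (p / 2))) := by
    rw [← mul_neg, Real.exp_nat_mul]
    have := Real.add_one_le_exp (-(p / 2))
    exact pow_le_pow_left₀ (by linarith) (by linarith) n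
  have h3 : M + Γ ≤ n * (p / 2) := by
    rw [div_mul_eq_mul_div, div_le_iff₀ hp0] at hn
    linarith
  have h4 : Real.exp (-(Real.log 2 + Real.log (1 / δ))) = δ / 2 := by
    rw [Real.exp_neg, Real.exp_add, Real.exp_log (by norm_num), Real.exp_log (by positivity)]
    field_simp
  calc _ ≤ Real.exp M * Real.exp (-(n * (p / 2))) := by
        refine mul_le_mul h1 h2 (pow_nonneg (by linarith) n) (Real.exp_pos _).le
    _ ≤ Real.exp (-(Real.log 2 + Real.log (1 / δ))) := by
        rw [← Real.exp_add, Real.exp_le_exp]; linarith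
    _ = _ := h4

lemma examples_le {d : ℕ} {c μ Γ ε ℓ : ℝ} (hd : 3 ≤ d) (hc : 0 < c) (hμ : 0 ≤ μ) (hΓ : 1 / 2 ≤ Γ)
    (hε0 : 0 < ε) (hε : ε ≤ 1 / 2) (hℓ : 0.69 ≤ ℓ) :
    2 / (c * (ε / Γ)) * (9 * ℓ * μ * d * Γ + Γ) + 1 ≤
      (2 / c * (9 * μ + 1) + 1) * (d * Γ ^ 2 * (1 / ε * ℓ)) := by
  have hd3 : (3 : ℝ) ≤ d := by exact_mod_cast hd
  have h2 : 2 ≤ 1 / ε := by rw [le_div_iff₀ hε0]; linarith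
  have hdℓ : 1 ≤ d * ℓ := by nlinarith
  have hΓ2 : 1 / 4 ≤ Γ ^ 2 := by nlinarith
  have hεΓ : 1 / 2 ≤ 1 / ε * Γ ^ 2 := by nlinarith
  have hQ : 1 ≤ d * Γ ^ 2 * (1 / ε * ℓ) := by
    have : d * Γ ^ 2 * (1 / ε * ℓ) = (d * ℓ) * (1 / ε * Γ ^ 2) := by ring
    rw [this]
    have : 2 ≤ d * ℓ := by nlinarith
    nlinarith
  have e : 2 / (c * (ε / Γ)) * (9 * ℓ * μ * d * Γ + Γ) =
      2 / c * (Γ ^ 2 * (1 / ε) * (9 * μ * (d * ℓ) + 1)) := by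
    have : Γ ≠ 0 := by linarith
    field_simp
  have h3 : 9 * μ * (d * ℓ) + 1 ≤ (9 * μ + 1) * (d * ℓ) := by linarith
  rw [e, add_mul, one_mul]
  refine add_le_add ?_ hQ
  calc _ ≤ 2 / c * (Γ ^ 2 * (1 / ε) * ((9 * μ + 1) * (d * ℓ))) := by gcongr
    _ = _ := by ring

lemma steps_le {d k n T : ℕ} {C Γ ε ℓ : ℝ} (hd : 3 ≤ d) (hΓ : 1 / 2 ≤ Γ)
    (hε0 : 0 < ε) (hε : ε ≤ 1 / 2) (hℓ : 0.69 ≤ ℓ) (hk : (k : ℝ) ≤ 3 * ℓ)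
    (hn : n ≤ C * (d * Γ ^ 2 * (1 / ε * ℓ))) (hT : T ≤ (10 * d + 9) * n + (10 * k + 4)) :
    (T : ℝ) ≤ (13 * C + 40) * (d ^ 2 * Γ ^ 2 * (1 / ε * ℓ)) := by
  have hd3 : (3 : ℝ) ≤ d := by exact_mod_cast hd
  have h2 : 2 ≤ 1 / ε := by rw [le_div_iff₀ hε0]; linarith
  have hΓ2 : 1 / 4 ≤ Γ ^ 2 := by nlinarith
  have hT' : (T : ℝ) ≤ (10 * d + 9) * n + (10 * k + 4) := by exact_mod_cast hT
  have hℓQ : ℓ ≤ d ^ 2 * Γ ^ 2 * (1 / ε * ℓ) := by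
    have hd9 : 9 ≤ (d : ℝ) ^ 2 := by nlinarith
    have h4 : 2 ≤ (d : ℝ) ^ 2 * Γ ^ 2 := by nlinarith
    have h5 : 1 ≤ (d : ℝ) ^ 2 * Γ ^ 2 * (1 / ε) := by nlinarith
    rw [← mul_assoc]
    exact le_mul_of_one_le_left (by linarith) h5
  have hn0 : (0 : ℝ) ≤ n := by positivity
  have h6 : (10 * (d : ℝ) + 9) * n ≤ 13 * d * (C * (d * Γ ^ 2 * (1 / ε * ℓ))) :=
    mul_le_mul (by linarith) hn hn0 (by positivity)
  have e : 13 * (d : ℝ) * (C * (d * Γ ^ 2 * (1 / ε * ℓ))) =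
      13 * C * (d ^ 2 * Γ ^ 2 * (1 / ε * ℓ)) := by ring
  rw [e] at h6
  linarith

end Halfspace

end

/-! ### Choice of the constants and assembly -/

theorem mainTheorem7 :
    ∃ β₀ : ℝ, 0 < β₀ ∧ ∀ β₁ β₂ : ℝ, 0 < β₁ → β₁ ≤ β₂ → β₂ ≤ β₀ →
    ∃ μ₀ : ℝ, 0 < μ₀ ∧ ∀ μ₁ μ₂ : ℝ, μ₀ ≤ μ₁ → μ₁ ≤ μ₂ →
    ∃ c C : ℝ, 0 < c ∧ 0 < C ∧
      ∀ (d : ℕ) (D : Measure (Halfspace.Example d)) [IsProbabilityMeasure D]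
        (u v₀ : Halfspace.Sphere d) (ε δ ν : ℝ) (m : ℕ → ℕ) (b : ℕ → ℝ),
        3 ≤ d →
        D.map Prod.fst = Halfspace.uniformSphere d →
        InnerProductGeometry.angle (v₀ : EuclideanSpace ℝ (Fin d)) u ≤ Real.pi / 2 →
        0 < ε → ε ≤ 1 / 2 →
        0 < δ → δ < 1 →
        Halfspace.SampleSchedule d δ μ₁ μ₂ m →
        Halfspace.BandSchedule d δ β₁ β₂ m b →
        ν ≤ c * (ε / (Real.log (Real.log (1 / ε)) + Real.log (d / δ))) →
        Halfspace.AdversarialNoise D ν u →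
        ∃ E : Set (ℕ → Halfspace.Example d), MeasurableSet E ∧
          1 - δ ≤ (Measure.infinitePi fun _ : ℕ => D).real E ∧
          ∀ z ∈ E, ∃ (v : Halfspace.Sphere d) (n T : ℕ),
            Halfspace.Outputs z v₀ ε δ m b v n T ∧
            Halfspace.err D v ≤ Halfspace.err D u + ε ∧
            (n : ℝ) ≤ C * (d * (Real.log d + Real.log (1 / δ) + Real.log (Real.log (1 / ε))) ^ 2 *
              (1 / ε * Real.log (1 / ε))) ∧
            (T : ℝ) ≤ C * (d ^ 2 * (Real.log d + Real.log (1 / δ) + Real.log (Real.log (1 / ε))) ^ 2 *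
              (1 / ε * Real.log (1 / ε))) := by
  refine ⟨1 / 10 ^ 6, by norm_num, fun β₁ β₂ hβ0 hβ12 hβ2 => ⟨(2580 / β₁) ^ 2, by positivity,
    fun μ₁ μ₂ hμ1 hμ12 => ?_⟩⟩
  have hβ1 : β₁ ≤ 1 / 10 ^ 6 := hβ12.trans hβ2
  have hμ2 : 1 ≤ μ₂ := by
    have : 2580 ≤ 2580 / β₁ := by rw [le_div_iff₀ hβ0]; nlinarith
    nlinarith
  have hlogμ : 0 ≤ Real.log μ₂ := Real.log_nonneg hμ2
  -- The last band is the narrowest. Its mass is at least `β₁ 2 ^ (-k₀) / (1000 L)`, where `2 ^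
  -- (-k₀) ≥ ε / 2` and `L ≤ 3 (2 + ln μ₂) Γ`; the numerical factors multiply to `6000`.
  set a := β₁ / (6000 * (2 + Real.log μ₂)) with ha
  have ha0 : 0 < a := by positivity
  have ha1 : a ≤ 1 := by
    rw [ha, div_le_one (by positivity)]; linarith
  set C₁ := 2 / a * (9 * μ₂ + 1) + 1 with hC₁
  have hC₁0 : 0 < C₁ := by positivity
  -- The noise constant makes `ν ≤ p / 50000`, as the drift lemma requires. In the running time, `10
  -- d + 9 ≤ 13 d`, and the overhead of the epochs is at most `40 ℓ`.
  refine ⟨a / 50000, 13 * C₁ + 40, by positivity, by positivity, ?_⟩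
  intro d D _ u v₀ ε δ ν m b hd hD hangle hε0 hε hδ0 hδ1 hm hb hν hnoise
  have hd0 : (0 : ℝ) < d := by exact_mod_cast (by omega : 0 < d)
  obtain ⟨hk1, hkℓ, hkε, hεk⟩ := Halfspace.epochs_facts hε0 hε
  set k₀ := ⌈Real.logb 2 (1 / ε)⌉₊ with hk₀
  set ℓ := Real.log (1 / ε) with hℓ
  have hℓ2 : Real.log 2 ≤ ℓ := Real.log_le_log (by norm_num) (by rw [le_div_iff₀ hε0]; linarith)
  have hℓ069 : 0.69 ≤ ℓ := by have := Real.log_two_gt_d9; norm_num at this ⊢; linarith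
  obtain ⟨hΓ1, hΓ2, hΓ3⟩ := Halfspace.log_factor_facts hd hδ0 hδ1 hℓ2
  have hden : Real.log ℓ + Real.log (d / δ) = Real.log d + Real.log (1 / δ) + Real.log ℓ := by
    rw [show (d : ℝ) / δ = d * (1 / δ) by ring, Real.log_mul hd0.ne' (by positivity)]; ring
  rw [hden] at hν
  set Γ := Real.log d + Real.log (1 / δ) + Real.log ℓ with hΓ
  have hΓ0 : 0 < Γ := by linarith
  set p := a * (ε / Γ) with hp
  have hp0 : 0 < p := by positivity
  have hp1 : p ≤ 1 := by
    have : ε / Γ ≤ 1 := by rw [div_le_one hΓ0]; linarith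
    rw [hp]; nlinarith [div_pos hε0 hΓ0]
  have hkΓ : ∀ k ∈ Set.Icc 1 k₀, Real.log d + Real.log (k / δ) ≤ 3 * Γ := by
    intro k hk
    refine hΓ3 k hk.1 (le_trans ?_ hkℓ)
    exact_mod_cast hk.2
  have hplow : ∀ k ∈ Set.Icc 1 k₀,
      p ≤ β₁ * ((1 / 2) ^ k / Real.log (k * m k / δ)) / 1000 := by
    intro k hk
    obtain ⟨-, hL1, -, hL⟩ := Halfspace.schedule_facts (m := m k) hd hk.1 hδ0 hδ1 hβ0
      (by linarith) hμ1 (hm k hk.1).1 (hm k hk.1).2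
    have hL' : Real.log (k * m k / δ) ≤ (2 + Real.log μ₂) * (3 * Γ) :=
      hL.trans (mul_le_mul_of_nonneg_left (hkΓ k hk) (by linarith))
    have hτ : ε / 2 ≤ (1 / 2 : ℝ) ^ k :=
      hεk.trans (pow_le_pow_of_le_one (by norm_num) (by norm_num) hk.2)
    have e : p = β₁ * ((ε / 2) / ((2 + Real.log μ₂) * (3 * Γ))) / 1000 := by
      rw [hp, ha]; field_simp; norm_num
    rw [e]
    gcongr
  have hM : ((∑ i ∈ Finset.Ioc 0 k₀, m i : ℕ) : ℝ) ≤ 9 * ℓ * μ₂ * d * Γ := by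
    push_cast
    calc _ ≤ ∑ i ∈ Finset.Ioc 0 k₀, μ₂ * (d * (3 * Γ)) := by
          refine Finset.sum_le_sum fun i hi => ?_
          rw [Finset.mem_Ioc] at hi
          refine (hm i (by omega)).2.trans ?_
          have := hkΓ i ⟨by omega, hi.2⟩
          gcongr
      _ = k₀ * (μ₂ * (d * (3 * Γ))) := by simp
      _ ≤ 3 * ℓ * (μ₂ * (d * (3 * Γ))) := by gcongr
      _ = _ := by ring
  -- Chosen so that `n p / 2` is at least the total number of iterations plus `Γ`; then `2 ^ M (1 -
  -- p / 2) ^ n ≤ exp (-Γ) ≤ δ / 2`.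
  set n := ⌈2 / p * (9 * ℓ * μ₂ * d * Γ + Γ)⌉₊ with hn
  have hnle : (n : ℝ) ≤ C₁ * (d * Γ ^ 2 * (1 / ε * ℓ)) := by
    have hnn : 0 ≤ 2 / p * (9 * ℓ * μ₂ * d * Γ + Γ) := by
      have : 0 ≤ ℓ := by linarith
      positivity
    exact (Nat.ceil_lt_add_one hnn).le.trans
      (Halfspace.examples_le hd ha0 (by linarith) hΓ1 hε0 hε hℓ069)
  have hnge : 2 / p * (((∑ i ∈ Finset.Ioc 0 k₀, m i : ℕ) : ℝ) + Γ) ≤ n := by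
    refine le_trans ?_ (Nat.le_ceil _)
    gcongr
  have hpow := Halfspace.two_pow_mul_pow_le hp0 hp1 hδ0 hΓ2 hnge
  set G := {w : EuclideanSpace ℝ (Fin d) |
    ‖w‖ = 1 ∧ 1 - ⟪(u : EuclideanSpace ℝ (Fin d)), w⟫ ≤ ((1 / 2) ^ k₀) ^ 2 / 8} with hG
  have hGm : MeasurableSet G := by
    have h1 : MeasurableSet {w : EuclideanSpace ℝ (Fin d) | ‖w‖ = 1} :=
      measurableSet_eq_fun (by fun_prop) (by fun_prop)
    have h2 : MeasurableSet {w : EuclideanSpace ℝ (Fin d) |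
        1 - ⟪(u : EuclideanSpace ℝ (Fin d)), w⟫ ≤ ((1 / 2) ^ k₀) ^ 2 / 8} :=
      measurableSet_le (by fun_prop) (by fun_prop)
    exact h1.inter h2
  have hfail := Halfspace.failProb_run_le hd hD (p := p) hk1 hβ0 hβ12 hβ2 hμ1 hangle hδ0 hδ1 hm hb
    hnoise (hν.trans (by rw [hp]; exact le_of_eq (by ring))) hplow n
  have hEm := Halfspace.measurableSet_succeeds_stream (m := m) (b := b) hGm n k₀ 0 0
    (v₀ : EuclideanSpace ℝ (Fin d))
  refine ⟨{z | Halfspace.Succeeds m b G n k₀ 0 0 v₀ z}, hEm, ?_, ?_⟩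
  · have hc : (Measure.infinitePi fun _ : ℕ => D).real
        {z | Halfspace.Succeeds m b G n k₀ 0 0 v₀ z}ᶜ ≤ δ := by
      refine ENNReal.toReal_le_of_le_ofReal hδ0.le (hfail.trans (ENNReal.ofReal_le_ofReal ?_))
      linarith
    rw [probReal_compl_eq_one_sub hEm] at hc
    linarith
  · intro z hz
    obtain ⟨v, ⟨hv1, hvΦ⟩, n', hn', T, hT, hrun⟩ := Halfspace.passivePerceptron_of_succeeds
      (ε := ε) (δ := δ) hz
    have hn'le : (n' : ℝ) ≤ C₁ * (d * Γ ^ 2 * (1 / ε * ℓ)) :=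
      le_trans (by exact_mod_cast hn') hnle
    refine ⟨⟨v, by simpa using hv1⟩, n', T, ⟨n, hrun⟩, ?_, ?_, ?_⟩
    · exact (Halfspace.err_le (by omega) hD (u := u) (v := ⟨v, by simpa using hv1⟩)
        (by positivity) (pow_le_one₀ (by norm_num) (by norm_num)) hvΦ).trans (by linarith)
    · refine hn'le.trans (mul_le_mul_of_nonneg_right (by linarith) ?_)
      have : 0 ≤ ℓ := by linarith
      positivity
    · exact Halfspace.steps_le hd hΓ1 hε0 hε hℓ069 hkℓ hn'le hT
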